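/- Let $n\ge 1$, $d=2n+1$, and let $G=\operatorname{SO}^0(d,1)$, $K=\operatorname{SO}(d)$ or $G=\operatorname{Spin}(d,1)$, $K=\operatorname{Spin}(d)$. Let $P=MAN$ be the standard parabolic subgroup of $G$ given by an Iwasawa decomposition $G=NAK$, with $M$ the centralizer of $A$ in $K$. A parabolic subgroup $P'$ of $G$ means a conjugate of $P$; it is of the form $P'=kPk^{-1}$ with $k\in K$, and $N_{P'}=kNk^{-1}$ is its nilpotent radical, with Lie algebra $\mathfrak n_{P'}\cong\mathbb R^{2n}$. The Lie algebra of $G$ carries the inner product $\langle X,Y\rangle=-\frac{1}{2(d-1)}B(X,\theta Y)$, where $B$ is the Killing form and $\theta$ the Cartan involution, and $\mathfrak n_{P'}$ the induced one; $\log\colon N_{P'}\to\mathfrak n_{P'}$ is the inverse of $\exp$. For a discrete subgroup $\Gamma$ of $G$ of finite covolume, $P'$ is called $\Gamma$-cuspidal if $\Gamma\cap N_{P'}$ is a lattice in $N_{P'}$. Let $\mathfrak P_\Gamma$ denote a set of representatives of the $\Gamma$-conjugacy classes of $\Gamma$-cuspidal parabolic subgroups; it is finite, and $\kappa(\Gamma):=\#\mathfrak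 P_\Gamma$. Let $\Gamma_0$ be a discrete subgroup of $G$ of finite covolume and fix $\mathfrak P_{\Gamma_0}$. For each $\Gamma_0$-cuspidal $P'$ choose $\gamma'\in\Gamma_0$ with $\gamma'P'\gamma'^{-1}\in\mathfrak P_{\Gamma_0}$. For a finite-index subgroup $\Gamma_1\le\Gamma_0$ put $$\tilde\Lambda_{P'}(\Gamma_1)=\log\bigl(\gamma'(\Gamma_1\cap N_{P'})\gamma'^{-1}\bigr),\qquad \hat\Lambda_{P'}(\Gamma_1)=\operatorname{vol}(\tilde\Lambda_{P'}(\Gamma_1))^{-1/(2n)}\,\tilde\Lambda_{P'}(\Gamma_1),$$ lattices in $\mathfrak n_{\gamma'P'\gamma'^{-1}}$. For a lattice $\Lambda$ in a $2n$-dimensional Euclidean space let $C(\Lambda)$ be the constant term at $s=0$ of the Laurent expansion of the meromorphic continuation of $\zeta_\Lambda(s)=\sum_{\lambda\in\Lambda\setminus\{0\}}\|\lambda\|^{-2n(1+s)}$ (convergent for $\operatorname{Re}s>0$, with a simple pole at $s=0$), and put $$\alpha(\Gamma_1)=\sum_{P_j\in\mathfrak P_{\Gamma_1}}\frac{C(\tilde\Lambda_{P_j}(\Gamma_1))\operatorname{vol}(\tilde\Lambda_{P_j}(\Gamma_1))}{\operatorname{vol}(S^{2n-1})}.$$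 A sequence $(\Gamma_i)_{i\in\mathbb N}$ of finite-index subgroups of $\Gamma_0$ is called cusp-uniform if for each $P_0\in\mathfrak P_{\Gamma_0}$ there is a compact set $\mathcal K$ in the space $\operatorname{SO}(2n)\backslash\operatorname{SL}_{2n}(\mathbb R)/\operatorname{SL}_{2n}(\mathbb Z)$ of isometry classes of unimodular lattices in $\mathfrak n_{P_0}\cong\mathbb R^{2n}$ such that for each $\Gamma_0$-cuspidal $P'$ that is $\Gamma_0$-conjugate to $P_0$ and each $i$ the class of $\hat\Lambda_{P'}(\Gamma_i)$ belongs to $\mathcal K$. **Proposition.** Let $(\Gamma_i)_{i\in\mathbb N}$ be a sequence of normal subgroups of $\Gamma_0$ of finite index with $[\Gamma_0:\Gamma_i]\to\infty$ as $i\to\infty$, such that each $\gamma_0\in\Gamma_0$, $\gamma_0\ne1$, belongs to only finitely many $\Gamma_i$. Assume that for each $i$ one has $\Gamma_i\cap P'=\Gamma_i\cap N_{P'}$ for every $\Gamma_i$-cuspidal parabolic subgroup $P'$ of $G$. Then the sets $\mathfrak P_{\Gamma_i}$ are finite and $$\lim_{i\to\infty}\frac{\kappa(\Gamma_i)}{[\Gamma_0:\Gamma_i]}=0.$$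 If in addition the sequence $(\Gamma_i)$ is cusp-uniform, then $$\lim_{i\to\infty}\frac{|\alpha(\Gamma_i)|}{[\Gamma_0:\Gamma_i]}=0.$$ -/

import Mathlib

open Filter Topology MeasureTheory CliffordAlgebra
open scoped Pointwise

/-! ## The groups `SO⁰(d,1)` and `Spin(d,1)`, `d = 2n+1` -/

namespace HypCusp

/-- The Euclidean space `ℝ^{2n}`. -/
abbrev E (n : ℕ) : Type := EuclideanSpace ℝ (Fin (2 * n))

/-- Index set of the coordinates of `ℝ^{d+1}`, `d = 2n+1`. The coordinate `inl 0` is the time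
coordinate, `inl 1` and the `inr j` are the `d` space coordinates. -/
abbrev I (n : ℕ) : Type := Fin 2 ⊕ Fin (2 * n)

/-- The signs of the Lorentz form `-x₀² + x₁² + ... + x_d²`. -/
def sgn (n : ℕ) (i : I n) : ℝ := if i = Sum.inl 0 then -1 else 1

/-- The Gram matrix of the Lorentz form. -/
def J (n : ℕ) : Matrix (I n) (I n) ℝ := Matrix.diagonal (sgn n)

theorem sgn_mul_self (n : ℕ) (i : I n) : sgn n i * sgn n i = 1 := by
  unfold sgn; split_ifs <;> norm_num

theorem J_mul_J (n : ℕ) : J n * J n = 1 := by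
  rw [J, Matrix.diagonal_mul_diagonal, ← Matrix.diagonal_one]
  congr 1; funext i; exact sgn_mul_self n i

theorem mul_J_mul_transpose {n : ℕ} {g : Matrix (I n) (I n) ℝ}
    (hg : g.transpose * J n * g = J n) : g * J n * g.transpose = J n := by
  have h1 : (J n * g.transpose * J n) * g = 1 := by
    rw [Matrix.mul_assoc (J n), Matrix.mul_assoc (J n), hg, J_mul_J]
  have h2 : g * (J n * g.transpose * J n) = 1 := mul_eq_one_comm.mp h1
  calc g * J n * g.transpose = g * (J n * g.transpose * J n) * J n := by
        simp only [Matrix.mul_assoc, J_mul_J, Matrix.mul_one]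
    _ = J n := by rw [h2, Matrix.one_mul]

theorem time_entry_mul_pos {n : ℕ} {g h : Matrix (I n) (I n) ℝ}
    (hg : g.transpose * J n * g = J n) (hh : h.transpose * J n * h = J n)
    (hg0 : 0 < g (Sum.inl 0) (Sum.inl 0)) (hh0 : 0 < h (Sum.inl 0) (Sum.inl 0)) :
    0 < (g * h) (Sum.inl 0) (Sum.inl 0) := by
  have key : ∀ x : I n → ℝ, ∑ i, x i * sgn n i * x i = -1 →
      ∑ i ∈ Finset.univ.erase (Sum.inl 0), x i ^ 2 = x (Sum.inl 0) ^ 2 - 1 := by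
    intro x hx
    rw [← Finset.add_sum_erase _ _ (Finset.mem_univ (Sum.inl 0 : I n))] at hx
    have : ∑ i ∈ Finset.univ.erase (Sum.inl 0 : I n), x i * sgn n i * x i
        = ∑ i ∈ Finset.univ.erase (Sum.inl 0 : I n), x i ^ 2 := by
      refine Finset.sum_congr rfl fun i hi => ?_
      rw [sgn, if_neg (Finset.ne_of_mem_erase hi)]; ring
    rw [this] at hx
    simp only [sgn, if_true] at hx
    linarith
  have e1 := congrFun (congrFun (mul_J_mul_transpose hg) (Sum.inl 0)) (Sum.inl 0)
  have e2 := congrFun (congrFun hh (Sum.inl 0)) (Sum.inl 0)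
  rw [Matrix.mul_apply] at e1 e2
  simp only [J, Matrix.mul_diagonal, Matrix.transpose_apply, Matrix.diagonal_apply_eq] at e1 e2
  have s1 := key (fun i => g (Sum.inl 0) i) (by rw [e1]; simp [sgn])
  have s2 := key (fun i => h i (Sum.inl 0)) (by rw [e2]; simp [sgn])
  have cs := Finset.sum_mul_sq_le_sq_mul_sq (Finset.univ.erase (Sum.inl 0 : I n))
    (fun i => g (Sum.inl 0) i) (fun i => h i (Sum.inl 0))
  rw [s1, s2] at cs
  have p1 : 0 ≤ g (Sum.inl 0) (Sum.inl 0) ^ 2 - 1 := s1 ▸ Finset.sum_nonneg fun i _ => sq_nonneg _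
  have p2 : 0 ≤ h (Sum.inl 0) (Sum.inl 0) ^ 2 - 1 := s2 ▸ Finset.sum_nonneg fun i _ => sq_nonneg _
  rw [Matrix.mul_apply, ← Finset.add_sum_erase _ _ (Finset.mem_univ (Sum.inl 0 : I n))]
  set S := ∑ i ∈ Finset.univ.erase (Sum.inl 0 : I n), g (Sum.inl 0) i * h i (Sum.inl 0)
  have hlt : S ^ 2 < (g (Sum.inl 0) (Sum.inl 0) * h (Sum.inl 0) (Sum.inl 0)) ^ 2 := by
    rw [mul_pow]; nlinarith
  have := (abs_lt.mp (abs_lt_of_sq_lt_sq hlt (mul_pos hg0 hh0).le)).1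
  linarith

/-- `SO⁰(d,1)`: the identity component of `SO(d,1)`, i.e. the matrices of determinant one that
preserve the Lorentz form and the direction of time. -/
def SO0 (n : ℕ) : Subgroup (Matrix.SpecialLinearGroup (I n) ℝ) where
  carrier := {g | g.1.transpose * J n * g.1 = J n ∧ 0 < g.1 (Sum.inl 0) (Sum.inl 0)}
  one_mem' := by simp
  mul_mem' := by
    rintro g h ⟨hg, hg0⟩ ⟨hh, hh0⟩
    refine ⟨?_, time_entry_mul_pos hg hh hg0 hh0⟩
    rw [Matrix.SpecialLinearGroup.coe_mul, Matrix.transpose_mul]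
    calc h.1.transpose * g.1.transpose * J n * (g.1 * h.1)
        = h.1.transpose * (g.1.transpose * J n * g.1) * h.1 := by simp only [Matrix.mul_assoc]
      _ = J n := by rw [hg, hh]
  inv_mem' := by
    rintro g ⟨hg, hg0⟩
    have hinv : (g⁻¹).1 = J n * g.1.transpose * J n := by
      have h1 : (J n * g.1.transpose * J n) * g.1 = 1 := by
        rw [Matrix.mul_assoc (J n), Matrix.mul_assoc (J n), hg, J_mul_J]
      have h3 : g.1 * (g⁻¹).1 = 1 := by
        rw [← Matrix.SpecialLinearGroup.coe_mul, mul_inv_cancel, Matrix.SpecialLinearGroup.coe_one]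
      calc (g⁻¹).1 = (J n * g.1.transpose * J n) * (g.1 * (g⁻¹).1) := by
            rw [← Matrix.mul_assoc, h1, Matrix.one_mul]
        _ = _ := by rw [h3, Matrix.mul_one]
    have hJt : (J n).transpose = J n := Matrix.diagonal_transpose _
    refine ⟨?_, ?_⟩
    · rw [hinv, Matrix.transpose_mul, Matrix.transpose_mul, Matrix.transpose_transpose, hJt]
      calc J n * (g.1 * J n) * J n * (J n * g.1.transpose * J n)
          = J n * (g.1 * J n * (J n * J n) * g.1.transpose) * J n := by
            simp only [Matrix.mul_assoc]
        _ = J n := by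
            rw [J_mul_J, Matrix.mul_one, mul_J_mul_transpose hg, J_mul_J, Matrix.one_mul]
    · rw [hinv]
      simp only [J, Matrix.mul_diagonal, Matrix.diagonal_mul, Matrix.transpose_apply]
      simpa [sgn] using hg0

/-- A Lorentz isometry that is a square in the Lorentz group and has positive time entry. -/
def SO0.mk {n : ℕ} (M L : Matrix (I n) (I n) ℝ) (hL : L.transpose * J n * L = J n)
    (hM : M = L * L) (h0 : 0 < M (Sum.inl 0) (Sum.inl 0)) : SO0 n :=
  ⟨⟨M, by
    have h := congrArg Matrix.det hL
    have hJ : (J n).det ≠ 0 := by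
      intro h0
      have := congrArg Matrix.det (J_mul_J n)
      rw [Matrix.det_mul, h0, Matrix.det_one] at this
      norm_num at this
    rw [Matrix.det_mul, Matrix.det_mul, Matrix.det_transpose] at h
    rw [hM, Matrix.det_mul]
    apply mul_right_cancel₀ hJ
    linarith⟩, by
    refine ⟨?_, h0⟩
    change M.transpose * J n * M = J n
    rw [hM, Matrix.transpose_mul]
    calc L.transpose * L.transpose * J n * (L * L)
        = L.transpose * (L.transpose * J n * L) * L := by simp only [Matrix.mul_assoc]
      _ = J n := by rw [hL, hL]⟩

/-- The matrix `exp (t H₁)`, where `H₁ = E₁₂ + E₂₁`. -/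
noncomputable def boostMatrix (n : ℕ) (t : ℝ) : Matrix (I n) (I n) ℝ :=
  Matrix.fromBlocks !![Real.cosh t, Real.sinh t; Real.sinh t, Real.cosh t] 0 0 1

/-- The matrix `exp (X(v)) = 1 + X(v) + X(v)²/2`, where `X(v)` is the matrix with rows
`(0, 0, vᵗ)`, `(0, 0, vᵗ)`, `(v, -v, 0)`. -/
noncomputable def unipMatrix (n : ℕ) (v : E n) : Matrix (I n) (I n) ℝ :=
  Matrix.fromBlocks
    !![1 + ‖v‖ ^ 2 / 2, -(‖v‖ ^ 2 / 2); ‖v‖ ^ 2 / 2, 1 - ‖v‖ ^ 2 / 2]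
    (Matrix.of fun _ j => v j)
    (Matrix.of fun i j => if j = 0 then v i else -v i)
    1

theorem boostMatrix_add (n : ℕ) (s t : ℝ) :
    boostMatrix n (s + t) = boostMatrix n s * boostMatrix n t := by
  rw [boostMatrix, boostMatrix, boostMatrix, Matrix.fromBlocks_multiply]
  congr 1
  · ext i j
    fin_cases i <;> fin_cases j <;> simp [Real.cosh_add, Real.sinh_add] <;> ring
  · simp
  · simp
  · simp

theorem norm_sq_add_eq (n : ℕ) (v w : E n) :
    ‖v + w‖ ^ 2 = ‖v‖ ^ 2 + 2 * ∑ i, v i * w i + ‖w‖ ^ 2 := by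
  rw [norm_add_sq_real, PiLp.inner_apply]
  simp [mul_comm]

theorem unipMatrix_add (n : ℕ) (v w : E n) :
    unipMatrix n (v + w) = unipMatrix n v * unipMatrix n w := by
  rw [unipMatrix, unipMatrix, unipMatrix, Matrix.fromBlocks_multiply]
  congr 1
  · ext i j
    fin_cases i <;> fin_cases j <;>
      simp [norm_sq_add_eq, Matrix.mul_apply] <;> ring
  · ext i j
    fin_cases i <;> simp [Matrix.vecHead, Matrix.vecTail] <;> ring
  · ext i j
    fin_cases j <;> simp [Matrix.mul_apply, Fin.sum_univ_two] <;> ring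
  · ext i j
    simp [Matrix.mul_apply, Fin.sum_univ_two]

theorem unipMatrix_zero (n : ℕ) : unipMatrix n 0 = 1 := by
  rw [unipMatrix, ← Matrix.fromBlocks_one]
  congr 1
  · ext i j
    fin_cases i <;> fin_cases j <;> simp
  · ext i j; simp

theorem boostMatrix_zero (n : ℕ) : boostMatrix n 0 = 1 := by
  rw [boostMatrix, ← Matrix.fromBlocks_one]
  congr 1
  ext i j
  fin_cases i <;> fin_cases j <;> simp

theorem boostMatrix_isometry (n : ℕ) (t : ℝ) :
    (boostMatrix n t).transpose * J n * boostMatrix n t = J n := by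
  have h : (boostMatrix n t).transpose * J n = J n * boostMatrix n (-t) := by
    ext i j
    rw [J, Matrix.mul_diagonal, Matrix.diagonal_mul]
    rcases i with i | i <;> rcases j with j | j
    · fin_cases i <;> fin_cases j <;> simp [boostMatrix, sgn]
    · simp [boostMatrix]
    · simp [boostMatrix]
    · simp [boostMatrix, sgn, Matrix.one_apply, eq_comm]
  rw [h, Matrix.mul_assoc, ← boostMatrix_add, neg_add_cancel, boostMatrix_zero, Matrix.mul_one]

theorem unipMatrix_isometry (n : ℕ) (v : E n) :
    (unipMatrix n v).transpose * J n * unipMatrix n v = J n := by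
  have h : (unipMatrix n v).transpose * J n = J n * unipMatrix n (-v) := by
    ext i j
    rw [J, Matrix.mul_diagonal, Matrix.diagonal_mul]
    rcases i with i | i <;> rcases j with j | j
    · fin_cases i <;> fin_cases j <;> simp [unipMatrix, sgn]
    · fin_cases i <;> simp [unipMatrix, sgn]
    · fin_cases j <;> simp [unipMatrix, sgn]
    · simp [unipMatrix, sgn, Matrix.one_apply, eq_comm]
  rw [h, Matrix.mul_assoc, ← unipMatrix_add, neg_add_cancel, unipMatrix_zero, Matrix.mul_one]

/-- `exp (t H₁)` as an element of `SO⁰(d,1)`. -/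
noncomputable def SO0.boost (n : ℕ) (t : ℝ) : SO0 n :=
  SO0.mk (boostMatrix n t) (boostMatrix n (t / 2)) (boostMatrix_isometry n _)
    (by rw [← boostMatrix_add, add_halves]) (by simp [boostMatrix, Real.cosh_pos])

/-- `exp (X(v))` as an element of `SO⁰(d,1)`. -/
noncomputable def SO0.unip (n : ℕ) (v : E n) : SO0 n :=
  SO0.mk (unipMatrix n v) (unipMatrix n ((1 / 2 : ℝ) • v)) (unipMatrix_isometry n _)
    (by rw [← unipMatrix_add, ← add_smul]; norm_num)
    (by
      have : 0 < 1 + ‖v‖ ^ 2 / 2 := by positivity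
      simpa [unipMatrix] using this)

/-- The Lorentz form as a quadratic form on `ℝ^{d+1}`. -/
noncomputable def Q (n : ℕ) : QuadraticForm ℝ (I n → ℝ) :=
  QuadraticMap.weightedSumSquares ℝ (sgn n)

/-- The group `Spin(d,1)`: products of an even number of vectors in the Clifford algebra of the
Lorentz form with spinor norm one (the connected double covering of `SO⁰(d,1)`). -/
abbrev SpinG (n : ℕ) : Type := spinGroup (Q n)

/-- The topology of `Spin(d,1)`, induced by the canonical topology of the finite dimensional real
vector space in which it lies. -/
noncomputable instance (n : ℕ) : TopologicalSpace (SpinG n) :=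
  TopologicalSpace.induced Subtype.val (moduleTopology ℝ (CliffordAlgebra (Q n)))

/-- The unit time vector. -/
def e0 (n : ℕ) : I n → ℝ := Pi.single (Sum.inl 0) 1

/-- The first unit space vector. -/
def e1 (n : ℕ) : I n → ℝ := Pi.single (Sum.inl 1) 1

/-- The inclusion of `ℝ^{2n}` in `ℝ^{d+1}` as the orthogonal complement of the first two
coordinates. -/
def vec {n : ℕ} (v : E n) : I n → ℝ := Sum.elim 0 v

theorem Q_apply (n : ℕ) (x : I n → ℝ) :
    Q n x = -(x (Sum.inl 0) * x (Sum.inl 0)) + x (Sum.inl 1) * x (Sum.inl 1)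
      + ∑ j, x (Sum.inr j) * x (Sum.inr j) := by
  simp [Q, QuadraticMap.weightedSumSquares_apply, sgn]

theorem Q_vec {n : ℕ} (v : E n) : Q n (vec v) = ‖v‖ ^ 2 := by
  rw [Q_apply, EuclideanSpace.real_norm_sq_eq]
  simp [vec, pow_two]

theorem mul_mem_spin {n : ℕ} (x y : I n → ℝ) (h : Q n x * Q n y = 1) :
    ι (Q n) x * ι (Q n) y ∈ spinGroup (Q n) := by
  have hx : Q n x ≠ 0 := left_ne_zero_of_mul_eq_one h
  have hy : Q n y ≠ 0 := right_ne_zero_of_mul_eq_one h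
  have unit : ∀ z : I n → ℝ, Q n z ≠ 0 →
      ∃ u ∈ lipschitzGroup (Q n), (u : CliffordAlgebra (Q n)) = ι (Q n) z := by
    intro z hz
    have e : ι (Q n) z * ((Q n z)⁻¹ • ι (Q n) z) = 1 := by
      rw [mul_smul_comm, ι_sq_scalar, Algebra.algebraMap_eq_smul_one, smul_smul,
        inv_mul_cancel₀ hz, one_smul]
    have e' : ((Q n z)⁻¹ • ι (Q n) z) * ι (Q n) z = 1 := by
      rw [smul_mul_assoc, ι_sq_scalar, Algebra.algebraMap_eq_smul_one, smul_smul,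
        inv_mul_cancel₀ hz, one_smul]
    exact ⟨⟨_, _, e, e'⟩, Subgroup.subset_closure ⟨z, rfl⟩, rfl⟩
  obtain ⟨u, hu, hu'⟩ := unit x hx
  obtain ⟨w, hw, hw'⟩ := unit y hy
  refine ⟨⟨⟨u * w, mul_mem hu hw, ?_⟩, ?_⟩, ι_mul_ι_mem_evenOdd_zero _ _ _⟩
  · simp [hu', hw']
  · have hs : star (ι (Q n) x * ι (Q n) y) = ι (Q n) y * ι (Q n) x := by
      rw [star_mul, star_ι, star_ι, neg_mul_neg]
    refine Unitary.mem_iff.mpr ?_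
    rw [hs]
    constructor
    · rw [mul_assoc, ← mul_assoc (ι (Q n) x) (ι (Q n) x), ι_sq_scalar, Algebra.commutes,
        ← mul_assoc, ι_sq_scalar, ← map_mul, mul_comm, h, map_one]
    · rw [mul_assoc, ← mul_assoc (ι (Q n) y) (ι (Q n) y), ι_sq_scalar, Algebra.commutes,
        ← mul_assoc, ι_sq_scalar, ← map_mul, h, map_one]

theorem Q_e0 (n : ℕ) : Q n (e0 n) = -1 := by rw [Q_apply]; simp [e0]

theorem Q_e1 (n : ℕ) : Q n (e1 n) = 1 := by rw [Q_apply]; simp [e1]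

theorem Q_null (n : ℕ) : Q n (e0 n + e1 n) = 0 := by rw [Q_apply]; simp [e0, e1]

/-- The element `exp (t H₁) = cosh (t/2) + sinh (t/2) e₀ e₁` of `Spin(d,1)`. It covers
`SO0.boost n t`. -/
noncomputable def spinBoost (n : ℕ) (t : ℝ) : SpinG n :=
  ⟨algebraMap ℝ _ (Real.cosh (t / 2)) + Real.sinh (t / 2) • (ι (Q n) (e0 n) * ι (Q n) (e1 n)), by
    have hQ : Q n (Real.cosh (t / 2) • e1 n + Real.sinh (t / 2) • e0 n) = 1 := by
      rw [Q_apply]; simp [e0, e1]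
      nlinarith [Real.cosh_sq_sub_sinh_sq (t / 2)]
    have := mul_mem_spin (Real.cosh (t / 2) • e1 n + Real.sinh (t / 2) • e0 n) (e1 n)
      (by rw [hQ, Q_e1, one_mul])
    rw [map_add, map_smul, map_smul, add_mul, smul_mul_assoc, smul_mul_assoc, ι_sq_scalar, Q_e1,
      map_one] at this
    rwa [Algebra.algebraMap_eq_smul_one]⟩

theorem isOrtho_null_vec {n : ℕ} (v : E n) : (Q n).IsOrtho (e0 n + e1 n) (vec v) := by
  rw [QuadraticMap.isOrtho_def, Q_apply, Q_apply, Q_apply]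
  simp [e0, e1, vec]

/-- The element `exp (X(v)) = 1 + (e₀ + e₁) v / 2` of `Spin(d,1)`. It covers `SO0.unip n v`. -/
noncomputable def spinUnip (n : ℕ) (v : E n) : SpinG n :=
  ⟨1 + (1 / 2 : ℝ) • (ι (Q n) (e0 n + e1 n) * ι (Q n) (vec v)), by
    by_cases hv : v = 0
    · have : vec v = 0 := by subst hv; funext i; rcases i with i | i <;> simp [vec]
      rw [this, map_zero, mul_zero, smul_zero, add_zero]
      exact one_mem _
    have hn : ‖v‖ ^ 2 ≠ 0 := by simpa using hv
    have hQ : Q n ((‖v‖ ^ 2)⁻¹ • vec v + (1 / 2 : ℝ) • (e0 n + e1 n)) = (‖v‖ ^ 2)⁻¹ := by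
      have ho : (Q n).IsOrtho ((‖v‖ ^ 2)⁻¹ • vec v) ((1 / 2 : ℝ) • (e0 n + e1 n)) := by
        rw [QuadraticMap.isOrtho_def, Q_apply, Q_apply, Q_apply]
        simp [e0, e1, vec]
      rw [QuadraticMap.isOrtho_def] at ho
      rw [ho, QuadraticMap.map_smul, QuadraticMap.map_smul, Q_null, Q_vec]
      simp only [smul_eq_mul, mul_zero, add_zero]
      field_simp
    have := mul_mem_spin _ (vec v) (by rw [hQ, Q_vec, inv_mul_cancel₀ hn])
    rwa [map_add, map_smul, map_smul, add_mul, smul_mul_assoc, smul_mul_assoc, ι_sq_scalar, Q_vec,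
      Algebra.algebraMap_eq_smul_one, smul_smul, inv_mul_cancel₀ hn, one_smul] at this⟩

theorem spinUnip_add (n : ℕ) (v w : E n) : spinUnip n (v + w) = spinUnip n v * spinUnip n w := by
  apply Subtype.ext
  change (1 + (1 / 2 : ℝ) • (ι (Q n) (e0 n + e1 n) * ι (Q n) (vec (v + w))) :
      CliffordAlgebra (Q n)) =
    (1 + (1 / 2 : ℝ) • (ι (Q n) (e0 n + e1 n) * ι (Q n) (vec v))) *
      (1 + (1 / 2 : ℝ) • (ι (Q n) (e0 n + e1 n) * ι (Q n) (vec w)))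
  have hv : vec (v + w) = vec v + vec w := by
    funext i; rcases i with i | i <;> simp [vec]
  have hz : ι (Q n) (e0 n + e1 n) * ι (Q n) (vec v) *
      (ι (Q n) (e0 n + e1 n) * ι (Q n) (vec w)) = 0 := by
    rw [ι_mul_ι_comm_of_isOrtho (isOrtho_null_vec v), neg_mul, mul_assoc,
      ← mul_assoc (ι (Q n) (e0 n + e1 n)) (ι (Q n) (e0 n + e1 n)), ι_sq_scalar, Q_null]
    simp
  rw [hv, map_add (ι (Q n)) (vec v), mul_add (ι (Q n) (e0 n + e1 n)), smul_add, add_mul, mul_add, mul_add, one_mul,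
    one_mul, mul_one, smul_mul_smul_comm, hz, smul_zero, add_zero]
  abel

theorem spinUnip_zero (n : ℕ) : spinUnip n 0 = 1 := by
  have h := spinUnip_add n 0 0
  rw [add_zero] at h
  exact left_eq_mul.mp h

/-! ## Parabolic subgroups, lattices and cusps -/

/-- A topological group `G` with the data of an Iwasawa decomposition `G = N A K`: the maximal
compact subgroup `K`, the one-parameter group `a` with `A = a(ℝ)`, and an isometric identification
`u` of `ℝ^{2n}` with `N`, where `N` carries the norm of its Lie algebra through `exp`.
It is used for the two groups `lorentzGroup n` and `spinLorentzGroup n` below only. -/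
structure IwasawaGroup (n : ℕ) where
  G : Type
  [group : Group G]
  [top : TopologicalSpace G]
  K : Subgroup G
  a : ℝ → G
  u : Multiplicative (E n) →* G

attribute [instance] IwasawaGroup.group IwasawaGroup.top

/-- `G = SO⁰(d,1)` with `K = SO(d)` (the stabiliser of the time vector), `a(t) = exp (t H₁)` and
`u(w) = exp (X(w/√2))`. The norm on the Lie algebra is the one of
`⟨X, Y⟩ = -B(X, θ Y) / (2(d-1)) = tr (X Yᵗ) / 2`, `B` the Killing form, so that `‖H₁‖ = 1` and
`‖X(v)‖ = √2 ‖v‖`; thus `w ↦ X(w/√2)` is an isometry. -/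
noncomputable def lorentzGroup (n : ℕ) : IwasawaGroup n where
  G := SO0 n
  K :=
    { carrier := {g | g.1.1.mulVec (e0 n) = e0 n}
      one_mem' := by simp
      mul_mem' := by
        intro g h hg hh
        change (g.1.1 * h.1.1).mulVec (e0 n) = e0 n
        rw [← Matrix.mulVec_mulVec, show h.1.1.mulVec (e0 n) = e0 n from hh]
        exact hg
      inv_mem' := by
        intro g hg
        have h1 : (g⁻¹).1.1 * g.1.1 = 1 := by
          have := congrArg (fun x : SO0 n => x.1.1) (inv_mul_cancel g)
          exact this
        change (g⁻¹).1.1.mulVec (e0 n) = e0 n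
        have hg' : g.1.1.mulVec (e0 n) = e0 n := hg
        calc (g⁻¹).1.1.mulVec (e0 n) = (g⁻¹).1.1.mulVec (g.1.1.mulVec (e0 n)) := by rw [hg']
          _ = e0 n := by rw [Matrix.mulVec_mulVec, h1, Matrix.one_mulVec] }
  a := SO0.boost n
  u :=
    { toFun := fun w => SO0.unip n ((Real.sqrt 2)⁻¹ • w.toAdd)
      map_one' := by
        apply Subtype.ext; apply Subtype.ext
        change unipMatrix n ((Real.sqrt 2)⁻¹ • (0 : E n)) = 1
        rw [smul_zero, unipMatrix_zero]
      map_mul' := by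
        intro v w
        apply Subtype.ext; apply Subtype.ext
        change unipMatrix n ((Real.sqrt 2)⁻¹ • (v.toAdd + w.toAdd)) =
          unipMatrix n ((Real.sqrt 2)⁻¹ • v.toAdd) * unipMatrix n ((Real.sqrt 2)⁻¹ • w.toAdd)
        rw [smul_add, unipMatrix_add] }

/-- `G = Spin(d,1)` with `K = Spin(d)` (the stabiliser of the time vector),
`a(t) = exp (t H₁)` and `u(w) = exp (X(w/√2))`, normalised as for `SO⁰(d,1)`. -/
noncomputable def spinLorentzGroup (n : ℕ) : IwasawaGroup n where
  G := SpinG n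
  K :=
    { carrier := {g | (g : CliffordAlgebra (Q n)) * ι (Q n) (e0 n) = ι (Q n) (e0 n) * g}
      one_mem' := by simp
      mul_mem' := by
        intro g h hg hh
        have hg' : (g : CliffordAlgebra (Q n)) * ι (Q n) (e0 n) = ι (Q n) (e0 n) * g := hg
        have hh' : (h : CliffordAlgebra (Q n)) * ι (Q n) (e0 n) = ι (Q n) (e0 n) * h := hh
        change (g * h : CliffordAlgebra (Q n)) * ι (Q n) (e0 n) = ι (Q n) (e0 n) * (g * h)
        rw [mul_assoc, hh', ← mul_assoc, hg', mul_assoc]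
      inv_mem' := by
        intro g hg
        have hg' : (g : CliffordAlgebra (Q n)) * ι (Q n) (e0 n) = ι (Q n) (e0 n) * g := hg
        have h1 : (g⁻¹ : SpinG n).1 * g.1 = 1 := spinGroup.coe_star_mul_self g
        have h2 : g.1 * (g⁻¹ : SpinG n).1 = 1 := spinGroup.coe_mul_star_self g
        change (g⁻¹ : SpinG n).1 * ι (Q n) (e0 n) = ι (Q n) (e0 n) * (g⁻¹ : SpinG n).1
        calc (g⁻¹ : SpinG n).1 * ι (Q n) (e0 n)
            = (g⁻¹ : SpinG n).1 * (ι (Q n) (e0 n) * g.1) * (g⁻¹ : SpinG n).1 := by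
              rw [mul_assoc, mul_assoc, h2, mul_one]
          _ = (g⁻¹ : SpinG n).1 * g.1 * ι (Q n) (e0 n) * (g⁻¹ : SpinG n).1 := by
              rw [← hg', mul_assoc (g⁻¹ : SpinG n).1 g.1]
          _ = ι (Q n) (e0 n) * (g⁻¹ : SpinG n).1 := by rw [h1, one_mul] }
  a := spinBoost n
  u :=
    { toFun := fun w => spinUnip n ((Real.sqrt 2)⁻¹ • w.toAdd)
      map_one' := by
        change spinUnip n ((Real.sqrt 2)⁻¹ • (0 : E n)) = 1
        rw [smul_zero, spinUnip_zero]
      map_mul' := by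
        intro v w
        change spinUnip n ((Real.sqrt 2)⁻¹ • (v.toAdd + w.toAdd)) = _
        rw [smul_add, spinUnip_add] }

/-- A lattice in a topological group: a discrete subgroup `Γ` with `vol (Γ \ G) < ∞`. -/
def IsLattice {G : Type} [Group G] [TopologicalSpace G] (Γ : Subgroup G) : Prop :=
  DiscreteTopology Γ ∧
    letI : MeasurableSpace G := borel G
    ∃ μ : Measure G, μ.IsHaarMeasure ∧ ∃ F : Set G, IsFundamentalDomain Γ F μ ∧ μ F < ⊤

/-- The conjugate `g H g⁻¹`. -/
def conj {G : Type} [Group G] (g : G) (H : Subgroup G) : Subgroup G :=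
  H.map (MulAut.conj g).toMonoidHom

namespace IwasawaGroup

variable {n : ℕ} (S : IwasawaGroup n)

/-- The subgroup `N`. -/
def N : Subgroup S.G := S.u.range

/-- The subgroup `A`. -/
def A : Subgroup S.G := Subgroup.closure (Set.range S.a)

/-- The subgroup `M`, the centraliser of `A` in `K`. -/
def M : Subgroup S.G := Subgroup.centralizer (S.A : Set S.G) ⊓ S.K

/-- The standard parabolic subgroup `P = M A N`. -/
def P : Subgroup S.G := S.M ⊔ S.A ⊔ S.N

/-- The (proper) parabolic subgroups of `G`: the conjugates of `P`. -/
def IsParabolic (P' : Subgroup S.G) : Prop := ∃ g : S.G, P' = conj g S.P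

open Classical in
/-- A choice of an element `k` of `K` with `P' = k P k⁻¹`. -/
noncomputable def frame (P' : Subgroup S.G) : S.G :=
  if h : ∃ k ∈ S.K, P' = conj k S.P then h.choose else 1

/-- The nilpotent radical `N_{P'} = k N k⁻¹` of `P' = k P k⁻¹`. -/
noncomputable def nilradical (P' : Subgroup S.G) : Subgroup S.G := conj (S.frame P') S.N

/-- `log (Γ ∩ N_{P'})`, seen in `ℝ^{2n}` through the isometry
`w ↦ Ad(k) X(w/√2)` of `ℝ^{2n}` with the Lie algebra of `N_{P'}`, where `P' = k P k⁻¹`. -/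
noncomputable def cuspLattice (Γ P' : Subgroup S.G) : Submodule ℤ (E n) :=
  AddSubgroup.toIntSubmodule
    { carrier := {w | S.frame P' * S.u (Multiplicative.ofAdd w) * (S.frame P')⁻¹ ∈ Γ}
      zero_mem' := by simp
      add_mem' := by
        intro v w hv hw
        have := Γ.mul_mem hv hw
        simpa [mul_assoc] using this
      neg_mem' := by
        intro v hv
        have := Γ.inv_mem hv
        simpa [mul_assoc] using this }

/-- `P'` is a `Γ`-cuspidal parabolic subgroup: `Γ ∩ N_{P'}` is a lattice in `N_{P'}`. As
`exp` is an isomorphism of Lie groups from the Lie algebra of `N_{P'}` to `N_{P'}`, this says that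
`log (Γ ∩ N_{P'})` is a discrete subgroup which spans the Lie algebra. -/
def IsCuspidal (Γ P' : Subgroup S.G) : Prop :=
  S.IsParabolic P' ∧ DiscreteTopology (S.cuspLattice Γ P') ∧
    Submodule.span ℝ (S.cuspLattice Γ P' : Set (E n)) = ⊤

/-- `R` is a set of representatives of the `Γ`-conjugacy classes of `Γ`-cuspidal parabolic
subgroups. -/
def IsCuspReps (Γ : Subgroup S.G) (R : Set (Subgroup S.G)) : Prop :=
  (∀ P' ∈ R, S.IsCuspidal Γ P') ∧
    ∀ P', S.IsCuspidal Γ P' → ∃! P₀, P₀ ∈ R ∧ ∃ γ ∈ Γ, conj γ P' = P₀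

/-- The parabolic condition: `Γ ∩ P' = Γ ∩ N_{P'}` for each `Γ`-cuspidal parabolic `P'`. -/
def ParabolicCondition (Γ : Subgroup S.G) : Prop :=
  ∀ P', S.IsCuspidal Γ P' → Γ ⊓ P' = Γ ⊓ S.nilradical P'

open Classical in
/-- A choice of an element `γ'` of `Γ₀` with `γ' P' γ'⁻¹ ∈ R₀`. -/
noncomputable def toRep (Γ₀ : Subgroup S.G) (R₀ : Set (Subgroup S.G)) (P' : Subgroup S.G) : S.G :=
  if h : ∃ γ ∈ Γ₀, conj γ P' ∈ R₀ then h.choose else 1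

/-- The lattice `log (γ' (Γ₁ ∩ N_{P'}) γ'⁻¹)` in the Lie algebra of `N_{P₀}`, where
`P₀ = γ' P' γ'⁻¹` is the chosen representative of the `Γ₀`-conjugacy class of `P'`. -/
noncomputable def tildeLattice (Γ₀ : Subgroup S.G) (R₀ : Set (Subgroup S.G))
    (Γ₁ P' : Subgroup S.G) : Submodule ℤ (E n) :=
  S.cuspLattice (conj (S.toRep Γ₀ R₀ P') Γ₁) (conj (S.toRep Γ₀ R₀ P') P')

end IwasawaGroup

/-! ## Epstein zeta functions and the constant `α` -/

/-- The Epstein zeta function `∑_{λ ∈ Λ, λ ≠ 0} ‖λ‖^{-2n(1+s)}`, convergent for `Re s > 0`. -/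
noncomputable def epsteinZeta {n : ℕ} (Λ : Submodule ℤ (E n)) (s : ℂ) : ℂ :=
  ∑' x : {x : Λ // x ≠ 0}, ((‖(x.1 : E n)‖ : ℝ) : ℂ) ^ (-(2 * n * (1 + s)))

/-- `c` is the constant term at `s = 0` of the Laurent expansion of the meromorphic continuation
of the Epstein zeta function, which has a simple pole there. -/
def IsEpsteinConst {n : ℕ} (Λ : Submodule ℤ (E n)) (c : ℂ) : Prop :=
  ∃ f : ℂ → ℂ, Meromorphic f ∧ (∀ s : ℂ, 0 < s.re → f s = epsteinZeta Λ s) ∧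
    ∃ r : ℂ, Tendsto (fun s => f s - r / s) (𝓝[≠] 0) (𝓝 c)

open Classical in
/-- The constant term `C(Λ)`. -/
noncomputable def epsteinConst {n : ℕ} (Λ : Submodule ℤ (E n)) : ℂ :=
  if h : ∃ c, IsEpsteinConst Λ c then h.choose else 0

/-- The volume of the unit sphere `S^{2n-1}` of `ℝ^{2n}`. -/
noncomputable def sphereVol (n : ℕ) : ℝ := ((volume : Measure (E n)).toSphere Set.univ).toReal

/-- `α(Γ₁) = ∑_j C(Λ̃_{P_j}(Γ₁)) vol(Λ̃_{P_j}(Γ₁)) / vol(S^{2n-1})`, where the `P_j` run through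
the set `R₁` of representatives of the `Γ₁`-conjugacy classes of cuspidal parabolic subgroups. -/
noncomputable def IwasawaGroup.alpha {n : ℕ} (S : IwasawaGroup n)
    (Γ₀ : Subgroup S.G) (R₀ : Set (Subgroup S.G)) (Γ₁ : Subgroup S.G)
    (R₁ : Set (Subgroup S.G)) : ℂ :=
  ∑ᶠ P' ∈ R₁, epsteinConst (S.tildeLattice Γ₀ R₀ Γ₁ P') *
    (ZLattice.covolume (S.tildeLattice Γ₀ R₀ Γ₁ P') : ℂ) / (sphereVol n : ℂ)

/-! ## Cusp-uniformity -/

/-- `SO(m)` as a subgroup of `SL_m(ℝ)`. -/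
def SOm (m : ℕ) : Subgroup (Matrix.SpecialLinearGroup (Fin m) ℝ) :=
  { (Matrix.orthogonalGroup (Fin m) ℝ).comap Matrix.SpecialLinearGroup.coeMonoidHom with
    inv_mem' := by
      intro g hg
      have hg' : star g.1 * g.1 = 1 := (Matrix.mem_orthogonalGroup_iff' _ _).mp hg
      have h1 : g.1 * (g⁻¹).1 = 1 := by
        rw [← Matrix.SpecialLinearGroup.coe_mul, mul_inv_cancel, Matrix.SpecialLinearGroup.coe_one]
      have h2 : (g⁻¹).1 = star g.1 := by
        rw [← one_mul (g⁻¹).1, ← hg', mul_assoc, h1, mul_one]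
      change (g⁻¹).1 ∈ Matrix.orthogonalGroup (Fin m) ℝ
      rw [h2]
      exact Unitary.star_mem hg }

/-- The space `SO(m) \ SL_m(ℝ) / SL_m(ℤ)` of isometry classes of unimodular lattices in `ℝ^m`, with
the quotient topology. -/
abbrev UnimodularClasses (m : ℕ) : Type :=
  _root_.Quotient (DoubleCoset.setoid (SOm m : Set (Matrix.SpecialLinearGroup (Fin m) ℝ))
    ((Matrix.SpecialLinearGroup.map (n := Fin m) (Int.castRingHom ℝ)).range :
      Set (Matrix.SpecialLinearGroup (Fin m) ℝ)))

/-- The isometry class of the lattice `g ℤ^m`. -/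
def unimodularClass {m : ℕ} (g : Matrix.SpecialLinearGroup (Fin m) ℝ) : UnimodularClasses m :=
  _root_.Quotient.mk _ g

/-- The lattice `g ℤ^m`. -/
def matrixLattice {m : ℕ} (g : Matrix.SpecialLinearGroup (Fin m) ℝ) :
    Set (EuclideanSpace ℝ (Fin m)) :=
  Set.range fun z : Fin m → ℤ => WithLp.toLp 2 (g.1.mulVec fun j => (z j : ℝ))

/-- The unimodular lattice `vol(Λ̃_{P'}(Γ₁))^{-1/(2n)} Λ̃_{P'}(Γ₁)`. -/
noncomputable def IwasawaGroup.hatLattice {n : ℕ} (S : IwasawaGroup n)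
    (Γ₀ : Subgroup S.G) (R₀ : Set (Subgroup S.G)) (Γ₁ P' : Subgroup S.G) : Set (E n) :=
  (ZLattice.covolume (S.tildeLattice Γ₀ R₀ Γ₁ P') ^ (-(1 / (2 * n : ℝ))) : ℝ) •
    (S.tildeLattice Γ₀ R₀ Γ₁ P' : Set (E n))

/-- The sequence `Γ` of finite index subgroups of `Γ₀` is cusp-uniform: for each representative
`P₀ ∈ R₀` there is a compact set of isometry classes of unimodular lattices that contains the class
of the normalised lattice of `Γ i` at each cuspidal `P'` that is `Γ₀`-conjugate to `P₀`. -/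
def IwasawaGroup.CuspUniform {n : ℕ} (S : IwasawaGroup n)
    (Γ₀ : Subgroup S.G) (R₀ : Set (Subgroup S.G)) (Γ : ℕ → Subgroup S.G) : Prop :=
  ∀ P₀ ∈ R₀, ∃ C : Set (UnimodularClasses (2 * n)), IsCompact C ∧
    ∀ P', S.IsCuspidal Γ₀ P' → conj (S.toRep Γ₀ R₀ P') P' = P₀ →
      ∀ i, ∃ g : Matrix.SpecialLinearGroup (Fin (2 * n)) ℝ,
        S.hatLattice Γ₀ R₀ (Γ i) P' = matrixLattice g ∧ unimodularClass g ∈ C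

end HypCusp

/-!
Both groups act on Minkowski space `ℝ^{d,1}`, and everything about them that matters here is
collected in the structure `LorentzModel`, of which `lorentzModel` and `spinLorentzModel` are the
two instances. The parabolic subgroups are the stabilisers of the null lines: `mem_P_of_fixed` shows
that an element which fixes the line of `ξ = e₀ + e₁` lies in `P = M A N`, and `exists_K_mul_P` is
the decomposition `G = K P`.

*Finiteness.* By Shimizu's lemma (`LorentzModel.shimizu`), if a discrete group contains `u(v)` and
`h u(w) h⁻¹`, both nontrivial and close to the identity, then `h ∈ P`: iterated conjugation of
`u(v)` converges to `u(v)`, hence is eventually constant, and a nontrivial unipotent element fixes only one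
null line. Scale a frame `g` of each cusp of `Γ_i` by an element of `A` so that the shortest
translation in the cusp has a fixed length. For a small neighbourhood `W` of the identity the
translates `γ g W`, over all `γ ∈ Γ_i` and all inequivalent cusps, are then disjoint; the condition
`Γ_i ∩ P' = Γ_i ∩ N_{P'}` excludes the remaining elements of the stabiliser of a cusp. The volume of
`Γ_i \ G` is finite, so there are finitely many cusps (`LorentzModel.finite_cusps`).

*Counting.* Let `P₀` be a cusp of `Γ₀` and `D_i(P₀) = [Γ₀ ∩ N_{P₀} : Γ_i ∩ N_{P₀}]`. As `Γ_i` is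
normal, the cusps of `Γ_i` over `P₀` times the cosets counted by `D_i(P₀)` inject into `Γ₀ / Γ_i`
(`LorentzModel.card_mul_cuspIndex_le`). Since each `γ ≠ 1` is in only finitely many `Γ_i`, the index
`D_i(P₀)` tends to infinity (`LorentzModel.tendsto_cuspIndex`); this gives the first limit. It
also bounds `|α(Γ_i)| / [Γ₀ : Γ_i]` by the sum over `P₀` of the summand of `α` at `P₀`, divided by
`D_i(P₀)`, because by normality the lattice at a cusp over `P₀`, transported to `P₀`, is the lattice
of `Γ_i` at `P₀` (`IwasawaGroup.tildeLattice_eq`).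

*The constant `C(Λ)`.* The theta functions of a unimodular lattice and of its dual satisfy the
functional equation `theta_one_div`, by Poisson summation, and their Mellin transform continues the
Epstein zeta function. The Laurent expansion of the completed function shows that `C(Λ) vol(Λ)` is
`a + b log vol(Λ)`, where `b` depends on `n` only and `a` is bounded as long as the normalised
lattice is `g ℤ^{2n}` with `g` and `g⁻¹` bounded (`norm_epsteinConst_mul_le`). The bounded `g` map
onto any compact set of isometry classes (`exists_bounded_representative`). For a cusp-uniform
sequence the summand of `α(Γ_i)` at `P₀` is therefore `O(1 + log D_i(P₀))`, which is `o(D_i(P₀))`.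
-/

namespace HypCusp

/-! ### The action on Minkowski space and the parabolic subgroup -/

/-- The closed future cone of Minkowski space. -/
def IsFuture {n : ℕ} (x : I n → ℝ) : Prop := 0 ≤ x (Sum.inl 0) ∧ Q n x ≤ 0

/-- The null vector `e₀ + e₁`, which spans the line fixed by the standard parabolic subgroup. -/
def xi (n : ℕ) : I n → ℝ := e0 n + e1 n

/-- The reflection of `ℝ^{d+1}` in the orthogonal complement of a vector `p` with `Q p = 1`. -/
noncomputable def refl {n : ℕ} (p x : I n → ℝ) : I n → ℝ := x - QuadraticMap.polar (Q n) p x • p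

/-- The features of `SO⁰(d,1)` and `Spin(d,1)` on which the cusp geometry rests: the action on
Minkowski space with its compatibility with `K`, `A`, `N`, and a realisation of the topology by
matrices. -/
structure LorentzModel {n : ℕ} (S : IwasawaGroup n) where
  /-- The action on Minkowski space. -/
  ρ : S.G →* Module.End ℝ (I n → ℝ)
  /-- The action preserves the Lorentz form. -/
  form : ∀ g x, Q n (ρ g x) = Q n x
  /-- The action preserves the direction of time. -/
  cone : ∀ g x, IsFuture x → IsFuture (ρ g x)
  /-- The subgroup `A` scales the null vector `ξ`. -/
  boost_xi : ∀ t, ρ (S.a t) (xi n) = Real.exp t • xi n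
  /-- The subgroup `N` acts by the matrices `exp (X(w/√2))`. -/
  unip : ∀ w x, ρ (S.u (Multiplicative.ofAdd w)) x =
    (unipMatrix n ((Real.sqrt 2)⁻¹ • w)).mulVec x
  /-- Conjugation by `A` dilates `N`. -/
  boost_unip : ∀ t w, S.a t * S.u (Multiplicative.ofAdd w) =
    S.u (Multiplicative.ofAdd (Real.exp t • w)) * S.a t
  /-- `K` is the stabiliser of the time vector. -/
  mem_K : ∀ k, k ∈ S.K ↔ ρ k (e0 n) = e0 n
  /-- The pointwise stabiliser of `e₀` and `e₁` centralises `A`. -/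
  mem_M : ∀ m, ρ m (e0 n) = e0 n → ρ m (e1 n) = e1 n → m ∈ S.M
  /-- Products of two reflections in spacelike vectors orthogonal to `e₀` are realised. -/
  exists_refl : ∀ p q : I n → ℝ, p (Sum.inl 0) = 0 → q (Sum.inl 0) = 0 → Q n p = 1 → Q n q = 1 →
    ∃ k : S.G, ∀ x, ρ k x = refl p (refl q x)
  /-- The topology is induced by a matrix representation. -/
  exists_matrix : ∃ (κ : Type) (_ : Fintype κ) (_ : DecidableEq κ) (φ : S.G →* Matrix κ κ ℝ),
    IsInducing φ
  /-- `N` is embedded as a topological group. -/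
  isInducing_u : IsInducing fun w : E n => S.u (Multiplicative.ofAdd w)

theorem unipMatrix_mulVec_time {n : ℕ} (v : E n) (x : I n → ℝ) :
    (unipMatrix n v).mulVec x (Sum.inl 0) = x (Sum.inl 0) +
      (‖v‖ ^ 2 / 2 * (x (Sum.inl 0) - x (Sum.inl 1)) + ∑ j, v j * x (Sum.inr j)) := by
  simp [unipMatrix, Matrix.mulVec, dotProduct, Fintype.sum_sum_type, Fin.sum_univ_two]
  ring

theorem unipMatrix_mulVec_first {n : ℕ} (v : E n) (x : I n → ℝ) :
    (unipMatrix n v).mulVec x (Sum.inl 1) = x (Sum.inl 1) +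
      (‖v‖ ^ 2 / 2 * (x (Sum.inl 0) - x (Sum.inl 1)) + ∑ j, v j * x (Sum.inr j)) := by
  simp [unipMatrix, Matrix.mulVec, dotProduct, Fintype.sum_sum_type, Fin.sum_univ_two]
  ring

theorem unipMatrix_mulVec_inr {n : ℕ} (v : E n) (x : I n → ℝ) (j : Fin (2 * n)) :
    (unipMatrix n v).mulVec x (Sum.inr j) =
      x (Sum.inr j) + (x (Sum.inl 0) - x (Sum.inl 1)) * v j := by
  simp [unipMatrix, Matrix.mulVec, dotProduct, Fintype.sum_sum_type, Fin.sum_univ_two,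
    Matrix.one_apply]
  ring

theorem unipMatrix_mulVec_xi {n : ℕ} (v : E n) : (unipMatrix n v).mulVec (xi n) = xi n := by
  funext i
  rcases i with i | i
  · fin_cases i
    · simpa [xi, e0, e1] using unipMatrix_mulVec_time v (xi n)
    · simpa [xi, e0, e1] using unipMatrix_mulVec_first v (xi n)
  · simpa [xi, e0, e1] using unipMatrix_mulVec_inr v (xi n) i

theorem eq_smul_xi_of_null {n : ℕ} {x : I n → ℝ} (hQ : Q n x = 0)
    (h : x (Sum.inl 0) = x (Sum.inl 1)) : x = x (Sum.inl 0) • xi n := by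
  have hs : ∑ j, x (Sum.inr j) * x (Sum.inr j) = 0 := by
    rw [Q_apply, h] at hQ; linarith
  have hz : ∀ j, x (Sum.inr j) = 0 := fun j => by
    have := (Finset.sum_eq_zero_iff_of_nonneg fun j _ => mul_self_nonneg (x (Sum.inr j))).mp hs j
      (Finset.mem_univ j)
    exact mul_self_eq_zero.mp this
  funext i
  rcases i with i | i
  · fin_cases i
    · simp [xi, e0, e1]
    · simp [xi, e0, e1, h]
  · simp [xi, e0, e1, hz]

/-- A nontrivial unipotent element of `N` fixes only one null line. -/
theorem eq_smul_xi_of_unip_fixed {n : ℕ} {v : E n} (hv : v ≠ 0) {x : I n → ℝ} (hQ : Q n x = 0)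
    {c : ℝ} (h : (unipMatrix n v).mulVec x = c • x) : ∃ d : ℝ, x = d • xi n := by
  refine ⟨_, eq_smul_xi_of_null hQ ?_⟩
  by_contra hne
  have h0 := congrFun h (Sum.inl 0)
  have h1 := congrFun h (Sum.inl 1)
  rw [unipMatrix_mulVec_time] at h0
  rw [unipMatrix_mulVec_first] at h1
  simp only [Pi.smul_apply, smul_eq_mul] at h0 h1
  have hc : c = 1 := by
    have : (c - 1) * (x (Sum.inl 0) - x (Sum.inl 1)) = 0 := by linarith
    rcases mul_eq_zero.mp this with h | h
    · linarith
    · exact absurd (sub_eq_zero.mp h) hne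
  apply hv
  ext j
  have hj := congrFun h (Sum.inr j)
  rw [unipMatrix_mulVec_inr, hc, one_smul] at hj
  have : (x (Sum.inl 0) - x (Sum.inl 1)) * v j = 0 := by linarith
  simpa [sub_eq_zero, hne] using this

theorem Q_xi (n : ℕ) : Q n (xi n) = 0 := Q_null n

theorem isFuture_xi (n : ℕ) : IsFuture (xi n) := ⟨by simp [xi, e0, e1], (Q_xi n).le⟩

theorem xi_ne_zero (n : ℕ) : xi n ≠ 0 := fun h => by
  have := congrFun h (Sum.inl 0)
  simp [xi, e0, e1] at this

theorem polar_apply {n : ℕ} (p x : I n → ℝ) : QuadraticMap.polar (Q n) p x =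
    2 * (-(p (Sum.inl 0) * x (Sum.inl 0)) + p (Sum.inl 1) * x (Sum.inl 1)
      + ∑ j, p (Sum.inr j) * x (Sum.inr j)) := by
  rw [QuadraticMap.polar, Q_apply, Q_apply, Q_apply]
  have : ∑ j, (p + x) (Sum.inr j) * (p + x) (Sum.inr j) = ∑ j, p (Sum.inr j) * p (Sum.inr j)
      + ∑ j, x (Sum.inr j) * x (Sum.inr j) + 2 * ∑ j, p (Sum.inr j) * x (Sum.inr j) := by
    rw [Finset.mul_sum, ← Finset.sum_add_distrib, ← Finset.sum_add_distrib]
    exact Finset.sum_congr rfl fun j _ => by simp only [Pi.add_apply]; ring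
  rw [this]
  simp only [Pi.add_apply]; ring

theorem refl_e0 {n : ℕ} {p : I n → ℝ} (hp : p (Sum.inl 0) = 0) : refl p (e0 n) = e0 n := by
  rw [refl, polar_apply]
  simp [e0, hp]

namespace LorentzModel

variable {n : ℕ} {S : IwasawaGroup n} (H : LorentzModel S)

theorem ρ_inv_apply (g : S.G) (x : I n → ℝ) : H.ρ g⁻¹ (H.ρ g x) = x := by
  rw [← Module.End.mul_apply, ← map_mul, inv_mul_cancel, map_one, Module.End.one_apply]

theorem ρ_apply_inv (g : S.G) (x : I n → ℝ) : H.ρ g (H.ρ g⁻¹ x) = x := by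
  rw [← Module.End.mul_apply, ← map_mul, mul_inv_cancel, map_one, Module.End.one_apply]

theorem ρ_ne_zero (g : S.G) {x : I n → ℝ} (hx : x ≠ 0) : H.ρ g x ≠ 0 := fun h =>
  hx (by rw [← H.ρ_inv_apply g x, h, map_zero])

theorem ρ_mul_apply (g h : S.G) (x : I n → ℝ) : H.ρ (g * h) x = H.ρ g (H.ρ h x) := by
  rw [map_mul, Module.End.mul_apply]

theorem unip_xi (w : E n) : H.ρ (S.u (Multiplicative.ofAdd w)) (xi n) = xi n := by
  rw [H.unip, unipMatrix_mulVec_xi]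

end LorentzModel

theorem IwasawaGroup.a_mem_P {n : ℕ} (S : IwasawaGroup n) (t : ℝ) : S.a t ∈ S.P :=
  Subgroup.mem_sup_left (Subgroup.mem_sup_right (Subgroup.subset_closure ⟨t, rfl⟩))

theorem IwasawaGroup.u_mem_P {n : ℕ} (S : IwasawaGroup n) (w : Multiplicative (E n)) :
    S.u w ∈ S.P :=
  Subgroup.mem_sup_right ⟨w, rfl⟩

namespace LorentzModel

variable {n : ℕ} {S : IwasawaGroup n} (H : LorentzModel S)

/-- The stabiliser of the null line spanned by `e₀ + e₁` is contained in `P = M A N`. A boost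
normalises the factor by which the null vector is scaled, and an element of `N` moves the image of
the opposite null vector `e₀ - e₁` back to it; what remains fixes `e₀` and `e₁`. -/
theorem mem_P_of_fixed {h : S.G} {c : ℝ} (hc : H.ρ h (xi n) = c • xi n) : h ∈ S.P := by
  have hc0 : 0 < c := by
    have h1 := (H.cone h _ (isFuture_xi n)).1
    rw [hc] at h1
    refine lt_of_le_of_ne (by simpa [xi, e0, e1] using h1) fun h0 => ?_
    rw [← h0, zero_smul] at hc
    exact H.ρ_ne_zero h (xi_ne_zero n) hc
  set a := S.a (Real.log c) with ha
  have hax : H.ρ a (xi n) = c • xi n := by rw [ha, H.boost_xi, Real.exp_log hc0]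
  have hax' : H.ρ a⁻¹ (c • xi n) = xi n := by rw [← hax, H.ρ_inv_apply]
  set g := a⁻¹ * h with hg
  have hgx : H.ρ g (xi n) = xi n := by rw [hg, H.ρ_mul_apply, hc, hax']
  set eta : I n → ℝ := e0 n - e1 n with heta
  set x := H.ρ g eta with hx
  have hQeta : Q n eta = 0 := by rw [Q_apply]; simp [heta, e0, e1]
  have hQx : Q n x = 0 := by rw [hx, H.form, hQeta]
  have hdiff : x (Sum.inl 0) - x (Sum.inl 1) = 2 := by
    have e : Q n (x + xi n) = -4 := by
      have : x + xi n = H.ρ g (eta + xi n) := by rw [map_add, hgx]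
      rw [this, H.form, Q_apply]
      simp [heta, xi, e0, e1]; norm_num
    rw [Q_apply] at e hQx
    have hs : ∑ j, (x + xi n) (Sum.inr j) * (x + xi n) (Sum.inr j) =
        ∑ j, x (Sum.inr j) * x (Sum.inr j) := by
      refine Finset.sum_congr rfl fun j _ => ?_
      simp [xi, e0, e1]
    rw [hs] at e
    simp only [Pi.add_apply, xi, e0, e1] at e
    simp at e
    linarith
  set v : E n := WithLp.toLp 2 fun j => -(x (Sum.inr j) / 2) with hv
  set u := S.u (Multiplicative.ofAdd (Real.sqrt 2 • v)) with hu
  have hux : ∀ y, H.ρ u y = (unipMatrix n v).mulVec y := by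
    intro y
    rw [hu, H.unip, smul_smul, inv_mul_cancel₀ (by positivity), one_smul]
  have hy : H.ρ u x = eta := by
    have hQ : Q n (H.ρ u x) = 0 := by rw [H.form, hQx]
    have h2 : ∀ j, H.ρ u x (Sum.inr j) = 0 := fun j => by
      rw [hux, unipMatrix_mulVec_inr, hdiff, hv]; simp; ring
    have h3 : H.ρ u x (Sum.inl 0) - H.ρ u x (Sum.inl 1) = 2 := by
      rw [hux, unipMatrix_mulVec_time, unipMatrix_mulVec_first]; linarith
    rw [Q_apply] at hQ
    simp only [h2, mul_zero, Finset.sum_const_zero, add_zero] at hQ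
    have h4 : H.ρ u x (Sum.inl 0) + H.ρ u x (Sum.inl 1) = 0 := by nlinarith
    funext i
    rcases i with i | i
    · fin_cases i
      · simp [heta, e0, e1]; linarith
      · simp [heta, e0, e1]; linarith
    · rw [h2]; simp [heta, e0, e1]
  set m := u * g with hm
  have hmxi : H.ρ m (xi n) = xi n := by rw [hm, H.ρ_mul_apply, hgx, hu, H.unip_xi]
  have hmeta : H.ρ m eta = eta := by rw [hm, H.ρ_mul_apply, ← hx, hy]
  have he0 : e0 n = (1 / 2 : ℝ) • (xi n + eta) := by
    rw [heta, xi]; module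
  have he1 : e1 n = (1 / 2 : ℝ) • (xi n - eta) := by
    rw [heta, xi]; module
  have hmM : m ∈ S.M := H.mem_M m (by rw [he0, map_smul, map_add, hmxi, hmeta])
    (by rw [he1, map_smul, map_sub, hmxi, hmeta])
  have : h = a * (u⁻¹ * m) := by rw [hm, hg]; group
  rw [this]
  exact mul_mem (S.a_mem_P _) (mul_mem (inv_mem (S.u_mem_P _))
    (Subgroup.mem_sup_left (Subgroup.mem_sup_left hmM)))

/-- `K` acts transitively on the unit sphere of the space orthogonal to the time vector: a rotation
taking `e₁` to `y` is a product of two reflections. -/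
theorem exists_K_apply_e1 (hn : 1 ≤ n) {y : I n → ℝ} (hy0 : y (Sum.inl 0) = 0) (hy : Q n y = 1) :
    ∃ k ∈ S.K, H.ρ k (e1 n) = y := by
  have he1 : e1 n (Sum.inl 0) = 0 := by simp [e1]
  have hself : refl (e1 n) (e1 n) = -e1 n := by
    rw [refl, polar_apply]
    simp [e1]
    module
  have main : ∃ p q : I n → ℝ, p (Sum.inl 0) = 0 ∧ q (Sum.inl 0) = 0 ∧ Q n p = 1 ∧ Q n q = 1 ∧
      refl p (refl q (e1 n)) = y := by
    -- The first reflection takes `e₁` to `-e₁`, the second interchanges `-e₁` and `y`;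
    -- it is not defined for `y = -e₁`, where a reflection that fixes `e₁` is used instead.
    by_cases hyp : y (Sum.inl 1) = -1
    · set j₀ : Fin (2 * n) := ⟨0, by omega⟩
      have hye : y = -e1 n := by
        have hs : ∑ j, y (Sum.inr j) * y (Sum.inr j) = 0 := by
          rw [Q_apply, hyp, hy0] at hy; linarith
        have hz : ∀ j, y (Sum.inr j) = 0 := fun j => by
          have := (Finset.sum_eq_zero_iff_of_nonneg fun j _ =>
            mul_self_nonneg (y (Sum.inr j))).mp hs j (Finset.mem_univ j)
          exact mul_self_eq_zero.mp this
        funext i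
        rcases i with i | i
        · fin_cases i
          · simp [e1, hy0]
          · simp [e1, hyp]
        · simp [e1, hz]
      refine ⟨e1 n, Pi.single (Sum.inr j₀) 1, he1, by simp, Q_e1 n, ?_, ?_⟩
      · rw [Q_apply]; simp [Pi.single_apply]
      · have : refl (Pi.single (Sum.inr j₀) 1) (e1 n) = e1 n := by
          rw [refl, polar_apply]; simp [e1]
        rw [this, hself, hye]
    · have hs : ∑ j, y (Sum.inr j) * y (Sum.inr j) = 1 - y (Sum.inl 1) * y (Sum.inl 1) := by
        rw [Q_apply, hy0] at hy; linarith
      have hnn : 0 ≤ ∑ j, y (Sum.inr j) * y (Sum.inr j) :=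
        Finset.sum_nonneg fun j _ => mul_self_nonneg _
      have hpos : 0 < 2 + 2 * y (Sum.inl 1) := by
        have : -1 ≤ y (Sum.inl 1) := by nlinarith
        have := lt_of_le_of_ne this (Ne.symm hyp)
        linarith
      set s := Real.sqrt (2 + 2 * y (Sum.inl 1)) with hsdef
      have hs0 : s ≠ 0 := (Real.sqrt_pos.mpr hpos).ne'
      have hss : s * s = 2 + 2 * y (Sum.inl 1) := Real.mul_self_sqrt hpos.le
      have hQ : Q n (s⁻¹ • (e1 n + y)) = 1 := by
        rw [QuadraticMap.map_smul, Q_apply]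
        have : ∑ j, (e1 n + y) (Sum.inr j) * (e1 n + y) (Sum.inr j) =
            ∑ j, y (Sum.inr j) * y (Sum.inr j) := Finset.sum_congr rfl fun j _ => by simp [e1]
        rw [this, hs]
        simp only [Pi.add_apply, e1, hy0]
        simp
        field_simp
        nlinarith
      refine ⟨s⁻¹ • (e1 n + y), e1 n, by simp [he1, hy0], he1, hQ, Q_e1 n, ?_⟩
      have hpol : QuadraticMap.polar (Q n) (s⁻¹ • (e1 n + y)) (-e1 n) = -s := by
        rw [polar_apply]
        simp only [Pi.smul_apply, Pi.add_apply, e1, hy0, smul_eq_mul, Pi.neg_apply]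
        simp
        field_simp
        nlinarith
      rw [hself, refl, hpol, smul_smul, neg_mul, mul_inv_cancel₀ hs0]
      module
  obtain ⟨p, q, hp, hq, hQp, hQq, h⟩ := main
  obtain ⟨k, hk⟩ := H.exists_refl p q hp hq hQp hQq
  exact ⟨k, (H.mem_K k).mpr (by rw [hk, refl_e0 hq, refl_e0 hp]), by rw [hk, h]⟩

/-- The decomposition `G = K P`. -/
theorem exists_K_mul_P (H : LorentzModel S) (hn : 1 ≤ n) (g : S.G) :
    ∃ k ∈ S.K, ∃ p ∈ S.P, g = k * p := by
  set x := H.ρ g (xi n) with hx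
  have hQ : Q n x = 0 := by rw [hx, H.form, Q_xi]
  have hx0 : 0 < x (Sum.inl 0) := by
    refine lt_of_le_of_ne (H.cone g _ (isFuture_xi n)).1 fun h0 => ?_
    have hs : x (Sum.inl 1) * x (Sum.inl 1) + ∑ j, x (Sum.inr j) * x (Sum.inr j) = 0 := by
      rw [Q_apply, ← h0] at hQ; linarith
    have hnn : 0 ≤ ∑ j, x (Sum.inr j) * x (Sum.inr j) :=
      Finset.sum_nonneg fun j _ => mul_self_nonneg _
    have h1 : x (Sum.inl 1) = 0 := by
      apply mul_self_eq_zero.mp; nlinarith [mul_self_nonneg (x (Sum.inl 1))]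
    have := eq_smul_xi_of_null hQ (by rw [h1, ← h0])
    rw [← h0, zero_smul] at this
    exact H.ρ_ne_zero g (xi_ne_zero n) this
  set y : I n → ℝ := (x (Sum.inl 0))⁻¹ • x - e0 n with hy
  have hy0 : y (Sum.inl 0) = 0 := by simp [hy, e0, hx0.ne']
  have hQy : Q n y = 1 := by
    have h1 : Q n ((x (Sum.inl 0))⁻¹ • x) = 0 := by rw [QuadraticMap.map_smul, hQ, smul_zero]
    have h2 : (x (Sum.inl 0))⁻¹ • x = y + e0 n := by rw [hy]; abel
    rw [h2, Q_apply] at h1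
    rw [Q_apply]
    simp only [Pi.add_apply, hy0, e0] at h1
    simp at h1
    rw [hy0]; linarith
  obtain ⟨k, hk, hke⟩ := H.exists_K_apply_e1 hn hy0 hQy
  refine ⟨k, hk, k⁻¹ * g, H.mem_P_of_fixed (c := x (Sum.inl 0)) ?_, by group⟩
  have : H.ρ k (xi n) = (x (Sum.inl 0))⁻¹ • x := by
    rw [xi, map_add, hke, (H.mem_K k).mp hk, hy]; abel
  have hx' : x = x (Sum.inl 0) • H.ρ k (xi n) := by
    rw [this, smul_smul, mul_inv_cancel₀ hx0.ne', one_smul]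
  rw [H.ρ_mul_apply, ← hx]
  conv_lhs => rw [hx', map_smul, H.ρ_inv_apply]

end LorentzModel

/-! ### The group `SO⁰(d,1)` -/

theorem Q_eq_dotProduct {n : ℕ} (x : I n → ℝ) : Q n x = x ⬝ᵥ (J n).mulVec x := by
  rw [Q, QuadraticMap.weightedSumSquares_apply, J, dotProduct]
  refine Finset.sum_congr rfl fun i _ => ?_
  rw [Matrix.mulVec_diagonal, smul_eq_mul]; ring

theorem Q_mulVec_of_isometry {n : ℕ} {g : Matrix (I n) (I n) ℝ}
    (hg : g.transpose * J n * g = J n) (x : I n → ℝ) : Q n (g.mulVec x) = Q n x := by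
  have h : x ⬝ᵥ (g.transpose * J n * g).mulVec x = g.mulVec x ⬝ᵥ (J n).mulVec (g.mulVec x) := by
    rw [Matrix.mul_assoc, ← Matrix.mulVec_mulVec, Matrix.dotProduct_mulVec,
      Matrix.vecMul_transpose, Matrix.mulVec_mulVec]
  rw [Q_eq_dotProduct, ← h, hg, ← Q_eq_dotProduct]

theorem isFuture_mulVec {n : ℕ} {g : Matrix (I n) (I n) ℝ}
    (hg : g.transpose * J n * g = J n) (hg0 : 0 < g (Sum.inl 0) (Sum.inl 0)) {x : I n → ℝ}
    (hx : IsFuture x) : IsFuture (g.mulVec x) := by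
  refine ⟨?_, by rw [Q_mulVec_of_isometry hg]; exact hx.2⟩
  have e1 := congrFun (congrFun (mul_J_mul_transpose hg) (Sum.inl 0)) (Sum.inl 0)
  rw [Matrix.mul_apply] at e1
  simp only [J, Matrix.mul_diagonal, Matrix.transpose_apply, Matrix.diagonal_apply_eq] at e1
  have h1 : ∑ i ∈ Finset.univ.erase (Sum.inl 0 : I n), g (Sum.inl 0) i ^ 2 ≤
      g (Sum.inl 0) (Sum.inl 0) ^ 2 := by
    rw [← Finset.add_sum_erase _ _ (Finset.mem_univ (Sum.inl 0 : I n))] at e1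
    have : ∑ i ∈ Finset.univ.erase (Sum.inl 0 : I n), g (Sum.inl 0) i * sgn n i * g (Sum.inl 0) i
        = ∑ i ∈ Finset.univ.erase (Sum.inl 0 : I n), g (Sum.inl 0) i ^ 2 := by
      refine Finset.sum_congr rfl fun i hi => ?_
      rw [sgn, if_neg (Finset.ne_of_mem_erase hi)]; ring
    rw [this] at e1
    simp only [sgn, if_true] at e1
    linarith
  have h2 : ∑ i ∈ Finset.univ.erase (Sum.inl 0 : I n), x i ^ 2 ≤ x (Sum.inl 0) ^ 2 := by
    have hQ := hx.2
    rw [Q, QuadraticMap.weightedSumSquares_apply,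
      ← Finset.add_sum_erase _ _ (Finset.mem_univ (Sum.inl 0 : I n))] at hQ
    have : ∑ i ∈ Finset.univ.erase (Sum.inl 0 : I n), sgn n i • (x i * x i)
        = ∑ i ∈ Finset.univ.erase (Sum.inl 0 : I n), x i ^ 2 := by
      refine Finset.sum_congr rfl fun i hi => ?_
      rw [sgn, if_neg (Finset.ne_of_mem_erase hi), one_smul]; ring
    rw [this] at hQ
    simp only [sgn, if_true, smul_eq_mul] at hQ
    linarith
  rw [Matrix.mulVec, dotProduct, ← Finset.add_sum_erase _ _ (Finset.mem_univ (Sum.inl 0 : I n))]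
  have cs := Finset.sum_mul_sq_le_sq_mul_sq (Finset.univ.erase (Sum.inl 0 : I n))
    (fun i => g (Sum.inl 0) i) x
  set T := ∑ i ∈ Finset.univ.erase (Sum.inl 0 : I n), g (Sum.inl 0) i * x i
  have h3 : T ^ 2 ≤ (g (Sum.inl 0) (Sum.inl 0) * x (Sum.inl 0)) ^ 2 := by
    rw [mul_pow]
    exact cs.trans (mul_le_mul h1 h2 (Finset.sum_nonneg fun i _ => sq_nonneg _) (sq_nonneg _))
  have := (abs_le_of_sq_le_sq' h3 (mul_nonneg hg0.le hx.1)).1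
  linarith

/-- The matrix of the reflection in the orthogonal complement of a unit vector `p` orthogonal to the
time vector. -/
def reflMatrix {n : ℕ} (p : I n → ℝ) : Matrix (I n) (I n) ℝ :=
  1 - (2 : ℝ) • Matrix.vecMulVec p p

theorem J_mulVec_of_time_zero {n : ℕ} {p : I n → ℝ} (hp : p (Sum.inl 0) = 0) :
    (J n).mulVec p = p := by
  funext i
  rw [J, Matrix.mulVec_diagonal, sgn]
  split_ifs with h
  · rw [h, hp, mul_zero]
  · rw [one_mul]

theorem dotProduct_self_of_time_zero {n : ℕ} {p : I n → ℝ} (hp : p (Sum.inl 0) = 0) :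
    p ⬝ᵥ p = Q n p := by
  rw [Q_eq_dotProduct, J_mulVec_of_time_zero hp]

theorem reflMatrix_mulVec {n : ℕ} {p : I n → ℝ} (hp : p (Sum.inl 0) = 0) (x : I n → ℝ) :
    (reflMatrix p).mulVec x = refl p x := by
  have : QuadraticMap.polar (Q n) p x = 2 * p ⬝ᵥ x := by
    rw [polar_apply, hp, dotProduct, Fintype.sum_sum_type, Fin.sum_univ_two, hp]; ring
  rw [reflMatrix, Matrix.sub_mulVec, Matrix.one_mulVec, Matrix.smul_mulVec, refl, this]
  congr 1
  rw [Matrix.vecMulVec_mulVec]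
  funext i
  simp; ring

theorem reflMatrix_sq {n : ℕ} {p : I n → ℝ} (hp : p (Sum.inl 0) = 0) (hQ : Q n p = 1) :
    reflMatrix p * reflMatrix p = 1 := by
  have h : Matrix.vecMulVec p p * Matrix.vecMulVec p p = Matrix.vecMulVec p p := by
    rw [Matrix.vecMulVec_mul_vecMulVec, dotProduct_self_of_time_zero hp, hQ]
    simp
  rw [reflMatrix, sub_mul, mul_sub, mul_sub, one_mul, mul_one, one_mul, Matrix.smul_mul,
    Matrix.mul_smul, h]
  module

theorem reflMatrix_isometry {n : ℕ} {p : I n → ℝ} (hp : p (Sum.inl 0) = 0) (hQ : Q n p = 1) :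
    (reflMatrix p).transpose * J n * reflMatrix p = J n := by
  have ht : (reflMatrix p).transpose = reflMatrix p := by
    rw [reflMatrix, Matrix.transpose_sub, Matrix.transpose_smul, Matrix.transpose_one,
      Matrix.transpose_vecMulVec]
  have hc : J n * reflMatrix p = reflMatrix p * J n := by
    rw [reflMatrix, mul_sub, sub_mul, mul_one, one_mul, Matrix.mul_smul, Matrix.smul_mul,
      Matrix.mul_vecMulVec, Matrix.vecMulVec_mul, J_mulVec_of_time_zero hp,
      ← Matrix.mulVec_transpose, J, Matrix.diagonal_transpose, ← J, J_mulVec_of_time_zero hp]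
  rw [ht, Matrix.mul_assoc, hc, ← Matrix.mul_assoc, reflMatrix_sq hp hQ, Matrix.one_mul]

theorem det_reflMatrix {n : ℕ} {p : I n → ℝ} (hp : p (Sum.inl 0) = 0) (hQ : Q n p = 1) :
    (reflMatrix p).det = -1 := by
  have := Matrix.det_one_add_replicateCol_mul_replicateRow (ι := Unit) ((-2 : ℝ) • p) p
  rw [← Matrix.vecMulVec_eq, dotProduct_smul, dotProduct_self_of_time_zero hp, hQ] at this
  rw [reflMatrix, sub_eq_add_neg, ← neg_smul, ← Matrix.smul_vecMulVec, this]
  norm_num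

theorem boostMatrix_mul_unipMatrix (n : ℕ) (t : ℝ) (v : E n) :
    boostMatrix n t * unipMatrix n v = unipMatrix n (Real.exp t • v) * boostMatrix n t := by
  rw [unipMatrix, unipMatrix, boostMatrix, Matrix.fromBlocks_multiply, Matrix.fromBlocks_multiply]
  have h1 : Real.cosh t + Real.sinh t = Real.exp t := Real.cosh_add_sinh t
  have h2 : Real.exp t * (Real.cosh t - Real.sinh t) = 1 := by
    rw [Real.cosh_sub_sinh, ← Real.exp_add]; simp
  have h3 : ‖Real.exp t • v‖ ^ 2 = Real.exp t ^ 2 * ‖v‖ ^ 2 := by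
    rw [norm_smul, mul_pow, Real.norm_eq_abs, sq_abs]
  have hc : Real.exp t ^ 2 * Real.cosh t - Real.exp t ^ 2 * Real.sinh t = Real.exp t := by
    rw [← mul_sub, pow_two, mul_assoc, h2, mul_one]
  congr 1
  · ext i j
    fin_cases i <;> fin_cases j <;> simp [h3]
    · linear_combination (‖v‖^2/2) * (h1 - hc)
    · linear_combination (‖v‖^2/2) * (-h1 + hc)
    · linear_combination (‖v‖^2/2) * (h1 - hc)
    · linear_combination (‖v‖^2/2) * (-h1 + hc)
  · ext i j
    fin_cases i <;> simp [Matrix.vecHead, Matrix.vecTail]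
    · linear_combination (v j) * h1
    · linear_combination (v j) * h1
  · ext i j
    fin_cases j <;> simp [Matrix.mul_apply, Fin.sum_univ_two]
    · linear_combination (-v i) * h2
    · linear_combination (v i) * h2
  · ext i j
    simp

theorem boostMatrix_mulVec {n : ℕ} (t : ℝ) (x : I n → ℝ) :
    (boostMatrix n t).mulVec x = Sum.elim
      ![Real.cosh t * x (Sum.inl 0) + Real.sinh t * x (Sum.inl 1),
        Real.sinh t * x (Sum.inl 0) + Real.cosh t * x (Sum.inl 1)] (fun j => x (Sum.inr j)) := by
  funext i
  rcases i with i | i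
  · fin_cases i <;>
      simp [boostMatrix, Matrix.mulVec, dotProduct, Fintype.sum_sum_type, Fin.sum_univ_two]
  · simp [boostMatrix, Matrix.mulVec, dotProduct, Fintype.sum_sum_type, Matrix.one_apply]

theorem lorentzGroup_ext {n : ℕ} {g h : (lorentzGroup n).G}
    (e : (g : SO0 n).1.1 = (h : SO0 n).1.1) : g = h := Subtype.ext (Subtype.ext e)

/-- A Lorentz transformation that fixes `e₀` and `e₁` commutes with the boosts. -/
theorem mul_boostMatrix_of_fixed {n : ℕ} {m : Matrix (I n) (I n) ℝ}
    (hm : m.transpose * J n * m = J n) (h0 : m.mulVec (e0 n) = e0 n) (h1 : m.mulVec (e1 n) = e1 n)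
    (t : ℝ) : m * boostMatrix n t = boostMatrix n t * m := by
  have key : ∀ y : I n → ℝ, m.mulVec y = y → ∀ x, m.mulVec x ⬝ᵥ (J n).mulVec y =
      x ⬝ᵥ (J n).mulVec y := fun y hy x => by
    conv_rhs => rw [← hm, Matrix.mul_assoc, ← Matrix.mulVec_mulVec, Matrix.dotProduct_mulVec,
      Matrix.vecMul_transpose, ← Matrix.mulVec_mulVec, hy]
  have k0 : ∀ x, m.mulVec x (Sum.inl 0) = x (Sum.inl 0) := fun x => by
    have := key _ h0 x
    rw [e0, J, Matrix.mulVec_single_one] at this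
    simpa [sgn] using this
  have k1 : ∀ x, m.mulVec x (Sum.inl 1) = x (Sum.inl 1) := fun x => by
    have := key _ h1 x
    rw [e1, J, Matrix.mulVec_single_one] at this
    simpa [sgn] using this
  have hb : ∀ x : I n → ℝ, (boostMatrix n t).mulVec x = x +
      (((Real.cosh t - 1) * x (Sum.inl 0) + Real.sinh t * x (Sum.inl 1)) • e0 n +
      (Real.sinh t * x (Sum.inl 0) + (Real.cosh t - 1) * x (Sum.inl 1)) • e1 n) := fun x => by
    rw [boostMatrix_mulVec]
    funext i
    rcases i with i | i
    · fin_cases i <;> simp [e0, e1] <;> ring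
    · simp [e0, e1]
  apply Matrix.ext_of_mulVec_single
  intro i
  rw [← Matrix.mulVec_mulVec, ← Matrix.mulVec_mulVec, hb, hb, Matrix.mulVec_add, Matrix.mulVec_add,
    Matrix.mulVec_smul, Matrix.mulVec_smul, h0, h1, k0, k1]

/-- The Lorentz group as a model. -/
noncomputable def lorentzModel (n : ℕ) : LorentzModel (lorentzGroup n) where
  ρ :=
    { toFun := fun g => Matrix.mulVecLin (g : SO0 n).1.1
      map_one' := Matrix.mulVecLin_one
      map_mul' := fun g h => Matrix.mulVecLin_mul (g : SO0 n).1.1 (h : SO0 n).1.1 }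
  form g x := Q_mulVec_of_isometry (g : SO0 n).2.1 x
  cone g x hx := isFuture_mulVec (g : SO0 n).2.1 (g : SO0 n).2.2 hx
  boost_xi t := by
    change (boostMatrix n t).mulVec (xi n) = _
    rw [boostMatrix_mulVec, ← Real.cosh_add_sinh]
    funext i
    rcases i with i | i
    · fin_cases i <;> simp [xi, e0, e1]
    · simp [xi, e0, e1]
  unip w x := rfl
  boost_unip t w := by
    apply lorentzGroup_ext
    change boostMatrix n t * unipMatrix n ((Real.sqrt 2)⁻¹ • w) =
      unipMatrix n ((Real.sqrt 2)⁻¹ • Real.exp t • w) * boostMatrix n t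
    rw [boostMatrix_mul_unipMatrix, smul_comm]
  mem_K k := Iff.rfl
  mem_M m h0 h1 := by
    refine ⟨Subgroup.mem_centralizer_iff.mpr ?_, h0⟩
    have : (lorentzGroup n).A ≤ Subgroup.centralizer {m} := by
      rw [IwasawaGroup.A, Subgroup.closure_le]
      rintro _ ⟨t, rfl⟩
      refine Subgroup.mem_centralizer_iff.mpr fun g hg => ?_
      rw [Set.mem_singleton_iff.mp hg]
      exact lorentzGroup_ext (mul_boostMatrix_of_fixed (m : SO0 n).2.1 h0 h1 t)
    intro g hg
    exact (Subgroup.mem_centralizer_iff.mp (this hg) m rfl).symm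
  exists_refl p q hp hq hQp hQq := by
    have hiso : (reflMatrix p * reflMatrix q).transpose * J n * (reflMatrix p * reflMatrix q) =
        J n := by
      calc _ = (reflMatrix q).transpose *
            ((reflMatrix p).transpose * J n * reflMatrix p) * reflMatrix q := by
              rw [Matrix.transpose_mul]; simp only [Matrix.mul_assoc]
        _ = J n := by rw [reflMatrix_isometry hp hQp, reflMatrix_isometry hq hQq]
    have hx : ∀ x, (reflMatrix p * reflMatrix q).mulVec x = refl p (refl q x) := fun x => by
      rw [← Matrix.mulVec_mulVec, reflMatrix_mulVec hq, reflMatrix_mulVec hp]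
    have hpos : 0 < (reflMatrix p * reflMatrix q) (Sum.inl 0) (Sum.inl 0) := by
      have h1 := congrFun (hx (e0 n)) (Sum.inl 0)
      rw [refl_e0 hq, refl_e0 hp, e0, Matrix.mulVec_single_one] at h1
      have h2 : (reflMatrix p * reflMatrix q) (Sum.inl 0) (Sum.inl 0) = 1 := by simpa using h1
      rw [h2]; exact one_pos
    exact ⟨(⟨⟨reflMatrix p * reflMatrix q, by
      rw [Matrix.det_mul, det_reflMatrix hp hQp, det_reflMatrix hq hQq]; norm_num⟩,
      hiso, hpos⟩ : SO0 n), hx⟩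
  exists_matrix := ⟨I n, inferInstance, inferInstance,
    { toFun := fun g => (g : SO0 n).1.1
      map_one' := rfl
      map_mul' := fun _ _ => rfl }, IsInducing.subtypeVal.comp IsInducing.subtypeVal⟩
  isInducing_u := by
    have hφ : IsInducing fun g : (lorentzGroup n).G => (g : SO0 n).1.1 :=
      IsInducing.subtypeVal.comp IsInducing.subtypeVal
    have hc : Continuous fun w : E n => (lorentzGroup n).u (Multiplicative.ofAdd w) := by
      rw [hφ.continuous_iff]
      refine continuous_matrix fun i j => ?_
      change Continuous fun w : E n => unipMatrix n ((Real.sqrt 2)⁻¹ • w) i j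
      rcases i with i | i <;> rcases j with j | j
      · fin_cases i <;> fin_cases j <;> simp [unipMatrix] <;> fun_prop
      · simp [unipMatrix]; fun_prop
      · fin_cases j <;> simp [unipMatrix] <;> fun_prop
      · simp [unipMatrix]; fun_prop
    refine IsInducing.of_comp hc (g := fun g : (lorentzGroup n).G =>
      (WithLp.toLp 2 fun j => Real.sqrt 2 * (g : SO0 n).1.1 (Sum.inr j) (Sum.inl 0) : E n))
      ?_ ?_
    · have := hφ.continuous
      fun_prop
    · convert! IsInducing.id using 1
      funext w
      ext j
      change Real.sqrt 2 * unipMatrix n ((Real.sqrt 2)⁻¹ • w) (Sum.inr j) (Sum.inl 0) = w j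
      simp [unipMatrix]

/-! ### The group `Spin(d,1)` -/

theorem finite_cliffordAlgebra (n : ℕ) : Module.Finite ℝ (CliffordAlgebra (Q n)) :=
  have : Module.Finite ℝ (ExteriorAlgebra ℝ (I n → ℝ)) :=
    Module.Finite.of_basis (Module.finBasis ℝ (I n → ℝ)).ExteriorAlgebra
  Module.Finite.equiv (equivExterior (Q n)).symm

theorem ι_injective (n : ℕ) : Function.Injective (ι (Q n)) := by
  intro x y h
  have h' := congrArg (equivExterior (Q n)) h
  simp only [equivExterior, changeFormEquiv_apply, changeForm_ι] at h'
  exact ExteriorAlgebra.ι_leftInverse.injective h'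

theorem ι_mul_ι_mul_star {n : ℕ} (v f : I n → ℝ) :
    ι (Q n) v * ι (Q n) f * star (ι (Q n) v) =
      ι (Q n) (Q n v • f - QuadraticMap.polar (Q n) v f • v) := by
  have h1 : ι (Q n) v * ι (Q n) f = algebraMap ℝ _ (QuadraticMap.polar (Q n) v f) -
      ι (Q n) f * ι (Q n) v := by rw [← ι_mul_ι_add_swap]; abel
  rw [star_ι, h1, sub_mul, mul_neg, mul_neg, mul_assoc, ι_sq_scalar, map_sub, map_smul, map_smul,
    ← Algebra.commutes, Algebra.smul_def, Algebra.smul_def]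
  abel

/-- The map by which a vector of the Clifford algebra acts on Minkowski space preserves the closed
future cone, whether the vector is spacelike or timelike. -/
theorem isFuture_reflection {n : ℕ} (v : I n → ℝ) {f : I n → ℝ} (hf : IsFuture f) :
    IsFuture (Q n v • f - QuadraticMap.polar (Q n) v f • v) := by
  have hq : Q n (Q n v • f - QuadraticMap.polar (Q n) v f • v) = Q n v ^ 2 * Q n f := by
    have h1 := QuadraticMap.map_add (Q n) (Q n v • f) (-(QuadraticMap.polar (Q n) v f • v))
    rw [← sub_eq_add_neg] at h1
    rw [h1, QuadraticMap.map_neg, QuadraticMap.map_smul, QuadraticMap.map_smul,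
      QuadraticMap.polar_neg_right, QuadraticMap.polar_smul_left, QuadraticMap.polar_smul_right,
      QuadraticMap.polar_comm (Q n) f v]
    simp only [smul_eq_mul]; ring
  refine ⟨?_, by rw [hq]; exact mul_nonpos_of_nonneg_of_nonpos (sq_nonneg _) hf.2⟩
  obtain ⟨hf0, hfQ⟩ := hf
  rw [Q_apply] at hfQ
  simp only [Pi.sub_apply, Pi.smul_apply, smul_eq_mul]
  rw [Q_apply, polar_apply]
  set a := v (Sum.inl 0)
  set t := f (Sum.inl 0)
  have cs := Finset.sum_mul_sq_le_sq_mul_sq Finset.univ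
    (fun i : Option (Fin (2 * n)) => i.elim (v (Sum.inl 1)) fun j => v (Sum.inr j))
    (fun i => i.elim (f (Sum.inl 1)) fun j => f (Sum.inr j))
  simp only [Fintype.sum_option, Option.elim] at cs
  have e1 : ∑ j, v (Sum.inr j) ^ 2 = ∑ j, v (Sum.inr j) * v (Sum.inr j) := by simp only [pow_two]
  have e2 : ∑ j, f (Sum.inr j) ^ 2 = ∑ j, f (Sum.inr j) * f (Sum.inr j) := by simp only [pow_two]
  rw [e1, e2] at cs
  have hv0 : 0 ≤ ∑ j, v (Sum.inr j) * v (Sum.inr j) :=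
    Finset.sum_nonneg fun j _ => mul_self_nonneg _
  set V := ∑ j, v (Sum.inr j) * v (Sum.inr j)
  set F := ∑ j, f (Sum.inr j) * f (Sum.inr j)
  set X := ∑ j, v (Sum.inr j) * f (Sum.inr j)
  set σ := v (Sum.inl 1) * f (Sum.inl 1) + X
  set b := v (Sum.inl 1) ^ 2 + V
  have hb : 0 ≤ b := by positivity
  -- With `a`, `b` the time entry and the squared space norm of `v`, the new time entry is
  -- `(a² + b) t - 2 σ a`, and `|σ| ≤ √b t`, `2 |a| √b ≤ a² + b`.
  have h1 : σ ^ 2 ≤ b * t ^ 2 :=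
    cs.trans (mul_le_mul_of_nonneg_left (by nlinarith) hb)
  have h2 : (2 * σ * a) ^ 2 ≤ ((a ^ 2 + b) * t) ^ 2 := by
    have h3 : 4 * a ^ 2 * σ ^ 2 ≤ 4 * a ^ 2 * (b * t ^ 2) :=
      mul_le_mul_of_nonneg_left h1 (by positivity)
    have h4 : 0 ≤ (a ^ 2 - b) ^ 2 * t ^ 2 := by positivity
    nlinarith
  have h5 := (abs_le_of_sq_le_sq' h2 (by positivity)).2
  have : (-(a * a) + v (Sum.inl 1) * v (Sum.inl 1) + V) * t -
      2 * (-(a * t) + v (Sum.inl 1) * f (Sum.inl 1) + X) * a = (a ^ 2 + b) * t - 2 * σ * a := by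
    simp only [b, σ]; ring
  linarith

/-- The elements of the Lipschitz group act on the vectors by `f ↦ x f x*`. The cone is carried
along in this induction over products of vectors because the factors have spinor norms of either sign; a
product with spinor norm one then acts by isometries that preserve the direction of time. -/
theorem exists_act_of_mem_lipschitzGroup {n : ℕ} {x : (CliffordAlgebra (Q n))ˣ}
    (hx : x ∈ lipschitzGroup (Q n)) : ∀ f, ∃ f', (x : CliffordAlgebra (Q n)) * ι (Q n) f *
      star (x : CliffordAlgebra (Q n)) = ι (Q n) f' ∧ (IsFuture f → IsFuture f') := by
  have vector : ∀ v f, ∃ f', ι (Q n) v * ι (Q n) f * star (ι (Q n) v) = ι (Q n) f' ∧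
      (IsFuture f → IsFuture f') := fun v f =>
    ⟨_, ι_mul_ι_mul_star v f, isFuture_reflection v⟩
  unfold lipschitzGroup at hx
  induction hx using Subgroup.closure_induction'' with
  | mem x hx =>
    obtain ⟨v, hv⟩ := hx
    rw [← hv]
    exact vector v
  | inv_mem x hx =>
    obtain ⟨v, hv⟩ := hx
    have hQ : Q n v ≠ 0 := by
      intro h0
      have : (x : CliffordAlgebra (Q n)) * x = 0 := by rw [← hv, ι_sq_scalar, h0, map_zero]
      exact (x * x).ne_zero (by rw [Units.val_mul, this])
    have : ((x⁻¹ : (CliffordAlgebra (Q n))ˣ) : CliffordAlgebra (Q n)) =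
        ι (Q n) ((Q n v)⁻¹ • v) := by
      rw [← Units.mul_right_inj x, Units.mul_inv, map_smul, mul_smul_comm, ← hv, ι_sq_scalar,
        Algebra.algebraMap_eq_smul_one, smul_smul, inv_mul_cancel₀ hQ, one_smul]
    rw [this]
    exact vector _
  | one => exact fun f => ⟨f, by simp, id⟩
  | mul x y _ _ hx hy =>
    intro f
    obtain ⟨f₁, h₁, h₁'⟩ := hy f
    obtain ⟨f₂, h₂, h₂'⟩ := hx f₁
    refine ⟨f₂, ?_, fun h => h₂' (h₁' h)⟩
    rw [← h₂, ← h₁, Units.val_mul, star_mul]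
    simp only [mul_assoc]

theorem SpinG.exists_act {n : ℕ} (g : SpinG n) (f : I n → ℝ) :
    ∃ f', g.1 * ι (Q n) f * star g.1 = ι (Q n) f' ∧ (IsFuture f → IsFuture f') := by
  obtain ⟨x, hx, hxg⟩ := g.2.1.1
  rw [← hxg]
  exact exists_act_of_mem_lipschitzGroup hx f

/-- The action of `Spin(d,1)` on Minkowski space, by conjugation in the Clifford algebra. -/
noncomputable def SpinG.act {n : ℕ} (g : SpinG n) : (I n → ℝ) →ₗ[ℝ] (I n → ℝ) :=
  (LinearEquiv.ofInjective (ι (Q n)) (ι_injective n)).symm.toLinearMap ∘ₗ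
    ((LinearMap.mulRight ℝ (star g.1) ∘ₗ LinearMap.mulLeft ℝ g.1 ∘ₗ ι (Q n)).codRestrict
      (LinearMap.range (ι (Q n))) fun f => by
        obtain ⟨f', h, -⟩ := SpinG.exists_act g f
        exact ⟨f', h.symm⟩)

theorem SpinG.ι_act {n : ℕ} (g : SpinG n) (f : I n → ℝ) :
    ι (Q n) (g.act f) = g.1 * ι (Q n) f * star g.1 := by
  have := LinearEquiv.apply_symm_apply (LinearEquiv.ofInjective (ι (Q n)) (ι_injective n))
    ((LinearMap.mulRight ℝ (star g.1) ∘ₗ LinearMap.mulLeft ℝ g.1 ∘ₗ ι (Q n)).codRestrict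
      (LinearMap.range (ι (Q n))) (fun f => by
        obtain ⟨f', h, -⟩ := SpinG.exists_act g f
        exact ⟨f', h.symm⟩) f)
  exact congrArg Subtype.val this

theorem SpinG.act_eq_iff {n : ℕ} (g : SpinG n) (f f' : I n → ℝ) :
    g.act f = f' ↔ g.1 * ι (Q n) f = ι (Q n) f' * g.1 := by
  rw [← (ι_injective n).eq_iff, SpinG.ι_act]
  constructor
  · intro h
    rw [← h, mul_assoc _ (star g.1), spinGroup.coe_star_mul_self g, mul_one]
  · intro h
    rw [h, mul_assoc, spinGroup.mul_star_self_of_mem g.2, mul_one]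

theorem SpinG.Q_act {n : ℕ} (g : SpinG n) (x : I n → ℝ) : Q n (g.act x) = Q n x := by
  apply (algebraMap ℝ (CliffordAlgebra (Q n))).injective
  rw [← ι_sq_scalar, SpinG.ι_act, mul_assoc, ← mul_assoc (star g.1), ← mul_assoc (star g.1),
    spinGroup.star_mul_self_of_mem g.2, one_mul, mul_assoc, ← mul_assoc (ι (Q n) x), ι_sq_scalar,
    Algebra.commutes, ← mul_assoc, spinGroup.mul_star_self_of_mem g.2, one_mul]

theorem SpinG.isFuture_act {n : ℕ} (g : SpinG n) {x : I n → ℝ} (hx : IsFuture x) :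
    IsFuture (g.act x) := by
  obtain ⟨x', h, h'⟩ := g.exists_act x
  have : g.act x = x' := ι_injective n (by rw [SpinG.ι_act, h])
  rw [this]
  exact h' hx

theorem ι_anticomm {n : ℕ} {x y : I n → ℝ} (h : QuadraticMap.polar (Q n) x y = 0) :
    ι (Q n) x * ι (Q n) y = -(ι (Q n) y * ι (Q n) x) := by
  rw [eq_neg_iff_add_eq_zero, ι_mul_ι_add_swap, h, map_zero]

theorem e0_mul_e0 (n : ℕ) : ι (Q n) (e0 n) * ι (Q n) (e0 n) = -1 := by
  rw [ι_sq_scalar, Q_e0, map_neg, map_one]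

theorem e1_mul_e1 (n : ℕ) : ι (Q n) (e1 n) * ι (Q n) (e1 n) = 1 := by
  rw [ι_sq_scalar, Q_e1, map_one]

theorem e1_mul_e0 (n : ℕ) :
    ι (Q n) (e1 n) * ι (Q n) (e0 n) = -(ι (Q n) (e0 n) * ι (Q n) (e1 n)) :=
  ι_anticomm (by rw [polar_apply]; simp [e0, e1])

theorem spinBoost_coe (n : ℕ) (t : ℝ) : (spinBoost n t).1 = algebraMap ℝ _ (Real.cosh (t / 2)) +
    Real.sinh (t / 2) • (ι (Q n) (e0 n) * ι (Q n) (e1 n)) := rfl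

theorem spinUnip_coe (n : ℕ) (v : E n) : (spinUnip n v).1 =
    1 + (1 / 2 : ℝ) • (ι (Q n) (xi n) * ι (Q n) (vec v)) := rfl

theorem spinBoost_mul_xi (n : ℕ) (t : ℝ) :
    (spinBoost n t).1 * ι (Q n) (xi n) = Real.exp (t / 2) • ι (Q n) (xi n) := by
  have h1 : ι (Q n) (e0 n) * ι (Q n) (e1 n) * ι (Q n) (xi n) = ι (Q n) (xi n) := by
    rw [xi, map_add, mul_add, mul_assoc, mul_assoc, e1_mul_e1, e1_mul_e0, mul_neg, ← mul_assoc,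
      e0_mul_e0]
    noncomm_ring
  rw [spinBoost_coe, add_mul, smul_mul_assoc, h1, ← Algebra.smul_def, ← add_smul,
    Real.cosh_add_sinh]

theorem xi_mul_spinBoost (n : ℕ) (t : ℝ) :
    ι (Q n) (xi n) * (spinBoost n t).1 = Real.exp (-(t / 2)) • ι (Q n) (xi n) := by
  have h1 : ι (Q n) (xi n) * (ι (Q n) (e0 n) * ι (Q n) (e1 n)) = -ι (Q n) (xi n) := by
    rw [xi, map_add, add_mul, ← mul_assoc, ← mul_assoc, e0_mul_e0, e1_mul_e0, neg_mul (_ * _),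
      mul_assoc (ι (Q n) (e0 n)), e1_mul_e1]
    noncomm_ring
  rw [spinBoost_coe, mul_add, mul_smul_comm, h1, ← Algebra.commutes, ← Algebra.smul_def, smul_neg,
    ← sub_eq_add_neg, ← sub_smul, Real.cosh_sub_sinh]

theorem spinBoost_comm_vec (n : ℕ) (t : ℝ) (v : E n) :
    (spinBoost n t).1 * ι (Q n) (vec v) = ι (Q n) (vec v) * (spinBoost n t).1 := by
  have h0 : ι (Q n) (e0 n) * ι (Q n) (vec v) = -(ι (Q n) (vec v) * ι (Q n) (e0 n)) :=
    ι_anticomm (by rw [polar_apply]; simp [e0, vec])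
  have h1 : ι (Q n) (e1 n) * ι (Q n) (vec v) = -(ι (Q n) (vec v) * ι (Q n) (e1 n)) :=
    ι_anticomm (by rw [polar_apply]; simp [e1, vec])
  rw [spinBoost_coe, add_mul, mul_add, Algebra.commutes, smul_mul_assoc, mul_smul_comm, mul_assoc,
    h1, mul_neg, ← mul_assoc, h0, neg_mul, neg_neg, mul_assoc]

theorem xi_mul_vec (n : ℕ) (v : E n) :
    ι (Q n) (xi n) * ι (Q n) (vec v) = -(ι (Q n) (vec v) * ι (Q n) (xi n)) :=
  ι_anticomm (by rw [polar_apply]; simp [xi, e0, e1, vec])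

theorem xi_mul_xi (n : ℕ) : ι (Q n) (xi n) * ι (Q n) (xi n) = 0 := by
  rw [ι_sq_scalar, Q_xi, map_zero]

theorem vec_mul_vec (n : ℕ) (v : E n) :
    ι (Q n) (vec v) * ι (Q n) (vec v) = algebraMap ℝ _ (‖v‖ ^ 2) := by
  rw [ι_sq_scalar, Q_vec]

theorem unipMatrix_mulVec_eq {n : ℕ} (v : E n) (x : I n → ℝ) : (unipMatrix n v).mulVec x =
    x + (‖v‖ ^ 2 / 2 * (x (Sum.inl 0) - x (Sum.inl 1)) + ∑ j, v j * x (Sum.inr j)) • xi n +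
      (x (Sum.inl 0) - x (Sum.inl 1)) • vec v := by
  funext i
  rcases i with i | i
  · fin_cases i
    · simpa [xi, e0, e1, vec] using unipMatrix_mulVec_time v x
    · simpa [xi, e0, e1, vec] using unipMatrix_mulVec_first v x
  · simpa [xi, e0, e1, vec] using unipMatrix_mulVec_inr v x i

theorem spinUnip_act {n : ℕ} (v : E n) (x : I n → ℝ) :
    (spinUnip n v).act x = (unipMatrix n v).mulVec x := by
  rw [SpinG.act_eq_iff, spinUnip_coe, unipMatrix_mulVec_eq]
  set δ := x (Sum.inl 0) - x (Sum.inl 1) with hδ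
  set s := ∑ j, v j * x (Sum.inr j) with hs
  have hvx : ι (Q n) (vec v) * ι (Q n) x = (2 * s) • 1 - ι (Q n) x * ι (Q n) (vec v) := by
    rw [eq_sub_iff_add_eq, ι_mul_ι_add_swap, polar_apply, Algebra.algebraMap_eq_smul_one]
    simp [vec, hs]
  have hxx : ι (Q n) (xi n) * ι (Q n) x = (-2 * δ) • 1 - ι (Q n) x * ι (Q n) (xi n) := by
    rw [eq_sub_iff_add_eq, ι_mul_ι_add_swap, polar_apply, Algebra.algebraMap_eq_smul_one]
    congr 1
    simp [xi, e0, e1, hδ]; ring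
  have h1 : ι (Q n) (xi n) * ι (Q n) (vec v) * ι (Q n) x = (2 * s) • ι (Q n) (xi n) +
      (2 * δ) • ι (Q n) (vec v) + ι (Q n) x * (ι (Q n) (xi n) * ι (Q n) (vec v)) := by
    rw [mul_assoc, hvx, mul_sub, ← mul_assoc, hxx, sub_mul, smul_mul_assoc, one_mul,
      mul_smul_comm, mul_one, mul_assoc]
    module
  have h2 : ι (Q n) (vec v) * (ι (Q n) (xi n) * ι (Q n) (vec v)) =
      -(‖v‖ ^ 2) • ι (Q n) (xi n) := by
    rw [xi_mul_vec, mul_neg, ← mul_assoc, vec_mul_vec, ← Algebra.smul_def, neg_smul]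
  have h3 : ι (Q n) (xi n) * (ι (Q n) (xi n) * ι (Q n) (vec v)) = 0 := by
    rw [← mul_assoc, xi_mul_xi, zero_mul]
  rw [add_mul, one_mul, smul_mul_assoc, h1, mul_add, mul_one, map_add, map_add, map_smul, map_smul,
    mul_smul_comm, add_mul, add_mul, smul_mul_assoc, smul_mul_assoc, h2, h3]
  module

/-- The parameter of a unipotent element is recovered from its image in the Clifford
algebra by a linear map. -/
theorem exists_linearMap_leftInverse (n : ℕ) : ∃ r : CliffordAlgebra (Q n) →ₗ[ℝ] E n,
    ∀ w : E n, r ((spinUnip n ((Real.sqrt 2)⁻¹ • w)).1 - 1) = w := by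
  let vecL : E n →ₗ[ℝ] (I n → ℝ) :=
    { toFun := vec
      map_add' := fun v w => by funext i; rcases i with i | i <;> simp [vec]
      map_smul' := fun c w => by funext i; rcases i with i | i <;> simp [vec] }
  let T : E n →ₗ[ℝ] CliffordAlgebra (Q n) :=
    ((1 / 2 : ℝ) * (Real.sqrt 2)⁻¹) • (LinearMap.mulLeft ℝ (ι (Q n) (xi n)) ∘ₗ ι (Q n) ∘ₗ vecL)
  have hT : ∀ w : E n, (spinUnip n ((Real.sqrt 2)⁻¹ • w)).1 - 1 = T w := fun w => by
    rw [spinUnip_coe, add_sub_cancel_left]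
    have : vec ((Real.sqrt 2)⁻¹ • w) = (Real.sqrt 2)⁻¹ • vec w := map_smul vecL _ _
    rw [this, map_smul, mul_smul_comm, smul_smul]
    rfl
  have hker : LinearMap.ker T = ⊥ := by
    rw [LinearMap.ker_eq_bot']
    intro w hw
    have hw' : ι (Q n) (xi n) * ι (Q n) (vec w) = 0 := by
      have hne : (1 / 2 : ℝ) * (Real.sqrt 2)⁻¹ ≠ 0 := by positivity
      exact (smul_eq_zero.mp hw).resolve_left hne
    -- the opposite null vector `e₀ - e₁` recovers `w` from its product with `e₀ + e₁`
    have hη : ι (Q n) (e0 n - e1 n) * ι (Q n) (vec w) =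
        -(ι (Q n) (vec w) * ι (Q n) (e0 n - e1 n)) :=
      ι_anticomm (by rw [polar_apply]; simp [e0, e1, vec])
    have hs := ι_mul_ι_add_swap (Q := Q n) (e0 n - e1 n) (xi n)
    have hp : QuadraticMap.polar (Q n) (e0 n - e1 n) (xi n) = -4 := by
      rw [polar_apply]; simp [xi, e0, e1]; norm_num
    have h4 := congrArg (· * ι (Q n) (vec w)) hs
    simp only [add_mul, mul_assoc, hw', mul_zero, zero_add, hp] at h4
    rw [hη, mul_neg, ← mul_assoc, hw', zero_mul, neg_zero, ← Algebra.smul_def] at h4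
    have h5 : ι (Q n) (vec w) = 0 := by
      have := (smul_eq_zero.mp h4.symm).resolve_left (by norm_num)
      exact this
    have h6 : vec w = 0 := ι_injective n (by rw [h5, map_zero])
    ext j
    exact congrFun h6 (Sum.inr j)
  obtain ⟨r, hr⟩ := T.exists_leftInverse_of_injective hker
  exact ⟨r, fun w => by rw [hT]; exact LinearMap.congr_fun hr w⟩

/-- The spin group as a model. Its topology is realised by the left regular representation of the
Clifford algebra. -/
noncomputable def spinLorentzModel (n : ℕ) : LorentzModel (spinLorentzGroup n) where
  ρ :=
    { toFun := fun g => SpinG.act (n := n) g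
      map_one' := by
        refine LinearMap.ext fun x => (SpinG.act_eq_iff _ _ _).mpr ?_
        change (1 : CliffordAlgebra (Q n)) * _ = _ * 1
        rw [one_mul, mul_one]; rfl
      map_mul' := fun g h => by
        refine LinearMap.ext fun x => (SpinG.act_eq_iff _ _ _).mpr ?_
        change (g : SpinG n).1 * (h : SpinG n).1 * ι (Q n) x =
          ι (Q n) (SpinG.act (n := n) g (SpinG.act (n := n) h x)) *
            ((g : SpinG n).1 * (h : SpinG n).1)
        rw [mul_assoc, (SpinG.act_eq_iff (n := n) h x _).mp rfl, ← mul_assoc,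
          (SpinG.act_eq_iff (n := n) g _ _).mp rfl, mul_assoc] }
  form g x := SpinG.Q_act (n := n) g x
  cone g _ hx := SpinG.isFuture_act (n := n) g hx
  boost_xi t := by
    refine (SpinG.act_eq_iff (n := n) _ _ _).mpr ?_
    change (spinBoost n t).1 * _ = _ * (spinBoost n t).1
    rw [spinBoost_mul_xi, map_smul, smul_mul_assoc, xi_mul_spinBoost, smul_smul, ← Real.exp_add]
    congr 2; ring
  unip w x := spinUnip_act _ x
  boost_unip t w := by
    apply Subtype.ext
    change (spinBoost n t).1 * (spinUnip n ((Real.sqrt 2)⁻¹ • w)).1 =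
      (spinUnip n ((Real.sqrt 2)⁻¹ • Real.exp t • w)).1 * (spinBoost n t).1
    have hv : vec (Real.exp t • (Real.sqrt 2)⁻¹ • w) = Real.exp t • vec ((Real.sqrt 2)⁻¹ • w) := by
      funext i; rcases i with i | i <;> simp [vec]
    rw [smul_comm (Real.sqrt 2)⁻¹, spinUnip_coe, spinUnip_coe, hv, mul_add, add_mul, mul_one,
      one_mul, mul_smul_comm, ← mul_assoc, spinBoost_mul_xi, map_smul, mul_smul_comm,
      smul_mul_assoc, smul_mul_assoc, smul_mul_assoc, mul_assoc, ← spinBoost_comm_vec, ← mul_assoc,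
      xi_mul_spinBoost, smul_mul_assoc, smul_smul, smul_smul, smul_smul, mul_assoc, ← Real.exp_add]
    congr 3
    congr 1
    ring
  mem_K k := (SpinG.act_eq_iff (n := n) k _ _).symm
  mem_M m h0 h1 := by
    have c0 := (SpinG.act_eq_iff (n := n) m _ _).mp h0
    have c1 := (SpinG.act_eq_iff (n := n) m _ _).mp h1
    refine ⟨Subgroup.mem_centralizer_iff.mpr ?_, c0⟩
    have : (spinLorentzGroup n).A ≤ Subgroup.centralizer {m} := by
      rw [IwasawaGroup.A, Subgroup.closure_le]
      rintro _ ⟨t, rfl⟩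
      refine Subgroup.mem_centralizer_iff.mpr fun g hg => ?_
      rw [Set.mem_singleton_iff.mp hg]
      apply Subtype.ext
      change (m : SpinG n).1 * (spinBoost n t).1 = (spinBoost n t).1 * (m : SpinG n).1
      rw [spinBoost_coe, mul_add, add_mul, Algebra.commutes, mul_smul_comm, smul_mul_assoc,
        ← mul_assoc, c0, mul_assoc, c1, mul_assoc]
    intro g hg
    exact (Subgroup.mem_centralizer_iff.mp (this hg) m rfl).symm
  exists_refl p q hp hq hQp hQq := by
    have key : ∀ p : I n → ℝ, Q n p = 1 → ∀ y,
        ι (Q n) (refl p y) * ι (Q n) p = -(ι (Q n) p * ι (Q n) y) := fun p h y => by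
      have h1 : ι (Q n) p * ι (Q n) y = algebraMap ℝ _ (QuadraticMap.polar (Q n) p y) -
          ι (Q n) y * ι (Q n) p := by rw [← ι_mul_ι_add_swap]; abel
      rw [h1, refl, map_sub, map_smul, sub_mul, smul_mul_assoc, ι_sq_scalar, h, map_one,
        Algebra.algebraMap_eq_smul_one]
      abel
    refine ⟨(⟨_, mul_mem_spin p q (by rw [hQp, hQq, one_mul])⟩ : SpinG n), fun x => ?_⟩
    refine (SpinG.act_eq_iff (n := n) _ _ _).mpr ?_
    change ι (Q n) p * ι (Q n) q * ι (Q n) x = _ * (ι (Q n) p * ι (Q n) q)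
    rw [← mul_assoc, key p hQp, neg_mul, mul_assoc (ι (Q n) p) _ (ι (Q n) q), key q hQq,
      mul_neg, neg_neg, mul_assoc]
  exists_matrix := by
    have := finite_cliffordAlgebra n
    let _ : TopologicalSpace (CliffordAlgebra (Q n)) := moduleTopology ℝ _
    have : IsModuleTopology ℝ (CliffordAlgebra (Q n)) := ⟨rfl⟩
    have : ContinuousAdd (CliffordAlgebra (Q n)) := IsModuleTopology.toContinuousAdd ℝ _
    let b := Module.finBasis ℝ (CliffordAlgebra (Q n))
    let L := Algebra.leftMulMatrix b
    obtain ⟨r, hr⟩ := L.toLinearMap.exists_leftInverse_of_injective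
      (LinearMap.ker_eq_bot.mpr (Algebra.leftMulMatrix_injective b))
    have hL : IsInducing L := by
      refine IsInducing.of_comp (g := r)
        (IsModuleTopology.continuous_of_linearMap L.toLinearMap) ?_ ?_
      · have : IsModuleTopology ℝ (Matrix (Fin (Module.finrank ℝ (CliffordAlgebra (Q n))))
            (Fin (Module.finrank ℝ (CliffordAlgebra (Q n)))) ℝ) :=
          inferInstanceAs (IsModuleTopology ℝ (Fin _ → Fin _ → ℝ))
        exact IsModuleTopology.continuous_of_linearMap r
      · convert! IsInducing.id using 1
        funext x
        exact LinearMap.congr_fun hr x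
    exact ⟨_, inferInstance, inferInstance,
      { toFun := fun g => L (g : SpinG n).1
        map_one' := map_one L
        map_mul' := fun _ _ => map_mul L _ _ }, hL.comp ⟨rfl⟩⟩
  isInducing_u := by
    let _ : TopologicalSpace (CliffordAlgebra (Q n)) := moduleTopology ℝ _
    have : IsModuleTopology ℝ (CliffordAlgebra (Q n)) := ⟨rfl⟩
    have : ContinuousAdd (CliffordAlgebra (Q n)) := IsModuleTopology.toContinuousAdd ℝ _
    have := IsModuleTopology.topologicalAddGroup ℝ (CliffordAlgebra (Q n))
    have hval : IsInducing fun g : (spinLorentzGroup n).G => (g : SpinG n).1 := ⟨rfl⟩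
    have hc : Continuous fun w : E n => (spinLorentzGroup n).u (Multiplicative.ofAdd w) := by
      rw [hval.continuous_iff]
      let T : E n →ₗ[ℝ] CliffordAlgebra (Q n) :=
        { toFun := fun w => (1 / 2 : ℝ) • (ι (Q n) (xi n) * ι (Q n) (vec ((Real.sqrt 2)⁻¹ • w)))
          map_add' := fun v w => by
            have : vec ((Real.sqrt 2)⁻¹ • (v + w)) =
                vec ((Real.sqrt 2)⁻¹ • v) + vec ((Real.sqrt 2)⁻¹ • w) := by
              funext i; rcases i with i | i <;> simp [vec]
            rw [this, map_add, mul_add, smul_add]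
          map_smul' := fun c w => by
            have : vec ((Real.sqrt 2)⁻¹ • c • w) = c • vec ((Real.sqrt 2)⁻¹ • w) := by
              funext i; rcases i with i | i <;> simp [vec]; ring
            rw [this, map_smul, mul_smul_comm, smul_comm]; rfl }
      exact continuous_const.add (LinearMap.continuous_of_finiteDimensional T)
    obtain ⟨r, hr⟩ := exists_linearMap_leftInverse n
    refine IsInducing.of_comp hc (g := fun g : (spinLorentzGroup n).G =>
      r ((g : SpinG n).1 - 1)) ?_ ?_
    · exact (IsModuleTopology.continuous_of_linearMap r).comp
        (hval.continuous.sub continuous_const)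
    · convert! IsInducing.id using 1
      funext w
      exact hr w

/-! ### Shimizu's lemma -/

theorem isTopologicalGroup_of_isInducing {𝔸 G : Type*} [NormedRing 𝔸] [CompleteSpace 𝔸] [Group G]
    [TopologicalSpace G] (φ : G →* 𝔸) (hφ : IsInducing φ) : IsTopologicalGroup G :=
  { hφ.continuousMul φ with
    continuous_inv := by
      rw [hφ.continuous_iff, continuous_iff_continuousAt]
      intro g
      let U : 𝔸ˣ := Units.map φ (toUnits g)
      have h : (φ ∘ fun g => g⁻¹) = Ring.inverse ∘ φ := by
        funext x
        have := Ring.inverse_unit (Units.map φ (toUnits x))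
        simpa using this.symm
      rw [h]
      exact ContinuousAt.comp (NormedRing.inverse_continuousAt U) hφ.continuous.continuousAt }

/-- The sequence `β, β α β⁻¹, (β α β⁻¹) α (β α β⁻¹)⁻¹, …` of iterated conjugates of `α`. -/
def conjSeq {G : Type*} [Group G] (α β : G) : ℕ → G
  | 0 => β
  | k + 1 => conjSeq α β k * α * (conjSeq α β k)⁻¹

theorem conjSeq_mem {G : Type*} [Group G] {Γ : Subgroup G} {α β : G} (hα : α ∈ Γ) (hβ : β ∈ Γ)
    (k : ℕ) : conjSeq α β k ∈ Γ := by
  induction k with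
  | zero => exact hβ
  | succ k ih => exact Γ.mul_mem (Γ.mul_mem ih hα) (Γ.inv_mem ih)

/-- Near the identity, conjugating `α` by `b` contracts the distance of `b` to `α`, because
`b α - α b = (b - α) (α - 1) - (α - 1) (b - α)`. -/
theorem norm_conj_sub_le {𝔸 G : Type*} [NormedRing 𝔸] [Group G] (φ : G →* 𝔸)
    (h1 : ‖(1 : 𝔸)‖ ≤ 1) {α b : G} (hα : ‖φ α - 1‖ ≤ 1 / 16) (hb : ‖φ b - 1‖ ≤ 1 / 4) :
    ‖φ (b * α * b⁻¹) - φ α‖ ≤ 1 / 2 * ‖φ b - φ α‖ := by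
  have hbb : φ b * φ b⁻¹ = 1 := by rw [← map_mul, mul_inv_cancel, map_one]
  have hinv : ‖φ b⁻¹‖ ≤ 2 := by
    have e : φ b⁻¹ = 1 - (φ b - 1) * φ b⁻¹ := by rw [sub_mul, hbb, one_mul]; abel
    have h2 : ‖φ b⁻¹‖ ≤ 1 + 1 / 4 * ‖φ b⁻¹‖ := by
      calc ‖φ b⁻¹‖ = ‖1 - (φ b - 1) * φ b⁻¹‖ := congrArg _ e
        _ ≤ ‖(1 : 𝔸)‖ + ‖(φ b - 1) * φ b⁻¹‖ := norm_sub_le _ _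
        _ ≤ 1 + 1 / 4 * ‖φ b⁻¹‖ := add_le_add h1 ((norm_mul_le _ _).trans
            (mul_le_mul_of_nonneg_right hb (norm_nonneg _)))
    linarith
  have e : φ (b * α * b⁻¹) - φ α =
      ((φ b - φ α) * (φ α - 1) - (φ α - 1) * (φ b - φ α)) * φ b⁻¹ := by
    have : (φ b - φ α) * (φ α - 1) - (φ α - 1) * (φ b - φ α) = φ b * φ α - φ α * φ b := by
      noncomm_ring
    rw [this, sub_mul, mul_assoc (φ α), hbb, mul_one, map_mul, map_mul]
  have h3 : ‖(φ b - φ α) * (φ α - 1) - (φ α - 1) * (φ b - φ α)‖ ≤ 1 / 8 * ‖φ b - φ α‖ := by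
    refine (norm_sub_le _ _).trans ?_
    have a1 := (norm_mul_le (φ b - φ α) (φ α - 1)).trans
      (mul_le_mul_of_nonneg_left hα (norm_nonneg _))
    have a2 := (norm_mul_le (φ α - 1) (φ b - φ α)).trans
      (mul_le_mul_of_nonneg_right hα (norm_nonneg _))
    linarith
  rw [e]
  refine (norm_mul_le _ _).trans ((mul_le_mul h3 hinv (norm_nonneg _) (by positivity)).trans ?_)
  nlinarith [norm_nonneg (φ b - φ α)]

theorem norm_conjSeq_sub_le {𝔸 G : Type*} [NormedRing 𝔸] [Group G] (φ : G →* 𝔸)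
    (h1 : ‖(1 : 𝔸)‖ ≤ 1) {α β : G} (hα : ‖φ α - 1‖ ≤ 1 / 16) (hβ : ‖φ β - 1‖ ≤ 1 / 16) (k : ℕ) :
    ‖φ (conjSeq α β k) - φ α‖ ≤ 1 / 8 * (1 / 2) ^ k := by
  induction k with
  | zero =>
    have := norm_sub_le (φ β - 1) (φ α - 1)
    rw [sub_sub_sub_cancel_right] at this
    simp only [conjSeq, pow_zero]
    linarith
  | succ k ih =>
    have hp : (1 / 2 : ℝ) ^ k ≤ 1 := pow_le_one₀ (by norm_num) (by norm_num)
    have hb : ‖φ (conjSeq α β k) - 1‖ ≤ 1 / 4 := by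
      have := norm_add_le (φ (conjSeq α β k) - φ α) (φ α - 1)
      rw [sub_add_sub_cancel] at this
      linarith
    refine (norm_conj_sub_le φ h1 hα hb).trans ?_
    rw [pow_succ]
    linarith

/-- In a discrete group the iterated conjugates of an element near the identity, formed with another
one, become stationary. -/
theorem exists_conjSeq_eq {𝔸 G : Type*} [NormedRing 𝔸] [Group G] [TopologicalSpace G] (φ : G →* 𝔸)
    (hφ : IsInducing φ) (h1 : ‖(1 : 𝔸)‖ ≤ 1) (Γ : Subgroup G) [DiscreteTopology Γ] {α β : G}
    (hαΓ : α ∈ Γ) (hβΓ : β ∈ Γ) (hα : ‖φ α - 1‖ ≤ 1 / 16) (hβ : ‖φ β - 1‖ ≤ 1 / 16) :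
    ∃ k, conjSeq α β k = α := by
  have ht : Tendsto (fun k => (⟨conjSeq α β k, conjSeq_mem hαΓ hβΓ k⟩ : Γ)) atTop (𝓝 ⟨α, hαΓ⟩) := by
    rw [IsInducing.subtypeVal.tendsto_nhds_iff, hφ.tendsto_nhds_iff,
      tendsto_iff_norm_sub_tendsto_zero]
    refine squeeze_zero (fun _ => norm_nonneg _) (norm_conjSeq_sub_le φ h1 hα hβ) ?_
    have := (tendsto_pow_atTop_nhds_zero_of_lt_one (r := (1 / 2 : ℝ)) (by norm_num)
      (by norm_num)).const_mul (1 / 8)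
    rwa [mul_zero] at this
  rw [nhds_discrete, tendsto_pure] at ht
  obtain ⟨k, hk⟩ := ht.exists
  exact ⟨k, congrArg Subtype.val hk⟩

namespace LorentzModel

variable {n : ℕ} {S : IwasawaGroup n} (H : LorentzModel S)

/-- If a conjugate of a nontrivial element of `N` fixes the null line of `e₀ + e₁`, then so does the
conjugating element. -/
theorem fixed_of_conj_unip_fixed {g : S.G} {w : E n} (hw : w ≠ 0) {c : ℝ}
    (h : H.ρ (g * S.u (Multiplicative.ofAdd w) * g⁻¹) (xi n) = c • xi n) :
    ∃ d : ℝ, H.ρ g (xi n) = d • xi n := by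
  have h1 : H.ρ (S.u (Multiplicative.ofAdd w)) (H.ρ g⁻¹ (xi n)) = c • H.ρ g⁻¹ (xi n) := by
    rw [← map_smul, ← h, H.ρ_mul_apply, H.ρ_mul_apply, H.ρ_inv_apply]
  rw [H.unip] at h1
  obtain ⟨d, hd⟩ := eq_smul_xi_of_unip_fixed (smul_ne_zero (by positivity) hw)
    (by rw [H.form, Q_xi]) h1
  have hd0 : d ≠ 0 := by
    rintro rfl
    rw [zero_smul] at hd
    exact H.ρ_ne_zero g⁻¹ (xi_ne_zero n) hd
  refine ⟨d⁻¹, ?_⟩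
  have h2 : xi n = d • H.ρ g (xi n) := by rw [← map_smul, ← hd, H.ρ_apply_inv]
  conv_rhs => rw [h2, smul_smul, inv_mul_cancel₀ hd0, one_smul]

theorem fixed_of_conjSeq_eq {w : E n} (hw : w ≠ 0) {β : S.G} {k : ℕ}
    (h : ∃ c : ℝ, H.ρ (conjSeq (S.u (Multiplicative.ofAdd w)) β k) (xi n) = c • xi n) :
    ∃ c : ℝ, H.ρ β (xi n) = c • xi n := by
  induction k with
  | zero => exact h
  | succ k ih =>
    obtain ⟨c, hc⟩ := h
    exact ih (H.fixed_of_conj_unip_fixed hw hc)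

/-- **Shimizu's lemma.** If a discrete group contains `u(v)` and `h u(w) h⁻¹`, both close to the
identity and not trivial, then `h` lies in the standard parabolic subgroup. -/
theorem shimizu (H : LorentzModel S) {𝔸 : Type*} [NormedRing 𝔸] (φ : S.G →* 𝔸) (hφ : IsInducing φ)
    (h1 : ‖(1 : 𝔸)‖ ≤ 1) (Γ : Subgroup S.G) [DiscreteTopology Γ] {v w : E n} (hv : v ≠ 0)
    (hw : w ≠ 0) {h : S.G} (hvΓ : S.u (Multiplicative.ofAdd v) ∈ Γ)
    (hwΓ : h * S.u (Multiplicative.ofAdd w) * h⁻¹ ∈ Γ)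
    (hvn : ‖φ (S.u (Multiplicative.ofAdd v)) - 1‖ ≤ 1 / 16)
    (hwn : ‖φ (h * S.u (Multiplicative.ofAdd w) * h⁻¹) - 1‖ ≤ 1 / 16) : h ∈ S.P := by
  obtain ⟨k, hk⟩ := exists_conjSeq_eq φ hφ h1 Γ hvΓ hwΓ hvn hwn
  obtain ⟨c, hc⟩ := H.fixed_of_conjSeq_eq hv (k := k) ⟨1, by rw [hk, H.unip_xi, one_smul]⟩
  obtain ⟨d, hd⟩ := H.fixed_of_conj_unip_fixed hw hc
  exact H.mem_P_of_fixed hd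

theorem exists_normedRing (H : LorentzModel S) : ∃ (𝔸 : Type) (_ : NormedRing 𝔸)
    (_ : CompleteSpace 𝔸) (_ : SecondCountableTopology 𝔸) (φ : S.G →* 𝔸), IsInducing φ ∧
      ‖(1 : 𝔸)‖ ≤ 1 := by
  obtain ⟨κ, _, _, φ, hφ⟩ := H.exists_matrix
  open scoped Matrix.Norms.Operator in
  refine ⟨Matrix κ κ ℝ, inferInstance, inferInstance, ?_, φ, hφ, ?_⟩
  · exact inferInstanceAs (SecondCountableTopology (κ → κ → ℝ))
  · rcases isEmpty_or_nonempty κ with h | h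
    · rw [Subsingleton.elim (1 : Matrix κ κ ℝ) 0, norm_zero]; exact zero_le_one
    · rw [norm_one]

theorem isTopologicalGroup (H : LorentzModel S) : IsTopologicalGroup S.G := by
  obtain ⟨𝔸, _, _, _, φ, hφ, -⟩ := H.exists_normedRing
  exact isTopologicalGroup_of_isInducing φ hφ

theorem secondCountableTopology (H : LorentzModel S) : SecondCountableTopology S.G := by
  obtain ⟨𝔸, _, _, _, φ, hφ, -⟩ := H.exists_normedRing
  exact hφ.secondCountableTopology

theorem u_injective (H : LorentzModel S) :
    Function.Injective fun w : E n => S.u (Multiplicative.ofAdd w) := by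
  intro v w h
  have h' : H.ρ (S.u (Multiplicative.ofAdd v)) (e0 n) =
    H.ρ (S.u (Multiplicative.ofAdd w)) (e0 n) := congrArg (fun g => H.ρ g (e0 n)) h
  rw [H.unip, H.unip] at h'
  ext j
  have := congrFun h' (Sum.inr j)
  rw [unipMatrix_mulVec_inr, unipMatrix_mulVec_inr] at this
  simpa [e0] using this

/-- A uniform scale `r` and a uniform neighbourhood `W` of the identity: quotients of elements of
`W` satisfy the hypotheses of Shimizu's lemma for vectors of length at most `r`, and do not contain
translations by vectors of length at least `r`. -/
theorem exists_scale (H : LorentzModel S) : ∃ r : ℝ, 0 < r ∧ ∃ W : Set S.G, IsOpen W ∧ 1 ∈ W ∧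
    ∀ x ∈ W, ∀ y ∈ W,
      (∀ (Γ : Subgroup S.G) [DiscreteTopology Γ] (v w : E n), v ≠ 0 → w ≠ 0 → ‖v‖ ≤ r → ‖w‖ ≤ r →
        S.u (Multiplicative.ofAdd v) ∈ Γ →
        x * y⁻¹ * S.u (Multiplicative.ofAdd w) * (x * y⁻¹)⁻¹ ∈ Γ → x * y⁻¹ ∈ S.P) ∧
      ∀ w : E n, x * y⁻¹ = S.u (Multiplicative.ofAdd w) → ‖w‖ < r := by
  obtain ⟨𝔸, _, _, _, φ, hφ, h1⟩ := H.exists_normedRing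
  have := H.isTopologicalGroup
  have hu := H.isInducing_u.continuous
  have hu0 : S.u (Multiplicative.ofAdd (0 : E n)) = 1 := S.u.map_one
  have hF : Tendsto (fun p : S.G × E n => φ (p.1 * S.u (Multiplicative.ofAdd p.2) * p.1⁻¹))
      (𝓝 1 ×ˢ 𝓝 0) (𝓝 1) := by
    have hc : Continuous fun p : S.G × E n => φ (p.1 * S.u (Multiplicative.ofAdd p.2) * p.1⁻¹) :=
      hφ.continuous.comp ((continuous_fst.mul (hu.comp continuous_snd)).mul continuous_fst.inv)
    have := hc.tendsto (1, 0)
    rw [nhds_prod_eq] at this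
    simpa [hu0] using this
  have hball : ∀ᶠ p : S.G × E n in 𝓝 1 ×ˢ 𝓝 0,
      ‖φ (p.1 * S.u (Multiplicative.ofAdd p.2) * p.1⁻¹) - 1‖ ≤ 1 / 16 := by
    have := hF (Metric.closedBall_mem_nhds (1 : 𝔸) (show (0 : ℝ) < 1 / 16 by norm_num))
    filter_upwards [this] with p hp
    simpa [dist_eq_norm] using hp
  obtain ⟨pU, hU, pV, hV, hUV⟩ := eventually_prod_iff.mp hball
  obtain ⟨r, hr, hrV⟩ := Metric.nhds_basis_closedBall.mem_iff.mp hV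
  have hsmall : ∀ᶠ g in 𝓝 (1 : S.G), ∀ w : E n, g = S.u (Multiplicative.ofAdd w) → ‖w‖ < r := by
    have h := H.isInducing_u.nhds_eq_comap (0 : E n)
    have hb : Metric.ball (0 : E n) r ∈ 𝓝 (0 : E n) := Metric.ball_mem_nhds _ hr
    rw [h, hu0] at hb
    obtain ⟨T, hT, hTb⟩ := hb
    filter_upwards [hT] with g hg w hw
    have : w ∈ Metric.ball (0 : E n) r := hTb (by rw [Set.mem_preimage, ← hw]; exact hg)
    simpa using this
  have hdiv : Tendsto (fun p : S.G × S.G => p.1 * p.2⁻¹) (𝓝 1 ×ˢ 𝓝 1) (𝓝 1) := by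
    have hc : Continuous fun p : S.G × S.G => p.1 * p.2⁻¹ := continuous_fst.mul continuous_snd.inv
    have := hc.tendsto (1, 1)
    rw [nhds_prod_eq] at this
    simpa using this
  obtain ⟨T, hT, hT'⟩ := (Filter.eventually_prod_self_iff (r := fun x y : S.G => pU (x * y⁻¹) ∧
    ∀ w : E n, x * y⁻¹ = S.u (Multiplicative.ofAdd w) → ‖w‖ < r)).mp
    (hdiv.eventually (hU.and hsmall))
  obtain ⟨W, hWT, hWo, hW1⟩ := mem_nhds_iff.mp hT
  refine ⟨r, hr, W, hWo, hW1, fun x hx y hy => ?_⟩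
  obtain ⟨hxU, hxs⟩ := hT' x (hWT hx) y (hWT hy)
  refine ⟨fun Γ _ v w hv hw hvr hwr hvΓ hwΓ => ?_, hxs⟩
  refine H.shimizu φ hφ h1 Γ hv hw hvΓ hwΓ ?_ (hUV hxU (hrV (by simpa using hwr)))
  have := hUV hU.self_of_nhds (hrV (show v ∈ Metric.closedBall 0 r by simpa using hvr))
  simpa using this

end LorentzModel

/-! ### Cusps of a discrete group -/

theorem mem_conj {G : Type} [Group G] {g x : G} {H : Subgroup G} :
    x ∈ conj g H ↔ g⁻¹ * x * g ∈ H := by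
  constructor
  · rintro ⟨y, hy, rfl⟩
    simpa [mul_assoc] using hy
  · intro h
    exact ⟨_, h, by simp [mul_assoc]⟩

theorem conj_mul {G : Type} [Group G] (g h : G) (H : Subgroup G) :
    conj (g * h) H = conj g (conj h H) := by
  ext x; simp [mem_conj, mul_assoc]

theorem conj_one {G : Type} [Group G] (H : Subgroup G) : conj 1 H = H := by
  ext x; simp [mem_conj]

theorem conj_eq_self {G : Type} [Group G] {g : G} {H : Subgroup G} (hg : g ∈ H) :
    conj g H = H := by
  ext x
  rw [mem_conj, H.mul_mem_cancel_right hg, H.mul_mem_cancel_left (H.inv_mem hg)]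

namespace LorentzModel

variable {n : ℕ} {S : IwasawaGroup n}

theorem conj_frame (H : LorentzModel S) (hn : 1 ≤ n) {P' : Subgroup S.G} (hP : S.IsParabolic P') :
    conj (S.frame P') S.P = P' := by
  have h : ∃ k ∈ S.K, P' = conj k S.P := by
    obtain ⟨g, hg⟩ := hP
    obtain ⟨k, hk, p, hp, rfl⟩ := H.exists_K_mul_P hn g
    exact ⟨k, hk, by rw [hg, conj_mul, conj_eq_self hp]⟩
  rw [IwasawaGroup.frame, dif_pos h]
  exact h.choose_spec.2.symm

theorem boost_conj (H : LorentzModel S) (g : S.G) (t : ℝ) (w : E n) :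
    g * S.a t * S.u (Multiplicative.ofAdd w) * (g * S.a t)⁻¹ =
      g * S.u (Multiplicative.ofAdd (Real.exp t • w)) * g⁻¹ := by
  rw [mul_assoc g, H.boost_unip]
  group

end LorentzModel

/-- A discrete subgroup that spans a space of positive dimension contains a nonzero vector of
minimal length. -/
theorem exists_min_norm {n : ℕ} (hn : 1 ≤ n) (Λ : Submodule ℤ (E n)) [DiscreteTopology Λ]
    (hs : Submodule.span ℝ (Λ : Set (E n)) = ⊤) :
    ∃ w ∈ Λ, w ≠ 0 ∧ ∀ v ∈ Λ, v ≠ 0 → ‖w‖ ≤ ‖v‖ := by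
  have hne : ∃ w ∈ Λ, w ≠ 0 := by
    by_contra! h
    have h0 : Submodule.span ℝ (Λ : Set (E n)) = ⊥ := Submodule.span_eq_bot.mpr h
    have : Nonempty (Fin (2 * n)) := ⟨⟨0, by omega⟩⟩
    have : Nontrivial (E n) := inferInstance
    exact bot_ne_top (h0.symm.trans hs)
  obtain ⟨w₀, hw₀, hw₀'⟩ := hne
  have hdisc : DiscreteTopology Λ.toAddSubgroup := inferInstanceAs (DiscreteTopology Λ)
  have hfin : (Metric.closedBall (0 : E n) ‖w₀‖ ∩ (Λ : Set (E n))).Finite :=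
    Metric.finite_isBounded_inter_isClosed ⟨inferInstanceAs (DiscreteTopology Λ)⟩
      Metric.isBounded_closedBall
      (AddSubgroup.isClosed_of_discrete (H := Λ.toAddSubgroup))
  have hfin' : {v | v ∈ Λ ∧ v ≠ 0 ∧ ‖v‖ ≤ ‖w₀‖}.Finite := hfin.subset
    (fun v hv => ⟨by simpa using hv.2.2, hv.1⟩)
  obtain ⟨w, hw, hmin⟩ := Set.exists_min_image _ (fun v : E n => ‖v‖) hfin' ⟨w₀, hw₀, hw₀', le_rfl⟩
  refine ⟨w, hw.1, hw.2.1, fun v hv hv0 => ?_⟩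
  rcases le_total ‖v‖ ‖w₀‖ with h | h
  · exact hmin v ⟨hv, hv0, h⟩
  · exact hw.2.2.trans h

namespace LorentzModel

variable {n : ℕ} {S : IwasawaGroup n}

/-- Every cusp has a frame `g` in which the shortest translations have the prescribed length `r`. -/
theorem exists_scaled_frame (H : LorentzModel S) (hn : 1 ≤ n) {r : ℝ} (hr : 0 < r)
    {Γ P' : Subgroup S.G} (hP : S.IsCuspidal Γ P') : ∃ g : S.G, conj g S.P = P' ∧
      conj g S.N = S.nilradical P' ∧
      (∃ w : E n, ‖w‖ = r ∧ g * S.u (Multiplicative.ofAdd w) * g⁻¹ ∈ Γ) ∧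
      ∀ w : E n, g * S.u (Multiplicative.ofAdd w) * g⁻¹ ∈ Γ → w ≠ 0 → r ≤ ‖w‖ := by
  obtain ⟨hpar, hdisc, hspan⟩ := hP
  obtain ⟨v, hv, hv0, hmin⟩ := exists_min_norm hn _ hspan
  have hvn : 0 < ‖v‖ := norm_pos_iff.mpr hv0
  set t := Real.log (‖v‖ / r) with ht
  have hexp : Real.exp t = ‖v‖ / r := Real.exp_log (by positivity)
  refine ⟨S.frame P' * S.a t, ?_, ?_, ⟨(Real.exp t)⁻¹ • v, ?_, ?_⟩, ?_⟩
  · rw [conj_mul, conj_eq_self (S.a_mem_P t), H.conj_frame hn hpar]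
  · rw [conj_mul, IwasawaGroup.nilradical]
    congr 1
    ext x
    rw [mem_conj]
    constructor
    · rintro ⟨w, hw⟩
      refine ⟨Multiplicative.ofAdd (Real.exp t • w.toAdd), ?_⟩
      have := H.boost_conj 1 t w.toAdd
      rw [ofAdd_toAdd, hw] at this
      simpa [mul_assoc] using this.symm
    · rintro ⟨w, rfl⟩
      refine ⟨Multiplicative.ofAdd ((Real.exp t)⁻¹ • w.toAdd), ?_⟩
      have := H.boost_unip t ((Real.exp t)⁻¹ • w.toAdd)
      rw [smul_smul, mul_inv_cancel₀ (Real.exp_pos t).ne', one_smul, ofAdd_toAdd] at this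
      rw [mul_assoc, ← this, inv_mul_cancel_left]
  · rw [norm_smul, norm_inv, Real.norm_of_nonneg (Real.exp_pos t).le, hexp]
    field_simp
  · rw [H.boost_conj, smul_smul, mul_inv_cancel₀ (Real.exp_pos t).ne', one_smul]
    exact hv
  · intro w hw hw0
    rw [H.boost_conj] at hw
    have := hmin _ hw (smul_ne_zero (Real.exp_pos t).ne' hw0)
    rw [norm_smul, Real.norm_of_nonneg (Real.exp_pos t).le, hexp, div_mul_eq_mul_div,
      le_div_iff₀ hr] at this
    exact le_of_mul_le_mul_left this hvn

theorem discreteTopology_conj (H : LorentzModel S) (g : S.G) (Γ : Subgroup S.G)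
    [DiscreteTopology Γ] : DiscreteTopology (conj g Γ) := by
  have := H.isTopologicalGroup
  have hc : Continuous fun x : conj g Γ => (⟨g⁻¹ * x.1 * g, mem_conj.mp x.2⟩ : Γ) := by fun_prop
  refine DiscreteTopology.of_continuous_injective hc fun x y h => ?_
  have := congrArg Subtype.val h
  exact Subtype.ext (by simpa using this)

/-- The `Γ`-translates of the neighbourhood `W` at the scaled frames of inequivalent cusps are
disjoint: Shimizu's lemma forces cusps with overlapping translates to be equivalent, and by the
parabolic condition an element of `Γ` that makes the translates at one cusp overlap is a unipotent
translation shorter than the shortest one. -/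
theorem packing (H : LorentzModel S) {r : ℝ} (hr : 0 < r) {W : Set S.G}
    (hW : ∀ x ∈ W, ∀ y ∈ W,
      (∀ (Γ : Subgroup S.G) [DiscreteTopology Γ] (v w : E n), v ≠ 0 → w ≠ 0 → ‖v‖ ≤ r → ‖w‖ ≤ r →
        S.u (Multiplicative.ofAdd v) ∈ Γ →
        x * y⁻¹ * S.u (Multiplicative.ofAdd w) * (x * y⁻¹)⁻¹ ∈ Γ → x * y⁻¹ ∈ S.P) ∧
      ∀ w : E n, x * y⁻¹ = S.u (Multiplicative.ofAdd w) → ‖w‖ < r)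
    {Γ : Subgroup S.G} [DiscreteTopology Γ] (hpar : S.ParabolicCondition Γ)
    {P₁ P₂ : Subgroup S.G} (hP₁ : S.IsCuspidal Γ P₁)
    {g₁ g₂ : S.G} (e₁ : conj g₁ S.P = P₁) (e₁' : conj g₁ S.N = S.nilradical P₁)
    (h₁ : ∃ w : E n, ‖w‖ = r ∧ g₁ * S.u (Multiplicative.ofAdd w) * g₁⁻¹ ∈ Γ)
    (m₁ : ∀ w : E n, g₁ * S.u (Multiplicative.ofAdd w) * g₁⁻¹ ∈ Γ → w ≠ 0 → r ≤ ‖w‖)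
    (e₂ : conj g₂ S.P = P₂)
    (h₂ : ∃ w : E n, ‖w‖ = r ∧ g₂ * S.u (Multiplicative.ofAdd w) * g₂⁻¹ ∈ Γ)
    (hne : ∀ γ ∈ Γ, conj γ P₁ = P₂ → g₁ = g₂)
    {γ : S.G} (hγ : γ ∈ Γ) {x y : S.G} (hx : x ∈ W) (hy : y ∈ W)
    (h : γ * (g₁ * x) = g₂ * y) : conj γ P₁ = P₂ ∧ γ = 1 := by
  have := H.discreteTopology_conj g₂⁻¹ Γ
  obtain ⟨w₁, hw₁, hw₁Γ⟩ := h₁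
  obtain ⟨w₂, hw₂, hw₂Γ⟩ := h₂
  have hq : y * x⁻¹ = g₂⁻¹ * γ * g₁ := by
    have : y = g₂⁻¹ * (γ * (g₁ * x)) := by rw [h]; group
    rw [this]; group
  have hnz : ∀ w : E n, ‖w‖ = r → w ≠ 0 := by
    rintro w hw rfl
    rw [norm_zero] at hw; exact hr.ne hw
  have hmem : y * x⁻¹ ∈ S.P := by
    refine (hW y hy x hx).1 (conj g₂⁻¹ Γ) w₂ w₁ (hnz _ hw₂) (hnz _ hw₁) hw₂.le hw₁.le ?_ ?_
    · rw [mem_conj, inv_inv]; exact hw₂Γ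
    · rw [mem_conj, inv_inv, hq]
      have : g₂ * (g₂⁻¹ * γ * g₁ * S.u (Multiplicative.ofAdd w₁) * (g₂⁻¹ * γ * g₁)⁻¹) * g₂⁻¹ =
          γ * (g₁ * S.u (Multiplicative.ofAdd w₁) * g₁⁻¹) * γ⁻¹ := by group
      rw [this]
      exact Γ.mul_mem (Γ.mul_mem hγ hw₁Γ) (Γ.inv_mem hγ)
  have hconj : conj γ P₁ = P₂ := by
    have : γ * g₁ = g₂ * (y * x⁻¹) := by rw [hq]; group
    rw [← e₁, ← conj_mul, this, conj_mul, conj_eq_self hmem, e₂]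
  refine ⟨hconj, ?_⟩
  obtain rfl := hne γ hγ hconj
  have hγP : γ ∈ P₁ := by
    rw [← e₁, mem_conj, ← hq]; exact hmem
  have hγN : γ ∈ S.nilradical P₁ := by
    have : γ ∈ Γ ⊓ S.nilradical P₁ := hpar P₁ hP₁ ▸ ⟨hγ, hγP⟩
    exact this.2
  rw [← e₁', mem_conj] at hγN
  obtain ⟨w, hw⟩ := hγN
  have hlt := (hW y hy x hx).2 w.toAdd (by rw [hq, ofAdd_toAdd, hw])
  have hw0 : w.toAdd = 0 := by
    by_contra hw0
    refine absurd (m₁ w.toAdd ?_ hw0) (not_le.mpr hlt)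
    rw [ofAdd_toAdd, hw]
    convert hγ using 1
    group
  have hw1 : w = 1 := hw0
  rw [hw1, map_one] at hw
  have : γ = g₁ * 1 * g₁⁻¹ := by rw [hw]; group
  rw [this]; group

end LorentzModel

/-- A set whose translates under a subgroup `Γ` of finite index in `Γ₀` are disjoint has at most
`[Γ₀ : Γ]` times the volume of a fundamental domain of `Γ₀`. -/
theorem measure_le_relIndex_mul {G : Type*} [Group G] [MeasurableSpace G] [MeasurableMul G]
    {μ : Measure G} [μ.IsMulLeftInvariant] {Γ₀ Γ : Subgroup G} [Countable Γ₀]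
    (hfin : Γ.relIndex Γ₀ ≠ 0) {F : Set G} (hF : IsFundamentalDomain Γ₀ F μ) {t : Set G}
    (ht : MeasurableSet t)
    (hd : ∀ γ ∈ Γ, ∀ x ∈ t, ∀ y ∈ t, γ * x = y → γ = 1) :
    μ t ≤ Γ.relIndex Γ₀ * μ F := by
  -- Decompose `t` by the translates of `F` and group them by the cosets of `Γ` in `Γ₀`; the pieces
  -- that belong to one coset are disjoint after translation into `F`.
  let Γ' : Subgroup Γ₀ := Γ.subgroupOf Γ₀
  have : Γ'.FiniteIndex := ⟨hfin⟩
  have := Fintype.ofFinite (Γ₀ ⧸ Γ')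
  rw [hF.measure_eq_tsum t, ← (Equiv.sigmaFiberEquiv (QuotientGroup.mk : Γ₀ → Γ₀ ⧸ Γ')).tsum_eq,
    ENNReal.tsum_sigma', tsum_fintype]
  have hle : ∀ q : Γ₀ ⧸ Γ', ∑' b : {γ : Γ₀ // (QuotientGroup.mk γ : Γ₀ ⧸ Γ') = q},
      μ (((Equiv.sigmaFiberEquiv (QuotientGroup.mk : Γ₀ → Γ₀ ⧸ Γ')) ⟨q, b⟩) • t ∩ F) ≤ μ F := by
    intro q
    rw [← measure_iUnion₀]
    · exact measure_mono (Set.iUnion_subset fun _ => Set.inter_subset_right)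
    · refine fun a b hab => Disjoint.aedisjoint ?_
      rw [Set.disjoint_left]
      rintro _ ⟨⟨x, hx, rfl⟩, -⟩ ⟨⟨y, hy, hxy⟩, -⟩
      apply hab
      have hmem : (b.1)⁻¹ * a.1 ∈ Γ' := QuotientGroup.eq.mp (b.2.trans a.2.symm)
      have h1 : (b.1 : G) * y = a.1 * x := hxy
      have h2 := hd (((b.1)⁻¹ * a.1 : Γ₀) : G) hmem x hx y hy (by
        simp only [Subgroup.coe_mul, Subgroup.coe_inv, mul_assoc]
        rw [← h1, inv_mul_cancel_left])
      have h3 : (b.1)⁻¹ * a.1 = 1 := Subtype.ext h2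
      exact Subtype.ext (inv_mul_eq_one.mp h3).symm
    · intro a
      exact ((ht.const_smul _).nullMeasurableSet).inter hF.nullMeasurableSet
  refine (Finset.sum_le_sum fun q _ => hle q).trans ?_
  rw [Finset.sum_const, nsmul_eq_mul, Finset.card_univ, ← Nat.card_eq_fintype_card]
  exact le_rfl

namespace LorentzModel

variable {n : ℕ} {S : IwasawaGroup n}

/-- A subgroup of finite index in a lattice has finitely many cusps, if its cuspidal stabilisers are
unipotent: disjoint translates of one open set, one for each cusp, fit into finite volume. -/
theorem finite_cusps (H : LorentzModel S) (hn : 1 ≤ n) {Γ₀ Γ : Subgroup S.G}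
    (hΓ₀ : IsLattice Γ₀) (hle : Γ ≤ Γ₀) (hfin : Γ.relIndex Γ₀ ≠ 0)
    (hpar : S.ParabolicCondition Γ) {R : Set (Subgroup S.G)} (hR : S.IsCuspReps Γ R) :
    R.Finite := by
  obtain ⟨hdisc, hex⟩ := hΓ₀
  have htg := H.isTopologicalGroup
  have hsc := H.secondCountableTopology
  let _ : MeasurableSpace S.G := borel S.G
  have : BorelSpace S.G := ⟨rfl⟩
  obtain ⟨μ, hμ, F, hF, hFfin⟩ := hex
  have : Countable Γ₀ := countable_of_Lindelof_of_discrete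
  have : DiscreteTopology Γ := DiscreteTopology.of_subset (s := (Γ₀ : Set S.G)) ‹_› hle
  obtain ⟨r, hr, W, hWo, hW1, hW⟩ := H.exists_scale
  have hWpos : 0 < μ W := hWo.measure_pos μ ⟨1, hW1⟩
  choose! g hgP hgN hgw hgm using fun P' (hP' : P' ∈ R) =>
    H.exists_scaled_frame hn hr (hR.1 P' hP')
  have huniq : ∀ P₁ ∈ R, ∀ P₂ ∈ R, ∀ γ ∈ Γ, conj γ P₁ = P₂ → P₁ = P₂ := by
    intro P₁ h₁ P₂ h₂ γ hγ h
    obtain ⟨P, -, hP⟩ := hR.2 P₁ (hR.1 P₁ h₁)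
    rw [hP P₁ ⟨h₁, 1, Γ.one_mem, conj_one P₁⟩, hP P₂ ⟨h₂, γ, hγ, h⟩]
  have hpack : ∀ P₁ ∈ R, ∀ P₂ ∈ R, ∀ γ ∈ Γ, ∀ x ∈ W, ∀ y ∈ W, γ * (g P₁ * x) = g P₂ * y →
      P₁ = P₂ ∧ γ = 1 := by
    intro P₁ h₁ P₂ h₂ γ hγ x hx y hy h
    obtain ⟨hc, h1⟩ := H.packing hr hW hpar (hR.1 P₁ h₁) (hgP P₁ h₁) (hgN P₁ h₁) (hgw P₁ h₁)
      (hgm P₁ h₁) (hgP P₂ h₂) (hgw P₂ h₂)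
      (fun γ hγ h => congrArg g (huniq P₁ h₁ P₂ h₂ γ hγ h)) hγ hx hy h
    exact ⟨huniq P₁ h₁ P₂ h₂ γ hγ hc, h1⟩
  have hcard : ∀ s : Finset (Subgroup S.G), (s : Set (Subgroup S.G)) ⊆ R →
      s.card * μ W ≤ Γ.relIndex Γ₀ * μ F := by
    intro s hs
    have hmeas : ∀ P' ∈ s, MeasurableSet (g P' • W) := fun P' _ => (hWo.smul (g P')).measurableSet
    have hsum : μ (⋃ P' ∈ s, g P' • W) = s.card * μ W := by
      rw [measure_biUnion_finset _ hmeas]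
      · simp only [measure_smul, Finset.sum_const, nsmul_eq_mul]
      · intro P₁ h₁ P₂ h₂ hne
        rw [Function.onFun, Set.disjoint_left]
        rintro _ ⟨x, hx, rfl⟩ ⟨y, hy, hxy⟩
        refine hne (hpack P₁ (hs h₁) P₂ (hs h₂) 1 Γ.one_mem x hx y hy ?_).1
        rw [one_mul]; exact hxy.symm
    rw [← hsum]
    refine measure_le_relIndex_mul hfin hF (Finset.measurableSet_biUnion s hmeas) ?_
    intro γ hγ a ha b hb hab
    simp only [Set.mem_iUnion] at ha hb
    obtain ⟨P₁, h₁, x, hx, rfl⟩ := ha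
    obtain ⟨P₂, h₂, y, hy, rfl⟩ := hb
    exact (hpack P₁ (hs h₁) P₂ (hs h₂) γ hγ x hx y hy hab).2
  by_contra hinf
  have htop : Γ.relIndex Γ₀ * μ F ≠ ⊤ := ENNReal.mul_ne_top (by simp) hFfin.ne
  obtain ⟨N, hN⟩ := ENNReal.exists_nat_mul_gt hWpos.ne' htop
  obtain ⟨s, hs, hsc⟩ := Set.Infinite.exists_subset_card_eq hinf N
  have := hcard s hs
  rw [hsc] at this
  exact absurd this (not_le.mpr hN)

end LorentzModel

/-! ### Counting the cusps of a normal subgroup -/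

/-- The element of `N_{P'}` with logarithm `w`. -/
noncomputable def IwasawaGroup.cuspUnip {n : ℕ} (S : IwasawaGroup n) (P' : Subgroup S.G) (w : E n) :
    S.G :=
  S.frame P' * S.u (Multiplicative.ofAdd w) * (S.frame P')⁻¹

theorem IwasawaGroup.mem_cuspLattice_iff {n : ℕ} (S : IwasawaGroup n) {Γ P' : Subgroup S.G}
    {w : E n} : w ∈ S.cuspLattice Γ P' ↔ S.cuspUnip P' w ∈ Γ := Iff.rfl

theorem IwasawaGroup.cuspUnip_add {n : ℕ} (S : IwasawaGroup n) (P' : Subgroup S.G) (v w : E n) :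
    S.cuspUnip P' (v + w) = S.cuspUnip P' v * S.cuspUnip P' w := by
  simp [IwasawaGroup.cuspUnip, ofAdd_add, mul_assoc]

theorem IwasawaGroup.cuspUnip_neg {n : ℕ} (S : IwasawaGroup n) (P' : Subgroup S.G) (v : E n) :
    S.cuspUnip P' (-v) = (S.cuspUnip P' v)⁻¹ := by
  simp [IwasawaGroup.cuspUnip, mul_assoc]

theorem IwasawaGroup.cuspUnip_nsmul {n : ℕ} (S : IwasawaGroup n) (P' : Subgroup S.G) (k : ℕ)
    (w : E n) : S.cuspUnip P' (k • w) = S.cuspUnip P' w ^ k := by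
  rw [IwasawaGroup.cuspUnip, IwasawaGroup.cuspUnip, ofAdd_nsmul, map_pow, conj_pow]

theorem IwasawaGroup.cuspLattice_mono {n : ℕ} (S : IwasawaGroup n) {Γ Γ₀ : Subgroup S.G}
    (h : Γ ≤ Γ₀) (P' : Subgroup S.G) : S.cuspLattice Γ P' ≤ S.cuspLattice Γ₀ P' :=
  fun _ hw => h hw

/-- The index `[Γ₀ ∩ N_{P'} : Γ ∩ N_{P'}]`. -/
noncomputable def IwasawaGroup.cuspIndex {n : ℕ} (S : IwasawaGroup n)
    (Γ Γ₀ P' : Subgroup S.G) : ℕ :=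
  (S.cuspLattice Γ P').toAddSubgroup.relIndex (S.cuspLattice Γ₀ P').toAddSubgroup

namespace LorentzModel

variable {n : ℕ} {S : IwasawaGroup n}

theorem cuspUnip_ne_one (H : LorentzModel S) (P' : Subgroup S.G) {w : E n} (hw : w ≠ 0) :
    S.cuspUnip P' w ≠ 1 := by
  intro h
  have h1 : S.u (Multiplicative.ofAdd w) = 1 := by
    have : S.u (Multiplicative.ofAdd w) = (S.frame P')⁻¹ * S.cuspUnip P' w * S.frame P' := by
      rw [IwasawaGroup.cuspUnip]; group
    rw [this, h]; group
  exact hw (H.u_injective (h1.trans S.u.map_one.symm))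

theorem conj_cuspUnip (H : LorentzModel S) (hn : 1 ≤ n) {P' : Subgroup S.G}
    (hP : S.IsParabolic P') (w : E n) : conj (S.cuspUnip P' w) P' = P' := by
  refine conj_eq_self ?_
  suffices h : S.cuspUnip P' w ∈ conj (S.frame P') S.P by rwa [H.conj_frame hn hP] at h
  rw [mem_conj, IwasawaGroup.cuspUnip]
  have : (S.frame P')⁻¹ * (S.frame P' * S.u (Multiplicative.ofAdd w) * (S.frame P')⁻¹) *
      S.frame P' = S.u (Multiplicative.ofAdd w) := by group
  rw [this]
  exact S.u_mem_P _

theorem discreteTopology_cuspLattice (H : LorentzModel S) (Γ P' : Subgroup S.G)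
    [DiscreteTopology Γ] : DiscreteTopology (S.cuspLattice Γ P') := by
  have := H.isTopologicalGroup
  have hc : Continuous fun w : S.cuspLattice Γ P' => (⟨S.cuspUnip P' w, w.2⟩ : Γ) := by
    refine Continuous.subtype_mk ?_ _
    exact (continuous_const.mul (H.isInducing_u.continuous.comp continuous_subtype_val)).mul
      continuous_const
  refine DiscreteTopology.of_continuous_injective hc fun v w h => ?_
  have h1 := congrArg Subtype.val h
  simp only [IwasawaGroup.cuspUnip, mul_left_inj, mul_right_inj] at h1
  exact Subtype.ext (H.u_injective h1)

/-- A subgroup of finite index has the same cuspidal parabolic subgroups. -/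
theorem isCuspidal_iff (H : LorentzModel S) {Γ Γ₀ : Subgroup S.G} [DiscreteTopology Γ₀]
    (hle : Γ ≤ Γ₀) (hfin : Γ.relIndex Γ₀ ≠ 0) (P' : Subgroup S.G) :
    S.IsCuspidal Γ P' ↔ S.IsCuspidal Γ₀ P' := by
  have : DiscreteTopology Γ := DiscreteTopology.of_subset (s := (Γ₀ : Set S.G)) ‹_› hle
  constructor
  · rintro ⟨hp, -, hs⟩
    refine ⟨hp, H.discreteTopology_cuspLattice Γ₀ P', ?_⟩
    rw [eq_top_iff, ← hs]
    exact Submodule.span_mono (S.cuspLattice_mono hle P')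
  · rintro ⟨hp, -, hs⟩
    refine ⟨hp, H.discreteTopology_cuspLattice Γ P', ?_⟩
    rw [eq_top_iff, ← hs, Submodule.span_le]
    intro w hw
    obtain ⟨k, hk, -, hmem⟩ := Subgroup.exists_pow_mem_of_relIndex_ne_zero hfin
      (a := S.cuspUnip P' w) hw
    have hk' : (k : ℝ) ≠ 0 := Nat.cast_ne_zero.mpr hk.ne'
    have h1 : k • w ∈ S.cuspLattice Γ P' := by
      rw [S.mem_cuspLattice_iff, S.cuspUnip_nsmul]; exact hmem.1
    have h2 : w = (k : ℝ)⁻¹ • (k • w) := by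
      rw [← Nat.cast_smul_eq_nsmul ℝ, smul_smul, inv_mul_cancel₀ hk', one_smul]
    rw [h2]
    exact Submodule.smul_mem _ _ (Submodule.subset_span h1)

theorem isZLattice_cuspLattice {Γ P' : Subgroup S.G} (h : S.IsCuspidal Γ P') :
    have := h.2.1
    IsZLattice ℝ (S.cuspLattice Γ P') :=
  have := h.2.1
  ⟨h.2.2⟩

/-- The covolume of a cusp lattice is multiplied by the index. -/
theorem covolume_cuspLattice {Γ Γ₀ P' : Subgroup S.G} (hle : Γ ≤ Γ₀) (h : S.IsCuspidal Γ P')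
    (h₀ : S.IsCuspidal Γ₀ P') : ZLattice.covolume (S.cuspLattice Γ P') =
      S.cuspIndex Γ Γ₀ P' * ZLattice.covolume (S.cuspLattice Γ₀ P') := by
  have := h.2.1
  have := h₀.2.1
  have := isZLattice_cuspLattice h
  have := isZLattice_cuspLattice h₀
  have hne := ZLattice.covolume_ne_zero (S.cuspLattice Γ₀ P') volume
  rw [IwasawaGroup.cuspIndex, ← ZLattice.covolume_div_covolume_eq_relIndex' _ _
    (S.cuspLattice_mono hle P')]
  field_simp

theorem cuspIndex_ne_zero {Γ Γ₀ P' : Subgroup S.G} (hle : Γ ≤ Γ₀) (h : S.IsCuspidal Γ P')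
    (h₀ : S.IsCuspidal Γ₀ P') : S.cuspIndex Γ Γ₀ P' ≠ 0 := by
  intro h0
  have := h.2.1
  have := isZLattice_cuspLattice h
  have h1 := covolume_cuspLattice hle h h₀
  rw [h0, Nat.cast_zero, zero_mul] at h1
  exact ZLattice.covolume_ne_zero (S.cuspLattice Γ P') volume h1

/-- Along a sequence of subgroups that contains each nontrivial element finitely often, the index in
each cusp tends to infinity. -/
theorem tendsto_cuspIndex (H : LorentzModel S) (hn : 1 ≤ n) {Γ₀ : Subgroup S.G}
    {Γ : ℕ → Subgroup S.G} (hle : ∀ i, Γ i ≤ Γ₀)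
    (hfew : ∀ γ ∈ Γ₀, γ ≠ 1 → {i | γ ∈ Γ i}.Finite) {P' : Subgroup S.G}
    (h : ∀ i, S.IsCuspidal (Γ i) P') (h₀ : S.IsCuspidal Γ₀ P') :
    Tendsto (fun i => S.cuspIndex (Γ i) Γ₀ P') atTop atTop := by
  have := h₀.2.1
  obtain ⟨w, hw, hw0, -⟩ := exists_min_norm hn _ h₀.2.2
  refine tendsto_atTop.mpr fun M => ?_
  rw [← Nat.cofinite_eq_atTop]
  -- If the index is less than `M`, it divides `M!`, so `Γ i` contains the fixed element `u(M! w)`.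
  have hw1 : M.factorial • w ≠ 0 := by
    rw [← Nat.cast_smul_eq_nsmul ℝ]
    exact smul_ne_zero (Nat.cast_ne_zero.mpr (Nat.factorial_ne_zero M)) hw0
  have hfin := hfew (S.cuspUnip P' (M.factorial • w))
    (show M.factorial • w ∈ S.cuspLattice Γ₀ P' from nsmul_mem hw _) (H.cuspUnip_ne_one P' hw1)
  refine hfin.subset fun i hi => ?_
  have hi' : S.cuspIndex (Γ i) Γ₀ P' < M := not_le.mp hi
  have hne := cuspIndex_ne_zero (hle i) (h i) h₀
  have hmem : S.cuspIndex (Γ i) Γ₀ P' • w ∈ S.cuspLattice (Γ i) P' := by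
    have := AddSubgroup.nsmul_index_mem ((S.cuspLattice (Γ i) P').toAddSubgroup.addSubgroupOf
      (S.cuspLattice Γ₀ P').toAddSubgroup) ⟨w, hw⟩
    exact this
  obtain ⟨k, hk⟩ := Nat.dvd_factorial (Nat.pos_of_ne_zero hne) hi'.le
  change M.factorial • w ∈ S.cuspLattice (Γ i) P'
  rw [hk, mul_comm _ k, mul_smul]
  exact nsmul_mem hmem k

end LorentzModel

theorem IwasawaGroup.toRep_mem {n : ℕ} (S : IwasawaGroup n) {Γ₀ : Subgroup S.G}
    {R₀ : Set (Subgroup S.G)} (hR₀ : S.IsCuspReps Γ₀ R₀) {P' : Subgroup S.G}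
    (h : S.IsCuspidal Γ₀ P') :
    S.toRep Γ₀ R₀ P' ∈ Γ₀ ∧ conj (S.toRep Γ₀ R₀ P') P' ∈ R₀ := by
  have hex : ∃ γ ∈ Γ₀, conj γ P' ∈ R₀ := by
    obtain ⟨P₀, ⟨hP₀, γ, hγ, h⟩, -⟩ := hR₀.2 P' h
    exact ⟨γ, hγ, h ▸ hP₀⟩
  rw [IwasawaGroup.toRep, dif_pos hex]
  exact hex.choose_spec

theorem IwasawaGroup.IsCuspReps.eq_of_conj {n : ℕ} {S : IwasawaGroup n} {Γ : Subgroup S.G}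
    {R : Set (Subgroup S.G)} (hR : S.IsCuspReps Γ R) {P₁ P₂ : Subgroup S.G} (h₁ : P₁ ∈ R)
    (h₂ : P₂ ∈ R) {γ : S.G} (hγ : γ ∈ Γ) (h : conj γ P₁ = P₂) : P₁ = P₂ := by
  obtain ⟨P, -, hP⟩ := hR.2 P₁ (hR.1 P₁ h₁)
  rw [hP P₁ ⟨h₁, 1, Γ.one_mem, conj_one P₁⟩, hP P₂ ⟨h₂, γ, hγ, h⟩]

theorem IwasawaGroup.conj_toRep_of_mem {n : ℕ} (S : IwasawaGroup n) {Γ₀ : Subgroup S.G}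
    {R₀ : Set (Subgroup S.G)} (hR₀ : S.IsCuspReps Γ₀ R₀) {P₀ : Subgroup S.G} (h : P₀ ∈ R₀) :
    conj (S.toRep Γ₀ R₀ P₀) P₀ = P₀ := by
  obtain ⟨h1, h2⟩ := S.toRep_mem hR₀ (hR₀.1 P₀ h)
  exact (hR₀.eq_of_conj h h2 h1 rfl).symm

theorem conj_eq_of_normal {G : Type} [Group G] {Γ Γ₀ : Subgroup G} (hle : Γ ≤ Γ₀)
    (hnormal : (Γ.subgroupOf Γ₀).Normal) {γ : G} (hγ : γ ∈ Γ₀) : conj γ Γ = Γ := by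
  have key : ∀ γ ∈ Γ₀, ∀ x ∈ Γ, γ⁻¹ * x * γ ∈ Γ := fun γ hγ x hx => by
    have := hnormal.conj_mem ⟨x, hle hx⟩ hx (⟨γ, hγ⟩⁻¹)
    simpa [Subgroup.mem_subgroupOf] using this
  ext x
  rw [mem_conj]
  refine ⟨fun h => ?_, fun h => key γ hγ x h⟩
  have := key γ⁻¹ (Γ₀.inv_mem hγ) _ h
  simpa [mul_assoc] using this

/-- For a normal subgroup the lattice of a cusp, transported to the representative of its class, is
the lattice of the subgroup at the representative. -/
theorem IwasawaGroup.tildeLattice_eq {n : ℕ} (S : IwasawaGroup n) {Γ Γ₀ : Subgroup S.G}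
    {R₀ : Set (Subgroup S.G)} (hR₀ : S.IsCuspReps Γ₀ R₀) (hle : Γ ≤ Γ₀)
    (hnormal : (Γ.subgroupOf Γ₀).Normal) {P' : Subgroup S.G} (h : S.IsCuspidal Γ₀ P') :
    S.tildeLattice Γ₀ R₀ Γ P' = S.cuspLattice Γ (conj (S.toRep Γ₀ R₀ P') P') := by
  rw [IwasawaGroup.tildeLattice, conj_eq_of_normal hle hnormal (S.toRep_mem hR₀ h).1]

namespace LorentzModel

variable {n : ℕ} {S : IwasawaGroup n}

/-- The cusps of the normal subgroup `Γ` over a cusp `P₀` of `Γ₀`, together with the cosets of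
`Γ ∩ N_{P₀}` in `Γ₀ ∩ N_{P₀}`, inject into the cosets of `Γ` in `Γ₀`. -/
theorem card_mul_cuspIndex_le (H : LorentzModel S) (hn : 1 ≤ n) {Γ Γ₀ : Subgroup S.G}
    {R₀ R : Set (Subgroup S.G)} (hR₀ : S.IsCuspReps Γ₀ R₀) (hR : S.IsCuspReps Γ R) (hle : Γ ≤ Γ₀)
    (hnormal : (Γ.subgroupOf Γ₀).Normal) (hfin : Γ.relIndex Γ₀ ≠ 0)
    (hcusp : ∀ P' ∈ R, S.IsCuspidal Γ₀ P') {P₀ : Subgroup S.G} (hP₀ : P₀ ∈ R₀)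
    (s : Finset (Subgroup S.G))
    (hs : ∀ P' ∈ s, P' ∈ R ∧ conj (S.toRep Γ₀ R₀ P') P' = P₀) :
    s.card * S.cuspIndex Γ Γ₀ P₀ ≤ Γ.relIndex Γ₀ := by
  set Λ := (S.cuspLattice Γ P₀).toAddSubgroup with hΛ
  set Λ₀ := (S.cuspLattice Γ₀ P₀).toAddSubgroup with hΛ₀
  have : (Γ.subgroupOf Γ₀).FiniteIndex := ⟨hfin⟩
  have hγ : ∀ P' : s, S.toRep Γ₀ R₀ P'.1 ∈ Γ₀ := fun P' =>
    (S.toRep_mem hR₀ (hcusp P' (hs P' P'.2).1)).1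
  let f : s × (Λ₀ ⧸ Λ.addSubgroupOf Λ₀) → Γ₀ ⧸ Γ.subgroupOf Γ₀ := fun p =>
    QuotientGroup.mk ((⟨S.cuspUnip P₀ p.2.out.1, p.2.out.2⟩ : Γ₀) * ⟨S.toRep Γ₀ R₀ p.1.1, hγ p.1⟩)
  have hf : Function.Injective f := by
    rintro ⟨P₁, q₁⟩ ⟨P₂, q₂⟩ h
    have h' := QuotientGroup.eq.mp h
    rw [Subgroup.mem_subgroupOf] at h'
    simp only [Subgroup.coe_mul, Subgroup.coe_inv, mul_inv_rev] at h'
    set γ₁ := S.toRep Γ₀ R₀ P₁.1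
    set γ₂ := S.toRep Γ₀ R₀ P₂.1
    set w : E n := -q₁.out.1 + q₂.out.1 with hw
    have h3 : γ₁⁻¹ * S.cuspUnip P₀ w * γ₂ ∈ Γ := by
      rw [hw, S.cuspUnip_add, S.cuspUnip_neg]
      simpa only [mul_assoc] using h'
    have hP : P₂ = P₁ := by
      refine Subtype.ext (hR.eq_of_conj (hs P₂ P₂.2).1 (hs P₁ P₁.2).1 h3 ?_)
      rw [conj_mul, (hs P₂ P₂.2).2, conj_mul, H.conj_cuspUnip hn (hR₀.1 P₀ hP₀).1,
        ← (hs P₁ P₁.2).2, ← conj_mul, inv_mul_cancel, conj_one]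
    have hγ₂ : γ₂ = γ₁ := by simp only [γ₁, γ₂, hP]
    have h4 : S.cuspUnip P₀ w ∈ Γ := by
      rw [hγ₂] at h3
      rw [← conj_eq_of_normal hle hnormal (hγ P₁), mem_conj]
      exact h3
    have hq : q₁ = q₂ := by
      rw [← QuotientAddGroup.out_eq' q₁, ← QuotientAddGroup.out_eq' q₂, QuotientAddGroup.eq,
        AddSubgroup.mem_addSubgroupOf]
      exact h4
    rw [hP, hq]
  have hcard := Nat.card_le_card_of_injective f hf
  rw [Nat.card_prod, Nat.card_eq_fintype_card, Fintype.card_coe] at hcard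
  exact hcard

/-- A sum over the cusps of the normal subgroup `Γ` of a function of the underlying cusp of `Γ₀`,
divided by the index of `Γ`. -/
theorem sum_div_relIndex_le (H : LorentzModel S) (hn : 1 ≤ n) {Γ Γ₀ : Subgroup S.G}
    [DiscreteTopology Γ₀] {R₀ R : Set (Subgroup S.G)} (hR₀ : S.IsCuspReps Γ₀ R₀)
    (hR : S.IsCuspReps Γ R) (hle : Γ ≤ Γ₀) (hnormal : (Γ.subgroupOf Γ₀).Normal)
    (hfin : Γ.relIndex Γ₀ ≠ 0) (hR₀f : R₀.Finite) (hRf : R.Finite) (a : Subgroup S.G → ℝ)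
    (ha : ∀ P₀, 0 ≤ a P₀) :
    (∑ P' ∈ hRf.toFinset, a (conj (S.toRep Γ₀ R₀ P') P')) / Γ.relIndex Γ₀ ≤
      ∑ P₀ ∈ hR₀f.toFinset, a P₀ / S.cuspIndex Γ Γ₀ P₀ := by
  classical
  have hcusp : ∀ P' ∈ R, S.IsCuspidal Γ₀ P' := fun P' hP' =>
    (H.isCuspidal_iff hle hfin P').mp (hR.1 P' hP')
  have hmaps : ∀ P' ∈ hRf.toFinset, conj (S.toRep Γ₀ R₀ P') P' ∈ hR₀f.toFinset := fun P' hP' =>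
    hR₀f.mem_toFinset.mpr (S.toRep_mem hR₀ (hcusp P' (hRf.mem_toFinset.mp hP'))).2
  rw [← Finset.sum_fiberwise_of_maps_to hmaps, Finset.sum_div]
  refine Finset.sum_le_sum fun P₀ hP₀ => ?_
  have hP₀' := hR₀f.mem_toFinset.mp hP₀
  have hle' := H.card_mul_cuspIndex_le hn hR₀ hR hle hnormal hfin hcusp hP₀'
    (hRf.toFinset.filter fun P' => conj (S.toRep Γ₀ R₀ P') P' = P₀) fun P' hP' => by
      rw [Finset.mem_filter, hRf.mem_toFinset] at hP'; exact hP'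
  rw [Finset.sum_congr rfl fun P' hP' => by rw [(Finset.mem_filter.mp hP').2], Finset.sum_const,
    nsmul_eq_mul]
  have hc₀ := hR₀.1 P₀ hP₀'
  have hi : (0 : ℝ) < S.cuspIndex Γ Γ₀ P₀ := Nat.cast_pos.mpr (Nat.pos_of_ne_zero
    (cuspIndex_ne_zero hle ((H.isCuspidal_iff hle hfin P₀).mpr hc₀) hc₀))
  have hr : (0 : ℝ) < Γ.relIndex Γ₀ := Nat.cast_pos.mpr (Nat.pos_of_ne_zero hfin)
  rw [div_le_div_iff₀ hr hi]
  have hle'' : ((hRf.toFinset.filter fun P' => conj (S.toRep Γ₀ R₀ P') P' = P₀).card : ℝ) *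
      S.cuspIndex Γ Γ₀ P₀ ≤ Γ.relIndex Γ₀ := by exact_mod_cast hle'
  nlinarith [ha P₀]

/-- A lattice has finitely many cusps if a subgroup of finite index does. -/
theorem finite_reps (H : LorentzModel S) {Γ Γ₀ : Subgroup S.G} [DiscreteTopology Γ₀]
    {R₀ R : Set (Subgroup S.G)} (hR₀ : S.IsCuspReps Γ₀ R₀) (hR : S.IsCuspReps Γ R) (hle : Γ ≤ Γ₀)
    (hfin : Γ.relIndex Γ₀ ≠ 0) (hRf : R.Finite) : R₀.Finite := by
  have hex : ∀ P₀ ∈ R₀, ∃ P ∈ R, ∃ γ ∈ Γ₀, conj γ P₀ = P := fun P₀ hP₀ => by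
    obtain ⟨P, ⟨hP, γ, hγ, h⟩, -⟩ :=
      hR.2 P₀ ((H.isCuspidal_iff hle hfin P₀).mpr (hR₀.1 P₀ hP₀))
    exact ⟨P, hP, γ, hle hγ, h⟩
  choose! f hf γ hγ hfγ using hex
  refine Set.Finite.of_finite_image (f := f) (hRf.subset (Set.image_subset_iff.mpr hf)) ?_
  intro P₁ h₁ P₂ h₂ h
  refine hR₀.eq_of_conj h₁ h₂ (Γ₀.mul_mem (Γ₀.inv_mem (hγ P₂ h₂)) (hγ P₁ h₁)) ?_
  rw [conj_mul, hfγ P₁ h₁, h, ← hfγ P₂ h₂, ← conj_mul, inv_mul_cancel, conj_one]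

end LorentzModel

/-! ### Poisson summation in several variables -/

section Poisson

variable {ι : Type*}

/-- An integral vector as a real vector. -/
def intVec (z : ι → ℤ) : ι → ℝ := fun i => (z i : ℝ)

theorem intVec_add (z w : ι → ℤ) : intVec (z + w) = intVec z + intVec w := by
  funext i; simp [intVec]

theorem intVec_zero : intVec (0 : ι → ℤ) = 0 := by
  funext i; simp [intVec]

theorem intVec_injective : Function.Injective (intVec : (ι → ℤ) → ι → ℝ) := fun z w h => by
  funext i
  exact Int.cast_injective (congrFun h i)

variable [Fintype ι]

theorem intVec_mem_span (z : ι → ℤ) :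
    intVec z ∈ Submodule.span ℤ (Set.range (Pi.basisFun ℝ ι)) := by
  rw [Module.Basis.mem_span_iff_repr_mem]
  exact fun i => ⟨z i, by simp [intVec]⟩

/-- The integral vectors as the `ℤ`-span of the standard basis. -/
noncomputable def intVecEquiv (ι : Type*) [Fintype ι] :
    (ι → ℤ) ≃ Submodule.span ℤ (Set.range (Pi.basisFun ℝ ι)) :=
  Equiv.ofBijective (fun z => ⟨intVec z, intVec_mem_span z⟩)
    ⟨fun z w h => intVec_injective (congrArg Subtype.val h), fun ⟨x, hx⟩ => by
      rw [Module.Basis.mem_span_iff_repr_mem] at hx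
      choose z hz using hx
      exact ⟨z, Subtype.ext (funext fun i => by simpa [intVec] using hz i)⟩⟩

/-- The character `x ↦ exp (-2 π i ⟨w, x⟩)`. -/
noncomputable def negChar (w : ι → ℤ) (x : ι → ℝ) : ℂ :=
  Complex.exp (((-2 * Real.pi * ∑ i, w i * x i : ℝ) : ℂ) * Complex.I)

theorem norm_negChar (w : ι → ℤ) (x : ι → ℝ) : ‖negChar w x‖ = 1 :=
  Complex.norm_exp_ofReal_mul_I _

theorem continuous_negChar (w : ι → ℤ) : Continuous (negChar w) := by
  unfold negChar; fun_prop

theorem mFourier_neg_apply (w : ι → ℤ) (x : ι → ℝ) :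
    UnitAddTorus.mFourier (-w) (fun i => (x i : UnitAddCircle)) = negChar w x := by
  simp only [UnitAddTorus.mFourier, ContinuousMap.coe_mk, Pi.neg_apply, fourier_coe_apply,
    negChar]
  rw [← Complex.exp_sum]
  congr 1
  push_cast
  rw [Finset.mul_sum, Finset.sum_mul]
  exact Finset.sum_congr rfl fun i _ => by ring

theorem negChar_intVec_add (w z : ι → ℤ) (x : ι → ℝ) :
    negChar w (intVec z + x) = negChar w x := by
  rw [← mFourier_neg_apply, ← mFourier_neg_apply]
  congr 1
  funext i
  have : ((z i : ℝ) : UnitAddCircle) = 0 := by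
    rw [AddCircle.coe_eq_zero_iff]; exact ⟨z i, by simp⟩
  simp [intVec, this]

/-- **Poisson summation** over `ℤ^ι`, for a continuous function whose translates are locally
uniformly summable. -/
theorem tsum_intVec_eq_tsum_fourier {f : (ι → ℝ) → ℂ} (hc : Continuous f) (hi : Integrable f)
    (hb : ∀ R : ℝ, ∃ u : (ι → ℤ) → ℝ, Summable u ∧
      ∀ x, ‖x‖ ≤ R → ∀ z, ‖f (intVec z + x)‖ ≤ u z)
    (hs : Summable fun w : ι → ℤ => ∫ x, negChar w x * f x) :
    ∑' z : ι → ℤ, f (intVec z) = ∑' w : ι → ℤ, ∫ x, negChar w x * f x := by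
  -- The periodisation `F` of `f` descends to a continuous function `Φ` on the torus; its Fourier
  -- coefficients are the values of the Fourier transform of `f`, and its Fourier series at `0` is
  -- the assertion.
  set F : (ι → ℝ) → ℂ := fun x => ∑' z : ι → ℤ, f (intVec z + x) with hF
  have hcont : Continuous F := by
    rw [continuous_iff_continuousAt]
    intro x₀
    obtain ⟨u, hu, hle⟩ := hb (‖x₀‖ + 1)
    have hon : ContinuousOn F (Metric.closedBall 0 (‖x₀‖ + 1)) := by
      refine continuousOn_tsum (fun z => (hc.comp (by fun_prop)).continuousOn) hu ?_
      intro z x hx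
      exact hle x (by simpa using hx) z
    refine hon.continuousAt (Filter.mem_of_superset (Metric.ball_mem_nhds x₀ one_pos) ?_)
    intro x hx
    rw [mem_closedBall_zero_iff]
    have := norm_sub_norm_le x x₀
    rw [Metric.mem_ball, dist_eq_norm] at hx
    linarith
  have hper : ∀ (k : ι → ℤ) x, F (intVec k + x) = F x := by
    intro k x
    rw [hF]
    simp only
    rw [← (Equiv.addRight k).tsum_eq (fun z => f (intVec z + x))]
    refine tsum_congr fun z => ?_
    rw [Equiv.coe_addRight, intVec_add, add_assoc]
  let q : C(ι → ℝ, UnitAddTorus ι) := ⟨fun x i => (x i : UnitAddCircle), by fun_prop⟩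
  have hq : IsQuotientMap q := (IsOpenQuotientMap.piMap
    (f := fun (_ : ι) (x : ℝ) => (x : UnitAddCircle))
    fun _ => QuotientAddGroup.isOpenQuotientMap_mk).isQuotientMap
  have hfac : Function.FactorsThrough (⟨F, hcont⟩ : C(ι → ℝ, ℂ)) q := by
    intro x y hxy
    have h1 : ∀ i, ∃ k : ℤ, (k : ℝ) = x i - y i := fun i => by
      have h2 : ((x i - y i : ℝ) : UnitAddCircle) = 0 := by
        rw [AddCircle.coe_sub, sub_eq_zero]; exact congrFun hxy i
      obtain ⟨k, hk⟩ := (AddCircle.coe_eq_zero_iff (1 : ℝ)).mp h2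
      exact ⟨k, by simpa using hk⟩
    choose k hk using h1
    have : x = intVec k + y := by funext i; simp [intVec, hk]
    change F x = F y
    rw [this, hper]
  let Φ : C(UnitAddTorus ι, ℂ) := hq.lift ⟨F, hcont⟩ hfac
  have hΦ : ∀ x : ι → ℝ, Φ (fun i => (x i : UnitAddCircle)) = F x := fun x =>
    congrArg (fun G : C(ι → ℝ, ℂ) => G x) (hq.lift_comp ⟨F, hcont⟩ hfac)
  have hcoeff : ∀ w, UnitAddTorus.mFourierCoeff Φ w = ∫ x, negChar w x * f x := by
    intro w
    have hint : Integrable fun x => negChar w x * f x := by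
      refine (integrable_norm_iff ((continuous_negChar w).mul hc).aestronglyMeasurable).mp ?_
      simpa only [Pi.mul_apply, norm_mul, norm_negChar, one_mul] using hi.norm
    let e : (ι → ℤ) ≃ (Submodule.span ℤ (Set.range (Pi.basisFun ℝ ι))).toAddSubgroup :=
      intVecEquiv ι
    have : Countable (Submodule.span ℤ (Set.range (Pi.basisFun ℝ ι))).toAddSubgroup :=
      e.symm.injective.countable
    rw [UnitAddTorus.mFourierCoeff_eq_integral _ _ (fun _ => 0),
      (ZSpan.isAddFundamentalDomain' (Pi.basisFun ℝ ι) volume).integral_eq_tsum'' _ hint,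
      ← e.tsum_eq]
    have hset : {x : ι → ℝ | ∀ i, x i ∈ Set.Ioc (0 : ℝ) (0 + 1)} =ᵐ[volume]
        ZSpan.fundamentalDomain (Pi.basisFun ℝ ι) := by
      rw [ZSpan.fundamentalDomain_pi_basisFun]
      have h1 : {x : ι → ℝ | ∀ i, x i ∈ Set.Ioc (0 : ℝ) (0 + 1)} =
          Set.univ.pi fun _ => Set.Ioc 0 1 := by
        ext x; simp [Set.mem_pi]
      rw [h1]
      exact Measure.univ_pi_Ioc_ae_eq_Icc.trans Measure.univ_pi_Ico_ae_eq_Icc.symm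
    rw [setIntegral_congr_set hset]
    set D := ZSpan.fundamentalDomain (Pi.basisFun ℝ ι) with hD
    obtain ⟨u, hu, hle⟩ := hb 1
    have hDfin : volume D ≠ ⊤ := by
      rw [hD, ZSpan.fundamentalDomain_pi_basisFun, Real.volume_pi_Ico]
      simp
    have hDn : ∀ x ∈ D, ‖x‖ ≤ 1 := by
      intro x hx
      rw [hD, ZSpan.fundamentalDomain_pi_basisFun] at hx
      refine (pi_norm_le_iff_of_nonneg zero_le_one).mpr fun i => ?_
      have := hx i trivial
      rw [Real.norm_eq_abs, abs_le]
      exact ⟨by linarith [this.1], this.2.le⟩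
    have hDm : MeasurableSet D := ZSpan.fundamentalDomain_measurableSet _
    have : IsFiniteMeasure (volume.restrict D) := ⟨by simpa using hDfin.lt_top⟩
    have hbound : ∀ z : ι → ℤ, ∀ᵐ x ∂volume.restrict D, ‖negChar w x * f (intVec z + x)‖ ≤ u z :=
      fun z => (ae_restrict_iff' hDm).mpr (Filter.Eventually.of_forall fun x hx => by
        rw [norm_mul, norm_negChar, one_mul]; exact hle x (hDn x hx) z)
    have hmeas : ∀ z : ι → ℤ, Continuous fun x => negChar w x * f (intVec z + x) := fun z =>
      (continuous_negChar w).mul (hc.comp (by fun_prop))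
    have hint' : ∀ z : ι → ℤ, Integrable (fun x => negChar w x * f (intVec z + x))
        (volume.restrict D) := fun z =>
      Integrable.of_bound (hmeas z).aestronglyMeasurable (u z) (hbound z)
    have hsum : Summable fun z : ι → ℤ => ∫ x in D, ‖negChar w x * f (intVec z + x)‖ := by
      refine Summable.of_nonneg_of_le (fun z => integral_nonneg fun x => norm_nonneg _)
        (fun z => ?_) (hu.mul_right (volume.real D))
      refine (integral_mono_ae (hint' z).norm (integrable_const (u z)) (hbound z)).trans ?_
      rw [integral_const, smul_eq_mul, mul_comm, measureReal_restrict_apply_univ]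
    have key := (hasSum_integral_of_summable_integral_norm hint' hsum).tsum_eq
    calc ∫ x in D, UnitAddTorus.mFourier (-w) (fun i => (x i : UnitAddCircle)) •
          Φ (fun i => (x i : UnitAddCircle))
        = ∫ x in D, ∑' z : ι → ℤ, negChar w x * f (intVec z + x) := by
          refine integral_congr_ae (Filter.Eventually.of_forall fun x => ?_)
          simp only [mFourier_neg_apply, hΦ, smul_eq_mul, hF, tsum_mul_left]
      _ = ∑' z : ι → ℤ, ∫ x in D, negChar w x * f (intVec z + x) := key.symm
      _ = _ := by
          refine tsum_congr fun z => ?_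
          refine integral_congr_ae (Filter.Eventually.of_forall fun x => ?_)
          change _ = negChar w (intVec z + x) * f (intVec z + x)
          rw [negChar_intVec_add]
  have hsum : Summable (UnitAddTorus.mFourierCoeff Φ) := by
    rw [funext hcoeff]; exact hs
  have h0 := UnitAddTorus.hasSum_mFourier_series_apply_of_summable hsum
    (fun i => ((0 : ℝ) : UnitAddCircle))
  have h1 : ∀ w : ι → ℤ, UnitAddTorus.mFourier w (fun _ => ((0 : ℝ) : UnitAddCircle)) = 1 := by
    intro w
    have := mFourier_neg_apply (-w) (0 : ι → ℝ)
    rw [neg_neg] at this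
    simpa [negChar] using this
  simp only [h1, smul_eq_mul, mul_one, hcoeff] at h0
  rw [h0.tsum_eq, hΦ (fun _ => 0)]
  change _ = ∑' z : ι → ℤ, f (intVec z + 0)
  simp only [add_zero]

end Poisson

/-! ### Theta functions of lattices -/

section Theta

variable {ι : Type*} [Fintype ι]

theorem summable_norm_intVec_rpow {r : ℝ} (hr : r < -Fintype.card ι) :
    Summable fun z : ι → ℤ => ‖intVec z‖ ^ r := by
  have h := ZLattice.summable_norm_rpow (Submodule.span ℤ (Set.range (Pi.basisFun ℝ ι))) r
    (by rw [ZLattice.rank ℝ, Module.finrank_fintype_fun_eq_card]; exact hr)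
  exact (intVecEquiv ι).summable_iff.mpr h

theorem one_le_norm_intVec {z : ι → ℤ} (hz : z ≠ 0) : 1 ≤ ‖intVec z‖ := by
  obtain ⟨i, hi⟩ := Function.ne_iff.mp hz
  have h1 : (1 : ℝ) ≤ |(z i : ℝ)| := by exact_mod_cast Int.one_le_abs hi
  exact h1.trans (norm_le_pi_norm (intVec z) i)

theorem summable_exp_neg_norm_intVec_sq {a : ℝ} (ha : 0 < a) :
    Summable fun z : ι → ℤ => Real.exp (-a * ‖intVec z‖ ^ 2) := by
  set m := Fintype.card ι
  have h := (summable_norm_intVec_rpow (ι := ι) (r := -(2 * (m + 1) : ℝ))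
    (by have : (0 : ℝ) ≤ Fintype.card ι := Nat.cast_nonneg _
        simp only [m]; linarith)).mul_left ((m + 1).factorial / a ^ (m + 1) : ℝ)
  classical
  refine (h.add (hasSum_ite_eq (0 : ι → ℤ) (1 : ℝ)).summable).of_nonneg_of_le
    (fun z => (Real.exp_pos _).le) fun z => ?_
  by_cases hz : z = 0
  · subst hz
    have : (0 : ℝ) ≤ (m + 1).factorial / a ^ (m + 1) *
        ‖intVec (0 : ι → ℤ)‖ ^ (-(2 * (m + 1) : ℝ)) := by positivity
    simpa [intVec_zero] using this
  · have hp : 0 < ‖intVec z‖ := one_pos.trans_le (one_le_norm_intVec hz)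
    have h1 := Real.pow_div_factorial_le_exp (a * ‖intVec z‖ ^ 2) (by positivity) (m + 1)
    rw [if_neg hz, add_zero, neg_mul, Real.exp_neg, Real.rpow_neg hp.le,
      show (2 * (m + 1) : ℝ) = ((2 * (m + 1) : ℕ) : ℝ) by push_cast; ring, Real.rpow_natCast]
    have h2 : (0 : ℝ) < (a * ‖intVec z‖ ^ 2) ^ (m + 1) / (m + 1).factorial := by positivity
    refine (inv_anti₀ h2 h1).trans (le_of_eq ?_)
    rw [mul_pow, ← pow_mul]
    field_simp

/-- The Euclidean norm of `g x`. -/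
noncomputable def matNorm (g : Matrix ι ι ℝ) (x : ι → ℝ) : ℝ := ‖WithLp.toLp 2 (g.mulVec x)‖

theorem continuous_matNorm (g : Matrix ι ι ℝ) : Continuous (matNorm g) := by
  unfold matNorm; fun_prop

/-- The theta function `∑_z exp (-π t ‖g z‖²)` of the lattice `g ℤ^ι`. -/
noncomputable def theta (g : Matrix ι ι ℝ) (t : ℝ) : ℝ :=
  ∑' z : ι → ℤ, Real.exp (-Real.pi * matNorm g (intVec z) ^ 2 * t)

/-- A lower bound for the dilation by `g`, from the supremum norm to the Euclidean norm. -/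
def IsLower (c : ℝ) (g : Matrix ι ι ℝ) : Prop := ∀ x : ι → ℝ, c * ‖x‖ ≤ matNorm g x

theorem exp_matNorm_le {c : ℝ} (hc : 0 < c) {g : Matrix ι ι ℝ} (hg : IsLower c g) {t : ℝ}
    (ht : 0 ≤ t) (x : ι → ℝ) :
    Real.exp (-Real.pi * matNorm g x ^ 2 * t) ≤ Real.exp (-(Real.pi * t * c ^ 2) * ‖x‖ ^ 2) := by
  have h1 : (c * ‖x‖) ^ 2 ≤ matNorm g x ^ 2 := pow_le_pow_left₀ (by positivity) (hg x) 2
  have h2 := mul_le_mul_of_nonneg_left h1 (mul_nonneg Real.pi_pos.le ht)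
  rw [Real.exp_le_exp]
  nlinarith

theorem summable_theta {c : ℝ} (hc : 0 < c) {g : Matrix ι ι ℝ} (hg : IsLower c g) {t : ℝ}
    (ht : 0 < t) :
    Summable fun z : ι → ℤ => Real.exp (-Real.pi * matNorm g (intVec z) ^ 2 * t) :=
  (summable_exp_neg_norm_intVec_sq (a := Real.pi * t * c ^ 2)
    (by have := Real.pi_pos; positivity)).of_nonneg_of_le
    (fun z => (Real.exp_pos _).le) fun z => exp_matNorm_le hc hg ht.le _

section Matrix

variable [DecidableEq ι]

theorem measurePreserving_mulVec {g : Matrix ι ι ℝ} (hg : g.det = 1) :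
    MeasurePreserving (fun x : ι → ℝ => (WithLp.toLp 2 (g.mulVec x) : EuclideanSpace ℝ ι)) := by
  have h1 : MeasurePreserving (Matrix.toLin' g : (ι → ℝ) → ι → ℝ) :=
    ⟨(Matrix.toLin' g).continuous_of_finiteDimensional.measurable, by
      rw [Real.map_matrix_volume_pi_eq_smul_volume_pi (by rw [hg]; exact one_ne_zero), hg]
      simp⟩
  exact (PiLp.volume_preserving_toLp ι).comp h1

theorem measurableEmbedding_mulVec {g : Matrix ι ι ℝ} (hg : g.det = 1) :
    MeasurableEmbedding (fun x : ι → ℝ => (WithLp.toLp 2 (g.mulVec x) : EuclideanSpace ℝ ι)) := by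
  have hc : Continuous (fun x : ι → ℝ => (WithLp.toLp 2 (g.mulVec x) : EuclideanSpace ℝ ι)) := by
    fun_prop
  refine hc.measurableEmbedding fun x y h => ?_
  have h' : g.mulVec x = g.mulVec y := congrArg WithLp.ofLp h
  have hu : IsUnit g.det := by rw [hg]; exact isUnit_one
  have := congrArg (g⁻¹.mulVec) h'
  simpa [Matrix.mulVec_mulVec, Matrix.nonsing_inv_mul g hu] using this

theorem dotProduct_eq_inner {g : Matrix ι ι ℝ} (hg : g.det = 1) (w x : ι → ℝ) :
    w ⬝ᵥ x = inner ℝ (WithLp.toLp 2 (g.mulVec x) : EuclideanSpace ℝ ι)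
      (WithLp.toLp 2 (g⁻¹.transpose.mulVec w)) := by
  have hu : IsUnit g.det := by rw [hg]; exact isUnit_one
  rw [EuclideanSpace.inner_eq_star_dotProduct]
  simp only [star_trivial]
  rw [Matrix.mulVec_transpose, ← Matrix.dotProduct_mulVec, Matrix.mulVec_mulVec,
    Matrix.nonsing_inv_mul g hu, Matrix.one_mulVec]

/-- The Fourier transform of the Gaussian `x ↦ exp (-π t ‖g x‖²)`. -/
theorem integral_negChar_mul_gaussian {g : Matrix ι ι ℝ} (hg : g.det = 1) {t : ℝ} (ht : 0 < t)
    (w : ι → ℤ) :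
    ∫ x : ι → ℝ, negChar w x * ((Real.exp (-Real.pi * matNorm g x ^ 2 * t) : ℝ) : ℂ) =
      ((((1 / t) ^ ((Fintype.card ι : ℝ) / 2) *
        Real.exp (-Real.pi * matNorm g⁻¹.transpose (intVec w) ^ 2 * (1 / t)) : ℝ)) : ℂ) := by
  set W : EuclideanSpace ℝ ι := WithLp.toLp 2 (g⁻¹.transpose.mulVec (intVec w)) with hW
  set G : EuclideanSpace ℝ ι → ℂ := fun y =>
    Complex.exp (((-2 * Real.pi * inner ℝ y W : ℝ) : ℂ) * Complex.I) •
      Complex.exp (-((Real.pi * t : ℝ) : ℂ) * ((‖y‖ : ℝ) : ℂ) ^ 2) with hG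
  have h1 : ∀ x : ι → ℝ, negChar w x * ((Real.exp (-Real.pi * matNorm g x ^ 2 * t) : ℝ) : ℂ) =
      G (WithLp.toLp 2 (g.mulVec x)) := by
    intro x
    simp only [hG, smul_eq_mul]
    rw [hW, ← dotProduct_eq_inner hg, negChar, Complex.ofReal_exp]
    congr 2
    rw [matNorm]; push_cast; ring
  simp only [h1]
  rw [(measurePreserving_mulVec hg).integral_comp (measurableEmbedding_mulVec hg) G, hG,
    ← Real.fourier_eq' (fun y : EuclideanSpace ℝ ι =>
      Complex.exp (-((Real.pi * t : ℝ) : ℂ) * ((‖y‖ : ℝ) : ℂ) ^ 2)) W,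
    fourier_gaussian_innerProductSpace (by
      rw [Complex.ofReal_re]; exact mul_pos Real.pi_pos ht)]
  have hpi : (Real.pi : ℂ) ≠ 0 := Complex.ofReal_ne_zero.mpr Real.pi_ne_zero
  have htc : (t : ℂ) ≠ 0 := Complex.ofReal_ne_zero.mpr ht.ne'
  rw [finrank_euclideanSpace, Complex.ofReal_mul ((1 / t) ^ ((Fintype.card ι : ℝ) / 2)),
    Complex.ofReal_cpow (by positivity), Complex.ofReal_exp, matNorm]
  congr 1
  · congr 1
    · push_cast; field_simp
    · push_cast; rfl
  · congr 1
    push_cast; field_simp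
    rfl

/-- The functional equation of the theta function. -/
theorem theta_one_div {c : ℝ} (hc : 0 < c) {g : Matrix ι ι ℝ} (hdet : g.det = 1)
    (hg : IsLower c g) (hg' : IsLower c g⁻¹.transpose) {t : ℝ} (ht : 0 < t) :
    theta g (1 / t) = t ^ ((Fintype.card ι : ℝ) / 2) * theta g⁻¹.transpose t := by
  have ht' : 0 < 1 / t := by positivity
  have hpi := Real.pi_pos
  have hcont : Continuous fun x : ι → ℝ =>
      ((Real.exp (-Real.pi * matNorm g x ^ 2 * (1 / t)) : ℝ) : ℂ) := by
    have := continuous_matNorm g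
    fun_prop
  have key := tsum_intVec_eq_tsum_fourier hcont ?_ ?_ ?_
  · simp only [integral_negChar_mul_gaussian hdet ht', one_div_one_div] at key
    rw [theta, theta, ← tsum_mul_left]
    exact_mod_cast key
  · have h := (GaussianFourier.integrable_cexp_neg_mul_sq_norm_add (V := EuclideanSpace ℝ ι)
      (b := ((Real.pi * (1 / t) : ℝ) : ℂ)) (by rw [Complex.ofReal_re]; positivity) 0 0)
    rw [← (measurePreserving_mulVec hdet).integrable_comp_emb
      (measurableEmbedding_mulVec hdet)] at h
    refine h.congr (Filter.Eventually.of_forall fun x => ?_)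
    simp only [Function.comp_apply]
    rw [Complex.ofReal_exp]
    congr 1
    rw [matNorm]; push_cast; ring
  · intro R
    set a := Real.pi * (1 / t) * c ^ 2 with ha
    have ha0 : 0 < a := by positivity
    refine ⟨fun z => Real.exp (a * R ^ 2) * Real.exp (-(a / 2) * ‖intVec z‖ ^ 2),
      (summable_exp_neg_norm_intVec_sq (by positivity)).mul_left _, fun x hx z => ?_⟩
    rw [Complex.norm_real, Real.norm_of_nonneg (Real.exp_pos _).le]
    refine (exp_matNorm_le hc hg ht'.le _).trans ?_
    change _ ≤ Real.exp (a * R ^ 2) * Real.exp (-(a / 2) * ‖intVec z‖ ^ 2)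
    rw [← Real.exp_add, Real.exp_le_exp]
    have h1 : ‖intVec z‖ ≤ ‖intVec z + x‖ + R := by
      have := norm_sub_le (intVec z + x) x
      rw [add_sub_cancel_right] at this
      linarith
    have h2 : ‖intVec z‖ ^ 2 ≤ 2 * ‖intVec z + x‖ ^ 2 + 2 * R ^ 2 := by
      have := pow_le_pow_left₀ (norm_nonneg _) h1 2
      nlinarith [sq_nonneg (‖intVec z + x‖ - R)]
    nlinarith
  · simp only [integral_negChar_mul_gaussian hdet ht', one_div_one_div]
    exact Complex.ofRealCLM.summable ((summable_theta hc hg' ht).mul_left _)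

end Matrix

/-- The constant in the decay of the theta functions. -/
noncomputable def thetaConst (ι : Type*) [Fintype ι] (c : ℝ) : ℝ :=
  ∑' z : ι → ℤ, Real.exp (-(Real.pi * c ^ 2) * ‖intVec z‖ ^ 2)

theorem thetaConst_nonneg (c : ℝ) : 0 ≤ thetaConst ι c := tsum_nonneg fun _ => (Real.exp_pos _).le

theorem hasSum_theta_sub_one {c : ℝ} (hc : 0 < c) {g : Matrix ι ι ℝ} (hg : IsLower c g) {t : ℝ}
    (ht : 0 < t) : HasSum (fun z : ι → ℤ =>
      if z = 0 then 0 else Real.exp (-Real.pi * matNorm g (intVec z) ^ 2 * t)) (theta g t - 1) := by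
  classical
  refine ((summable_theta hc hg ht).hasSum.sub (hasSum_ite_eq (0 : ι → ℤ) (1 : ℝ))).congr_fun ?_
  intro z
  by_cases hz : z = 0
  · subst hz
    simp [intVec_zero, matNorm]
  · simp [hz]

/-- Decay of the theta function at infinity; the term at `0` is the constant `1`. -/
theorem abs_theta_sub_one_le {c : ℝ} (hc : 0 < c) {g : Matrix ι ι ℝ} (hg : IsLower c g) {t : ℝ}
    (ht : 1 ≤ t) :
    |theta g t - 1| ≤ thetaConst ι c * Real.exp (-(Real.pi * c ^ 2) * (t - 1)) := by
  have h := hasSum_theta_sub_one hc hg (one_pos.trans_le ht)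
  have hpi := Real.pi_pos
  have hsum : HasSum (fun z : ι → ℤ => Real.exp (-(Real.pi * c ^ 2) * ‖intVec z‖ ^ 2) *
      Real.exp (-(Real.pi * c ^ 2) * (t - 1)))
      (thetaConst ι c * Real.exp (-(Real.pi * c ^ 2) * (t - 1))) :=
    ((summable_exp_neg_norm_intVec_sq (by positivity)).hasSum).mul_right _
  have h0 : 0 ≤ theta g t - 1 := h.nonneg fun z => by split_ifs <;> positivity
  rw [abs_of_nonneg h0]
  refine hasSum_le (fun z => ?_) h hsum
  split_ifs with hz
  · positivity
  · refine (exp_matNorm_le hc hg (zero_le_one.trans ht) _).trans ?_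
    rw [← Real.exp_add, Real.exp_le_exp]
    have h1 : (1 : ℝ) ≤ ‖intVec z‖ ^ 2 := one_le_pow₀ (one_le_norm_intVec hz)
    have h2 : 0 ≤ Real.pi * c ^ 2 * (t - 1) * (‖intVec z‖ ^ 2 - 1) :=
      mul_nonneg (mul_nonneg (by positivity) (by linarith)) (by linarith)
    nlinarith

end Theta

/-! ### The Mellin transform of the theta function -/

section Mellin

variable {ι : Type*} [Fintype ι]

theorem continuousOn_theta {c : ℝ} (hc : 0 < c) {g : Matrix ι ι ℝ} (hg : IsLower c g) :
    ContinuousOn (theta g) (Set.Ioi 0) := by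
  intro t ht
  have ht' : (0 : ℝ) < t / 2 := half_pos ht
  have h : ContinuousOn (theta g) (Set.Ici (t / 2)) := by
    refine continuousOn_tsum
      (u := fun z => Real.exp (-Real.pi * matNorm g (intVec z) ^ 2 * (t / 2)))
      (fun z => by fun_prop) (summable_theta hc hg ht') fun z x hx => ?_
    rw [Real.norm_of_nonneg (Real.exp_pos _).le, Real.exp_le_exp, neg_mul, neg_mul, neg_mul,
      neg_le_neg_iff]
    exact mul_le_mul_of_nonneg_left hx (mul_nonneg Real.pi_pos.le (sq_nonneg _))
  exact (h.continuousAt (Ici_mem_nhds (half_lt_self ht))).continuousWithinAt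

theorem locallyIntegrableOn_theta {c : ℝ} (hc : 0 < c) {g : Matrix ι ι ℝ} (hg : IsLower c g) :
    LocallyIntegrableOn (fun t => (theta g t : ℂ)) (Set.Ioi 0) :=
  (Complex.continuous_ofReal.comp_continuousOn (continuousOn_theta hc hg)).locallyIntegrableOn
    measurableSet_Ioi

theorem isBigO_theta_sub_one {c : ℝ} (hc : 0 < c) {g : Matrix ι ι ℝ} (hg : IsLower c g) (r : ℝ) :
    (fun t => (theta g t : ℂ) - 1) =O[atTop] (fun t => t ^ r) := by
  have ha : 0 < Real.pi * c ^ 2 := by have := Real.pi_pos; positivity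
  refine Asymptotics.IsBigO.trans ?_ (isLittleO_exp_neg_mul_rpow_atTop ha r).isBigO
  refine Asymptotics.IsBigO.of_bound (thetaConst ι c * Real.exp (Real.pi * c ^ 2)) ?_
  filter_upwards [eventually_ge_atTop 1] with t ht
  have h := abs_theta_sub_one_le hc hg ht
  rw [← Complex.ofReal_one, ← Complex.ofReal_sub, Complex.norm_real, Real.norm_eq_abs,
    Real.norm_of_nonneg (Real.exp_pos _).le, mul_assoc, ← Real.exp_add]
  refine h.trans (le_of_eq ?_)
  congr 2; ring

/-- A majorant of the integrand of `Λ₀` at the weight, for the theta functions of all lattices with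
lower bound `c`. -/
noncomputable def majorant (ι : Type*) [Fintype ι] (c t : ℝ) : ℝ :=
  (Set.Ioi 1).indicator (fun t => thetaConst ι c *
    (t ^ ((Fintype.card ι : ℝ) / 2 - 1) * Real.exp (-(Real.pi * c ^ 2) * (t - 1)))) t +
  (Set.Ioo 0 1).indicator (fun _ => thetaConst ι c *
    (Real.exp (Real.pi * c ^ 2) / (Real.pi * c ^ 2))) t

theorem integrableOn_majorant {c : ℝ} (hc : 0 < c) [Nonempty ι] :
    IntegrableOn (majorant ι c) (Set.Ioi 0) := by
  have ha : 0 < Real.pi * c ^ 2 := by have := Real.pi_pos; positivity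
  have hk : (0 : ℝ) < (Fintype.card ι : ℝ) / 2 := by
    have : 0 < Fintype.card ι := Fintype.card_pos
    positivity
  refine Integrable.add ?_ ?_
  · refine Integrable.indicator ?_ measurableSet_Ioi
    refine Integrable.const_mul ?_ _
    have h := (integrableOn_rpow_mul_exp_neg_mul_rpow (s := (Fintype.card ι : ℝ) / 2 - 1)
      (p := 1) (by linarith) one_pos ha).mul_const (Real.exp (Real.pi * c ^ 2))
    refine Integrable.congr h (Eventually.of_forall fun t => ?_)
    simp only [Real.rpow_one]
    rw [mul_assoc, ← Real.exp_add]
    congr 2; ring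
  · rw [integrable_indicator_iff measurableSet_Ioo]
    refine integrableOn_const ?_
    rw [Measure.restrict_apply measurableSet_Ioo]
    exact ((measure_mono Set.inter_subset_left).trans_lt measure_Ioo_lt_top).ne

variable [DecidableEq ι]

/-- The theta functions of a unimodular lattice and of its dual lattice, related by the functional
equation `theta_one_div`. -/
noncomputable def thetaPair [Nonempty ι] {c : ℝ} (hc : 0 < c) {g : Matrix ι ι ℝ} (hdet : g.det = 1)
    (hg : IsLower c g) (hg' : IsLower c g⁻¹.transpose) : WeakFEPair ℂ where
  f t := theta g t
  g t := theta g⁻¹.transpose t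
  k := Fintype.card ι / 2
  ε := 1
  f₀ := 1
  g₀ := 1
  hf_int := locallyIntegrableOn_theta hc hg
  hg_int := locallyIntegrableOn_theta hc hg'
  hk := by have : 0 < Fintype.card ι := Fintype.card_pos
           positivity
  hε := one_ne_zero
  h_feq t ht := by
    rw [theta_one_div hc hdet hg hg' ht, one_mul, smul_eq_mul, Complex.ofReal_mul]
  hf_top := isBigO_theta_sub_one hc hg
  hg_top := isBigO_theta_sub_one hc hg'

/-- The values `Λ₀ (card ι / 2)` are bounded in terms of the lower bound `c` only. -/
theorem norm_thetaPair_Λ₀_le [Nonempty ι] {c : ℝ} (hc : 0 < c) {g : Matrix ι ι ℝ}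
    (hdet : g.det = 1) (hg : IsLower c g) (hg' : IsLower c g⁻¹.transpose) :
    ‖(thetaPair hc hdet hg hg').Λ₀ ((Fintype.card ι : ℂ) / 2)‖ ≤
      ∫ t in Set.Ioi 0, majorant ι c t := by
  have ha : 0 < Real.pi * c ^ 2 := by have := Real.pi_pos; positivity
  have hC := thetaConst_nonneg (ι := ι) c
  set k : ℝ := (Fintype.card ι : ℝ) / 2 with hk
  refine norm_integral_le_of_norm_le (integrableOn_majorant hc)
    ((ae_restrict_iff' measurableSet_Ioi).mpr (Eventually.of_forall fun t ht => ?_))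
  have ht0 : 0 < t := ht
  have hn : ‖(t : ℂ) ^ ((Fintype.card ι : ℂ) / 2 - 1)‖ = t ^ (k - 1) := by
    rw [Complex.norm_cpow_eq_rpow_re_of_pos ht0]
    congr 1
    rw [hk]; simp
  rw [norm_smul, hn, majorant, WeakFEPair.f_modif, Pi.add_apply]
  rcases lt_trichotomy t 1 with h1 | h1 | h1
  · have hmem : t ∈ Set.Ioo 0 1 := ⟨ht0, h1⟩
    have hnot : t ∉ Set.Ioi 1 := by simpa using h1.le
    rw [Set.indicator_of_notMem hnot, Set.indicator_of_mem hmem, Set.indicator_of_notMem hnot,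
      Set.indicator_of_mem hmem, zero_add, zero_add]
    -- On `(0, 1)` the functional equation turns the decay of the dual theta function at infinity
    -- into decay at `0`, and `exp (-a / t) ≤ t / a` absorbs the factor `1 / t`.
    have h2 : theta g t = t ^ (-k) * theta g⁻¹.transpose (1 / t) := by
      have := theta_one_div hc hdet hg hg' (one_div_pos.mpr ht0)
      rw [one_div_one_div] at this
      rw [this, one_div, Real.inv_rpow ht0.le, Real.rpow_neg ht0.le]
    have h3 := abs_theta_sub_one_le hc hg' ((one_le_div ht0).mpr h1.le)
    have h4 : ‖(thetaPair hc hdet hg hg').f t - ((thetaPair hc hdet hg hg').ε *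
        ((t ^ (-(thetaPair hc hdet hg hg').k) : ℝ) : ℂ)) • (thetaPair hc hdet hg hg').g₀‖ =
        t ^ (-k) * |theta g⁻¹.transpose (1 / t) - 1| := by
      change ‖((theta g t : ℝ) : ℂ) - (1 * ((t ^ (-k) : ℝ) : ℂ)) • (1 : ℂ)‖ = _
      rw [one_mul, smul_eq_mul, mul_one, ← Complex.ofReal_sub, Complex.norm_real, Real.norm_eq_abs,
        h2, ← mul_sub_one, abs_mul, abs_of_pos (Real.rpow_pos_of_pos ht0 _)]
    rw [h4, ← mul_assoc, ← Real.rpow_add ht0, show k - 1 + -k = -1 by ring, Real.rpow_neg_one]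
    refine (mul_le_mul_of_nonneg_left h3 (inv_pos.mpr ht0).le).trans ?_
    rw [mul_left_comm]
    refine mul_le_mul_of_nonneg_left ?_ hC
    rw [show -(Real.pi * c ^ 2) * (1 / t - 1) = Real.pi * c ^ 2 - Real.pi * c ^ 2 / t by ring,
      Real.exp_sub, ← div_eq_inv_mul, div_div]
    refine div_le_div_of_nonneg_left (Real.exp_pos _).le ha ?_
    have h5 := Real.add_one_le_exp (Real.pi * c ^ 2 / t)
    calc Real.pi * c ^ 2 = Real.pi * c ^ 2 / t * t := by field_simp
      _ ≤ Real.exp (Real.pi * c ^ 2 / t) * t :=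
        mul_le_mul_of_nonneg_right (by linarith) ht0.le
  · subst h1
    simp
  · have hmem : t ∈ Set.Ioi 1 := h1
    have hnot : t ∉ Set.Ioo 0 1 := fun h => h.2.not_gt h1
    rw [Set.indicator_of_mem hmem, Set.indicator_of_notMem hnot, Set.indicator_of_mem hmem,
      Set.indicator_of_notMem hnot, add_zero, add_zero]
    have h3 := abs_theta_sub_one_le hc hg h1.le
    have h4 : ‖(thetaPair hc hdet hg hg').f t - (thetaPair hc hdet hg hg').f₀‖ =
        |theta g t - 1| := by
      change ‖((theta g t : ℝ) : ℂ) - 1‖ = _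
      rw [← Complex.ofReal_one, ← Complex.ofReal_sub, Complex.norm_real, Real.norm_eq_abs]
    rw [h4, mul_left_comm]
    exact mul_le_mul_of_nonneg_left h3 (Real.rpow_nonneg ht0.le _)

/-- The Dirichlet series of a unimodular lattice in terms of the completed function `Λ`. -/
theorem hasSum_matNorm_cpow [Nonempty ι] {c : ℝ} (hc : 0 < c) {g : Matrix ι ι ℝ}
    (hdet : g.det = 1) (hg : IsLower c g) (hg' : IsLower c g⁻¹.transpose) {s : ℂ}
    (hs : (Fintype.card ι : ℝ) / 2 < s.re) :
    HasSum (fun z : ι → ℤ => (Real.pi : ℂ) ^ (-s) * Complex.Gamma s * 1 /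
      ((matNorm g (intVec z) ^ 2 : ℝ) : ℂ) ^ s) ((thetaPair hc hdet hg hg').Λ s) := by
  have hs0 : 0 < s.re := lt_of_le_of_lt (by positivity) hs
  have h := (thetaPair hc hdet hg hg').hasMellin (s := s) hs
  rw [← h.2]
  have hlow : ∀ z : ι → ℤ, z ≠ 0 → 0 < matNorm g (intVec z) := fun z hz =>
    (mul_pos hc (one_pos.trans_le (one_le_norm_intVec hz))).trans_le (hg _)
  refine hasSum_mellin_pi_mul₀ (fun z => sq_nonneg _) hs0 (fun t ht => ?_) ?_
  · have := Complex.hasSum_ofReal.mpr (hasSum_theta_sub_one hc hg ht)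
    change HasSum _ (((theta g t : ℝ) : ℂ) - 1)
    rw [Complex.ofReal_sub, Complex.ofReal_one] at this
    refine this.congr_fun fun z => ?_
    by_cases hz : z = 0
    · subst hz; simp [intVec_zero, matNorm]
    · rw [if_neg hz, if_neg (pow_pos (hlow z hz) 2).ne', one_mul]
  · have h1 := (summable_norm_intVec_rpow (ι := ι) (r := -(2 * s.re)) (by linarith)).mul_left
      (c ^ (-(2 * s.re)))
    refine h1.of_nonneg_of_le (fun z => by positivity) fun z => ?_
    by_cases hz : z = 0
    · subst hz
      have h0 : -(2 * s.re) ≠ 0 := by linarith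
      simp [intVec_zero, matNorm, Real.zero_rpow hs0.ne', Real.zero_rpow h0]
    · have hp : 0 < ‖intVec z‖ := one_pos.trans_le (one_le_norm_intVec hz)
      rw [norm_one, ← Real.mul_rpow hc.le hp.le, Real.rpow_neg (by positivity), one_div,
        ← Real.rpow_natCast, ← Real.rpow_mul (hlow z hz).le]
      refine inv_anti₀ (by positivity) ?_
      exact Real.rpow_le_rpow (by positivity) (hg _) (by positivity)

end Mellin

/-! ### The constant term of the Epstein zeta function -/

section Epstein

variable {n : ℕ}

/-- The Laurent expansion determines its constant term; the functions agree near `0` on the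
positive real axis, which suffices to compare residues and constant terms. -/
theorem IsEpsteinConst.unique {Λ : Submodule ℤ (E n)} {c c' : ℂ} (h : IsEpsteinConst Λ c)
    (h' : IsEpsteinConst Λ c') : c = c' := by
  obtain ⟨f, -, hf, r, hr⟩ := h
  obtain ⟨f', -, hf', r', hr'⟩ := h'
  have hl : Tendsto (fun t : ℝ => (t : ℂ)) (𝓝[>] 0) (𝓝[≠] 0) := by
    refine tendsto_nhdsWithin_iff.mpr ⟨?_, ?_⟩
    · exact (Complex.continuous_ofReal.tendsto' 0 0 Complex.ofReal_zero).mono_left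
        nhdsWithin_le_nhds
    · filter_upwards [self_mem_nhdsWithin] with t ht
      exact Complex.ofReal_ne_zero.mpr (ne_of_gt ht)
  have hd : Tendsto (fun t : ℝ => (r' - r) / (t : ℂ)) (𝓝[>] 0) (𝓝 (c - c')) := by
    refine ((hr.comp hl).sub (hr'.comp hl)).congr' ?_
    filter_upwards [self_mem_nhdsWithin] with t ht
    have h0 : 0 < ((t : ℝ) : ℂ).re := by simpa using ht
    simp only [Function.comp_apply]
    rw [hf _ h0, hf' _ h0]
    ring
  have h0 : Tendsto (fun t : ℝ => (t : ℂ)) (𝓝[>] 0) (𝓝 0) := hl.mono_right nhdsWithin_le_nhds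
  have hrr : r' - r = 0 := by
    have h1 := hd.mul h0
    rw [mul_zero] at h1
    refine tendsto_nhds_unique (f := fun _ : ℝ => r' - r) tendsto_const_nhds (h1.congr' ?_)
    filter_upwards [self_mem_nhdsWithin] with t ht
    exact div_mul_cancel₀ _ (Complex.ofReal_ne_zero.mpr (ne_of_gt ht))
  rw [hrr] at hd
  simp only [zero_div] at hd
  exact sub_eq_zero.mp (tendsto_nhds_unique hd tendsto_const_nhds)

theorem IsEpsteinConst.epsteinConst_eq {Λ : Submodule ℤ (E n)} {c : ℂ}
    (h : IsEpsteinConst Λ c) : epsteinConst Λ = c := by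
  have h' : ∃ c, IsEpsteinConst Λ c := ⟨c, h⟩
  rw [epsteinConst, dif_pos h']
  exact h'.choose_spec.unique h

/-- The factor `π^w / Γ(w)`, `w = n (1 + s)`, between the zeta function and the completed zeta
function. -/
noncomputable def gammaFactor (n : ℕ) (s : ℂ) : ℂ :=
  (Real.pi : ℂ) ^ ((n : ℂ) * (1 + s)) * (Complex.Gamma (n * (1 + s)))⁻¹

theorem differentiable_gammaFactor (n : ℕ) : Differentiable ℂ (gammaFactor n) := by
  have hpi : (Real.pi : ℂ) ≠ 0 := Complex.ofReal_ne_zero.mpr Real.pi_ne_zero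
  have h1 : Differentiable ℂ fun s : ℂ => (n : ℂ) * (1 + s) := by fun_prop
  exact (h1.const_cpow (Or.inl hpi)).mul (Complex.differentiable_one_div_Gamma.comp h1)

/-- The Epstein zeta function of a lattice similar to `g ℤ^{2n}`. -/
theorem epsteinZeta_eq (hn : 1 ≤ n) {Λ : Submodule ℤ (E n)} {L c : ℝ} (hc : 0 < c)
    {g : Matrix (Fin (2 * n)) (Fin (2 * n)) ℝ} (hdet : g.det = 1) (hg : IsLower c g)
    (hg' : IsLower c g⁻¹.transpose) (e : (Fin (2 * n) → ℤ) ≃ Λ)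
    (he : ∀ z, ‖(e z : E n)‖ = Real.exp (L / (2 * n)) * matNorm g (intVec z))
    [Nonempty (Fin (2 * n))] {s : ℂ} (hs : 0 < s.re) :
    epsteinZeta Λ s = Complex.exp (-((1 + s) * L)) * gammaFactor n s *
      (thetaPair hc hdet hg hg').Λ (n * (1 + s)) := by
  have hn0 : (n : ℂ) ≠ 0 := by exact_mod_cast (by omega : n ≠ 0)
  have hnp : (0 : ℝ) < n := by exact_mod_cast hn
  set w : ℂ := n * (1 + s) with hw
  have hre : w.re = n * (1 + s.re) := by simp [hw]
  have hwre : (Fintype.card (Fin (2 * n)) : ℝ) / 2 < w.re := by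
    rw [hre, Fintype.card_fin]; push_cast; nlinarith
  have hw0 : 0 < w.re := lt_of_le_of_lt (by positivity) hwre
  have hww : -(2 * n * (1 + s)) = -(2 * w) := by rw [hw]; ring
  have hwne : -(2 * w) ≠ 0 := by
    intro h
    have h1 : w = 0 := by simpa using h
    rw [h1] at hw0; simp at hw0
  have hpi : (Real.pi : ℂ) ≠ 0 := Complex.ofReal_ne_zero.mpr Real.pi_ne_zero
  have h1 : epsteinZeta Λ s = ∑' x : Λ, ((‖(x : E n)‖ : ℝ) : ℂ) ^ (-(2 * w)) := by
    rw [epsteinZeta, hww]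
    refine tsum_subtype_eq_of_support_subset
      (f := fun x : Λ => ((‖(x : E n)‖ : ℝ) : ℂ) ^ (-(2 * w))) (s := {x | x ≠ 0}) fun x hx h0 => ?_
    refine hx ?_
    change ((‖(x : E n)‖ : ℝ) : ℂ) ^ (-(2 * w)) = 0
    rw [h0, ZeroMemClass.coe_zero, norm_zero, Complex.ofReal_zero, Complex.zero_cpow hwne]
  have h2 := (hasSum_matNorm_cpow hc hdet hg hg' hwre).tsum_eq
  rw [h1, ← e.tsum_eq, ← h2, ← tsum_mul_left]
  refine tsum_congr fun z => ?_
  have hN : 0 ≤ matNorm g (intVec z) := norm_nonneg _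
  have hG : Complex.Gamma w ≠ 0 := Complex.Gamma_ne_zero_of_re_pos hw0
  rw [he, Complex.ofReal_mul, Complex.mul_cpow_ofReal_nonneg (Real.exp_pos _).le hN, gammaFactor,
    ← hw]
  have e1 : ((Real.exp (L / (2 * n)) : ℝ) : ℂ) ^ (-(2 * w)) = Complex.exp (-((1 + s) * L)) := by
    rw [Complex.cpow_def_of_ne_zero (Complex.ofReal_ne_zero.mpr (Real.exp_pos _).ne'),
      ← Complex.ofReal_log (Real.exp_pos _).le, Real.log_exp, hw]
    congr 1
    push_cast; field_simp
  have e2 : ((matNorm g (intVec z) : ℝ) : ℂ) ^ (-(2 * w)) =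
      (((matNorm g (intVec z) ^ 2 : ℝ) : ℂ) ^ w)⁻¹ := by
    rw [Complex.cpow_neg, Complex.ofReal_pow, ← Complex.cpow_nat_mul', Nat.cast_ofNat]
    all_goals rw [Complex.arg_ofReal_of_nonneg hN]; linarith [Real.pi_pos]
  rw [e1, e2, Complex.cpow_neg]
  have hp : (Real.pi : ℂ) ^ w ≠ 0 := by simp [Complex.cpow_eq_zero_iff, hpi]
  field_simp

/-- The constant term of the Epstein zeta function of a lattice similar to `g ℤ^{2n}`, obtained
from the poles of the completed zeta function. -/
theorem isEpsteinConst (hn : 1 ≤ n) {Λ : Submodule ℤ (E n)} {L c : ℝ} (hc : 0 < c)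
    {g : Matrix (Fin (2 * n)) (Fin (2 * n)) ℝ} (hdet : g.det = 1) (hg : IsLower c g)
    (hg' : IsLower c g⁻¹.transpose) (e : (Fin (2 * n) → ℤ) ≃ Λ)
    (he : ∀ z, ‖(e z : E n)‖ = Real.exp (L / (2 * n)) * matNorm g (intVec z))
    [Nonempty (Fin (2 * n))] :
    IsEpsteinConst Λ (Complex.exp (-L) *
      (gammaFactor n 0 * ((thetaPair hc hdet hg hg').Λ₀ n - 1 / n) +
        (deriv (gammaFactor n) 0 - L * gammaFactor n 0) / n)) := by
  have hn0 : (n : ℂ) ≠ 0 := by exact_mod_cast (by omega : n ≠ 0)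
  set P := thetaPair hc hdet hg hg' with hP
  have hPk : (P.k : ℂ) = n := by
    change (((Fintype.card (Fin (2 * n)) : ℝ) / 2 : ℝ) : ℂ) = n
    rw [Fintype.card_fin]; push_cast; ring
  have hΛ : ∀ s, P.Λ s = P.Λ₀ s - 1 / s - 1 / (n - s) := by
    intro s
    rw [WeakFEPair.Λ, hPk]
    change P.Λ₀ s - (1 / s) • (1 : ℂ) - ((1 : ℂ) / (n - s)) • (1 : ℂ) = _
    simp
  set A : ℂ → ℂ := fun s => Complex.exp (-((1 + s) * L)) * gammaFactor n s with hA
  have hAd : Differentiable ℂ A := by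
    have := differentiable_gammaFactor n
    fun_prop
  have hA' : HasDerivAt A
      (Complex.exp (-L) * (deriv (gammaFactor n) 0 - L * gammaFactor n 0)) 0 := by
    have h1 : HasDerivAt (fun s : ℂ => Complex.exp (-((1 + s) * L)))
        (Complex.exp (-((1 + 0) * L)) * -(1 * L)) 0 :=
      ((((hasDerivAt_id (0 : ℂ)).const_add 1).mul_const (L : ℂ)).neg).cexp
    refine (h1.mul (differentiable_gammaFactor n 0).hasDerivAt).congr_deriv ?_
    rw [add_zero, one_mul]
    ring
  have hlin : Differentiable ℂ fun s : ℂ => (n : ℂ) * (1 + s) := by fun_prop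
  have hΛ₀ : Differentiable ℂ fun s : ℂ => P.Λ₀ (n * (1 + s)) := P.differentiable_Λ₀.comp hlin
  refine ⟨fun s => A s * P.Λ (n * (1 + s)), fun s => ?_, fun s hs => ?_, A 0 / n, ?_⟩
  · have h1 := (hAd.analyticAt s).meromorphicAt
    have h2 := (hΛ₀.analyticAt s).meromorphicAt
    have h3 := (hlin.analyticAt s).meromorphicAt
    simp only [hΛ]
    exact h1.mul ((h2.sub ((MeromorphicAt.const 1 s).div h3)).sub
      ((MeromorphicAt.const 1 s).div ((MeromorphicAt.const (n : ℂ) s).sub h3)))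
  · exact (epsteinZeta_eq hn hc hdet hg hg' e he hs).symm
  · have h1 : Tendsto (fun s : ℂ => A s * (P.Λ₀ (n * (1 + s)) - 1 / (n * (1 + s)))) (𝓝[≠] 0)
        (𝓝 (A 0 * (P.Λ₀ (n * (1 + 0)) - 1 / (n * (1 + 0))))) := by
      have hc1 : ContinuousAt (fun s : ℂ => (n : ℂ) * (1 + s)) 0 := hlin.continuous.continuousAt
      exact (hAd.continuous.continuousAt.mul (hΛ₀.continuous.continuousAt.sub
        (continuousAt_const.div hc1 (by simpa using hn0)))).tendsto.mono_left nhdsWithin_le_nhds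
    have h2 := (hasDerivAt_iff_tendsto_slope.mp hA').div_const (n : ℂ)
    have h3 := h1.add h2
    have hA0 : A 0 = Complex.exp (-L) * gammaFactor n 0 := by simp [hA]
    rw [add_zero, mul_one, hA0, mul_assoc, mul_div_assoc, ← mul_add] at h3
    refine h3.congr' ?_
    filter_upwards [self_mem_nhdsWithin] with s hs
    have hs0 : s ≠ 0 := hs
    rw [hΛ, slope_def_field]
    have : (n : ℂ) - n * (1 + s) = -(n * s) := by ring
    rw [this, hA0, sub_zero]
    by_cases h1s : 1 + s = 0
    · rw [h1s]; field_simp; ring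
    · field_simp; ring

/-- The constant in `norm_epsteinConst_mul_le`. -/
noncomputable def epsteinBound (n : ℕ) (c : ℝ) : ℝ :=
  ‖gammaFactor n 0‖ * ((∫ t in Set.Ioi 0, majorant (Fin (2 * n)) c t) + 2) +
    ‖deriv (gammaFactor n) 0‖

/-- The constant term of the Epstein zeta function, multiplied by the covolume, grows at most
logarithmically in the covolume as long as the normalised lattice has bounded geometry. -/
theorem norm_epsteinConst_mul_le (hn : 1 ≤ n) {Λ : Submodule ℤ (E n)} {v c : ℝ} (hv : 0 < v)
    (hc : 0 < c) {g : Matrix (Fin (2 * n)) (Fin (2 * n)) ℝ} (hdet : g.det = 1) (hg : IsLower c g)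
    (hg' : IsLower c g⁻¹.transpose) (e : (Fin (2 * n) → ℤ) ≃ Λ)
    (he : ∀ z, ‖(e z : E n)‖ = v ^ (1 / (2 * n : ℝ)) * matNorm g (intVec z)) :
    ‖epsteinConst Λ * v‖ ≤ epsteinBound n c * (1 + |Real.log v|) := by
  have : Nonempty (Fin (2 * n)) := ⟨⟨0, by omega⟩⟩
  have hnp : (1 : ℝ) ≤ n := by exact_mod_cast hn
  have hnC : ‖(n : ℂ)‖ = n := Complex.norm_natCast n
  have he' : ∀ z, ‖(e z : E n)‖ = Real.exp (Real.log v / (2 * n)) * matNorm g (intVec z) := by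
    intro z
    rw [he, Real.rpow_def_of_pos hv, mul_one_div]
  rw [(isEpsteinConst hn hc hdet hg hg' e he').epsteinConst_eq]
  have hΛ := norm_thetaPair_Λ₀_le hc hdet hg hg'
  rw [show ((Fintype.card (Fin (2 * n)) : ℂ) / 2) = n by
    rw [Fintype.card_fin]; push_cast; ring] at hΛ
  rw [epsteinBound]
  set D := ∫ t in Set.Ioi 0, majorant (Fin (2 * n)) c t
  set X := (thetaPair hc hdet hg hg').Λ₀ (n : ℂ)
  set h0 := gammaFactor n 0
  set h1 := deriv (gammaFactor n) 0
  set L := Real.log v with hL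
  have hev : Complex.exp (-L) * v = 1 := by
    rw [← Complex.ofReal_neg, ← Complex.ofReal_exp, ← Complex.ofReal_mul, hL, Real.exp_neg,
      Real.exp_log hv, inv_mul_cancel₀ hv.ne', Complex.ofReal_one]
  rw [mul_right_comm, hev, one_mul]
  have hD : 0 ≤ D := (norm_nonneg _).trans hΛ
  have b1 : ‖X - 1 / n‖ ≤ D + 1 := by
    refine (norm_sub_le _ _).trans (add_le_add hΛ ?_)
    rw [norm_div, hnC, norm_one]
    exact div_le_one_of_le₀ hnp (by linarith)
  have b2 : ‖(h1 - L * h0) / n‖ ≤ ‖h1‖ + |L| * ‖h0‖ := by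
    rw [norm_div, hnC]
    refine (div_le_self (norm_nonneg _) hnp).trans ((norm_sub_le _ _).trans ?_)
    rw [norm_mul, Complex.norm_real, Real.norm_eq_abs]
  refine (norm_add_le _ _).trans ?_
  rw [norm_mul]
  have b3 := mul_le_mul_of_nonneg_left b1 (norm_nonneg h0)
  have := abs_nonneg L
  nlinarith [norm_nonneg h0, norm_nonneg h1, mul_nonneg (norm_nonneg h0) this,
    mul_nonneg (norm_nonneg h1) this, mul_nonneg (mul_nonneg (norm_nonneg h0) hD) this]

end Epstein

/-! ### Compact sets of isometry classes of unimodular lattices -/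

section Compact

variable {m : ℕ}

/-- The matrices of determinant one whose entries, and those of the inverse, are less than `k` in
absolute value. -/
def boundedSL (m : ℕ) (k : ℕ) : Set (Matrix.SpecialLinearGroup (Fin m) ℝ) :=
  {g | ∀ i j, |g.1 i j| < k ∧ |(g⁻¹).1 i j| < k}

theorem isOpen_boundedSL (k : ℕ) : IsOpen (boundedSL m k) := by
  have h1 : Continuous fun g : Matrix.SpecialLinearGroup (Fin m) ℝ => g.1 := continuous_subtype_val
  have h2 : Continuous fun g : Matrix.SpecialLinearGroup (Fin m) ℝ => (g⁻¹).1 :=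
    h1.comp continuous_inv
  simp only [boundedSL, Set.ofPred_forall]
  exact isOpen_iInter_of_finite fun i => isOpen_iInter_of_finite fun j =>
    (isOpen_lt (h1.matrix_elem i j).abs continuous_const).inter
      (isOpen_lt (h2.matrix_elem i j).abs continuous_const)

theorem exists_mem_boundedSL (g : Matrix.SpecialLinearGroup (Fin m) ℝ) :
    ∃ k, g ∈ boundedSL m k := by
  obtain ⟨k, hk⟩ := exists_nat_gt ((∑ i, ∑ j, |g.1 i j|) + ∑ i, ∑ j, |(g⁻¹).1 i j|)
  have key : ∀ (M : Matrix (Fin m) (Fin m) ℝ) (i j), |M i j| ≤ ∑ i, ∑ j, |M i j| := fun M i j =>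
    (Finset.single_le_sum (f := fun j => |M i j|) (fun _ _ => abs_nonneg _)
      (Finset.mem_univ j)).trans (Finset.single_le_sum (f := fun i => ∑ j, |M i j|)
        (fun _ _ => Finset.sum_nonneg fun _ _ => abs_nonneg _) (Finset.mem_univ i))
  have pos : ∀ M : Matrix (Fin m) (Fin m) ℝ, 0 ≤ ∑ i, ∑ j, |M i j| := fun M =>
    Finset.sum_nonneg fun _ _ => Finset.sum_nonneg fun _ _ => abs_nonneg _
  refine ⟨k, fun i j => ⟨?_, ?_⟩⟩
  · linarith [key g.1 i j, pos (g⁻¹).1]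
  · linarith [key (g⁻¹).1 i j, pos g.1]

/-- The projection to the double coset space is open. -/
theorem isOpen_image_unimodularClass {V : Set (Matrix.SpecialLinearGroup (Fin m) ℝ)}
    (hV : IsOpen V) : IsOpen (unimodularClass '' V) := by
  refine isQuotientMap_quotient_mk'.isOpen_preimage.mp ?_
  refine isOpen_iff_mem_nhds.mpr ?_
  rintro y ⟨x, hx, hxy⟩
  obtain ⟨a, ha, b, hb, rfl⟩ := DoubleCoset.rel_iff.mp (_root_.Quotient.exact hxy)
  have hc : Continuous fun y : Matrix.SpecialLinearGroup (Fin m) ℝ => a⁻¹ * y * b⁻¹ := by fun_prop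
  have hmem : a * x * b ∈ (fun y => a⁻¹ * y * b⁻¹) ⁻¹' V := by
    change a⁻¹ * (a * x * b) * b⁻¹ ∈ V
    rwa [show a⁻¹ * (a * x * b) * b⁻¹ = x by group]
  refine Filter.mem_of_superset ((hV.preimage hc).mem_nhds hmem) fun y hy => ⟨_, hy, ?_⟩
  refine _root_.Quotient.sound (DoubleCoset.rel_iff.mpr ⟨a, ha, b, hb, ?_⟩)
  group

/-- Each lattice whose class lies in a fixed compact set is isometric to a lattice `h ℤ^m` with
bounded `h` and `h⁻¹`. -/
theorem exists_bounded_representative {C : Set (UnimodularClasses m)} (hC : IsCompact C) :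
    ∃ k, ∀ g : Matrix.SpecialLinearGroup (Fin m) ℝ, unimodularClass g ∈ C →
      ∃ h ∈ boundedSL m k, ∃ a ∈ SOm m, ∃ γ : Matrix.SpecialLinearGroup (Fin m) ℤ,
        g = a * h * Matrix.SpecialLinearGroup.map (Int.castRingHom ℝ) γ := by
  obtain ⟨k, hk⟩ := hC.elim_directed_cover (fun k => unimodularClass '' boundedSL m k)
    (fun k => isOpen_image_unimodularClass (isOpen_boundedSL k))
    (fun x _ => by
      obtain ⟨g, rfl⟩ := _root_.Quotient.exists_rep x
      obtain ⟨k, hk⟩ := exists_mem_boundedSL g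
      exact Set.mem_iUnion.mpr ⟨k, g, hk, rfl⟩)
    (by
      refine Monotone.directed_le fun k l hkl => Set.image_mono fun g hg i j => ?_
      have : (k : ℝ) ≤ l := by exact_mod_cast hkl
      exact ⟨(hg i j).1.trans_le this, (hg i j).2.trans_le this⟩)
  refine ⟨k, fun g hg => ?_⟩
  obtain ⟨h, hh, hhg⟩ := hk hg
  obtain ⟨a, ha, _, ⟨γ, rfl⟩, hab⟩ := DoubleCoset.rel_iff.mp (_root_.Quotient.exact hhg)
  exact ⟨h, hh, a, ha, γ, hab⟩

theorem isLower_of_abs_le {ι : Type*} [Fintype ι] [DecidableEq ι] {A B : Matrix ι ι ℝ} {K : ℝ}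
    (hBA : B * A = 1) (hK : 0 < K) (hB : ∀ i j, |B i j| ≤ K) :
    IsLower ((Fintype.card ι : ℝ) * K)⁻¹ A := by
  intro x
  have hnn : 0 ≤ matNorm A x := norm_nonneg _
  have h1 : ‖x‖ ≤ Fintype.card ι * K * matNorm A x := by
    refine (pi_norm_le_iff_of_nonneg (by positivity)).mpr fun i => ?_
    have hx : x i = ∑ j, B i j * (A.mulVec x) j := by
      have : B.mulVec (A.mulVec x) = x := by rw [Matrix.mulVec_mulVec, hBA, Matrix.one_mulVec]
      exact (congrFun this i).symm
    rw [hx, mul_assoc, ← nsmul_eq_mul]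
    refine (norm_sum_le _ _).trans (Finset.sum_le_card_nsmul _ _ _ fun j _ => ?_)
    rw [norm_mul]
    exact mul_le_mul (hB i j) (PiLp.norm_apply_le (WithLp.toLp 2 (A.mulVec x)) j)
      (norm_nonneg _) hK.le
  rcases eq_or_lt_of_le (Nat.cast_nonneg (α := ℝ) (Fintype.card ι)) with h0 | h0
  · rw [← h0, zero_mul, inv_zero, zero_mul]
    exact hnn
  · rw [inv_mul_le_iff₀ (by positivity)]
    exact h1

theorem matNorm_orthogonal_mul {a h : Matrix (Fin m) (Fin m) ℝ}
    (ha : a ∈ Matrix.orthogonalGroup (Fin m) ℝ) (x : Fin m → ℝ) :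
    matNorm (a * h) x = matNorm h x := by
  have ha' : a.transpose * a = 1 := (Matrix.mem_orthogonalGroup_iff' _ _).mp ha
  have key : ∀ y : Fin m → ℝ, ‖(WithLp.toLp 2 y : EuclideanSpace ℝ (Fin m))‖ ^ 2 = y ⬝ᵥ y := by
    intro y
    rw [EuclideanSpace.real_norm_sq_eq]
    simp [dotProduct, pow_two]
  refine (pow_left_inj₀ (norm_nonneg _) (norm_nonneg _) two_ne_zero).mp ?_
  rw [key, key, ← Matrix.mulVec_mulVec, Matrix.dotProduct_mulVec, ← Matrix.mulVec_transpose,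
    Matrix.mulVec_mulVec, ha', Matrix.one_mulVec]

/-- A bound for `C(Λ) vol(Λ)` that is uniform over all lattices whose normalised isometry class
lies in a fixed compact set. -/
theorem exists_norm_epsteinConst_mul_le {n : ℕ} (hn : 1 ≤ n) {C : Set (UnimodularClasses (2 * n))}
    (hC : IsCompact C) : ∃ B : ℝ, ∀ (Λ : Submodule ℤ (E n)) (v : ℝ), 0 < v →
      ∀ g : Matrix.SpecialLinearGroup (Fin (2 * n)) ℝ,
        (v ^ (-(1 / (2 * n : ℝ)))) • (Λ : Set (E n)) = matrixLattice g → unimodularClass g ∈ C →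
          ‖epsteinConst Λ * v‖ ≤ B * (1 + |Real.log v|) := by
  obtain ⟨k, hk⟩ := exists_bounded_representative hC
  have hcard : 0 < Fintype.card (Fin (2 * n)) := by rw [Fintype.card_fin]; omega
  set K : ℝ := k + 1 with hKdef
  have hK : 0 < K := by positivity
  set c : ℝ := ((Fintype.card (Fin (2 * n)) : ℝ) * K)⁻¹ with hcdef
  have hc : 0 < c := by positivity
  refine ⟨epsteinBound n c, fun Λ v hv g hg hgC => ?_⟩
  obtain ⟨h, hh, a, ha, γ, rfl⟩ := hk g hgC
  have ha' : a.1 ∈ Matrix.orthogonalGroup (Fin (2 * n)) ℝ := ha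
  have hinv : (h⁻¹).1 * h.1 = 1 := by
    rw [← Matrix.SpecialLinearGroup.coe_mul, inv_mul_cancel, Matrix.SpecialLinearGroup.coe_one]
  have hlow : IsLower c h.1 := isLower_of_abs_le hinv hK fun i j => by
    have := (hh i j).2; linarith
  have hinv' : h.1⁻¹ = (h⁻¹).1 := Matrix.inv_eq_left_inv hinv
  have hlow' : IsLower c h.1⁻¹.transpose := by
    refine isLower_of_abs_le (B := h.1.transpose) ?_ hK fun i j => ?_
    · rw [← Matrix.transpose_mul, hinv', hinv, Matrix.transpose_one]
    · have := (hh j i).1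
      rw [Matrix.transpose_apply]; linarith
  set T : ℝ := v ^ (1 / (2 * n : ℝ)) with hT
  have hTpos : 0 < T := Real.rpow_pos_of_pos hv _
  have hTinv : v ^ (-(1 / (2 * n : ℝ))) = T⁻¹ := Real.rpow_neg hv.le _
  rw [hTinv] at hg
  have hmem : ∀ y : E n, y ∈ Λ ↔ T⁻¹ • y ∈ matrixLattice (a * h *
      Matrix.SpecialLinearGroup.map (Int.castRingHom ℝ) γ) := by
    intro y
    rw [← hg, Set.smul_mem_smul_set_iff₀ (inv_ne_zero hTpos.ne')]
    rfl
  have hγ : ∀ (δ : Matrix.SpecialLinearGroup (Fin (2 * n)) ℤ) (z : Fin (2 * n) → ℤ),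
      ((Matrix.SpecialLinearGroup.map (Int.castRingHom ℝ) δ).1.mulVec (intVec z)) =
        intVec (δ.1.mulVec z) := by
    intro δ z
    funext i
    simp [Matrix.mulVec, dotProduct, intVec]
  have hlat : matrixLattice (a * h * Matrix.SpecialLinearGroup.map (Int.castRingHom ℝ) γ) =
      Set.range fun z : Fin (2 * n) → ℤ =>
        (WithLp.toLp 2 ((a.1 * h.1).mulVec (intVec z)) : E n) := by
    have h1 : ∀ z : Fin (2 * n) → ℤ, ((a * h *
        Matrix.SpecialLinearGroup.map (Int.castRingHom ℝ) γ).1.mulVec (intVec z)) =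
        (a.1 * h.1).mulVec (intVec (γ.1.mulVec z)) := by
      intro z
      rw [← hγ, Matrix.mulVec_mulVec]
      rfl
    refine Set.Subset.antisymm ?_ ?_
    · rintro _ ⟨z, rfl⟩
      exact ⟨γ.1.mulVec z, congrArg (WithLp.toLp 2) (h1 z).symm⟩
    · rintro _ ⟨z, rfl⟩
      have hz : γ.1.mulVec ((γ⁻¹).1.mulVec z) = z := by
        rw [Matrix.mulVec_mulVec, ← Matrix.SpecialLinearGroup.coe_mul, mul_inv_cancel,
          Matrix.SpecialLinearGroup.coe_one, Matrix.one_mulVec]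
      refine ⟨(γ⁻¹).1.mulVec z, congrArg (WithLp.toLp 2) ((h1 _).trans ?_)⟩
      rw [hz]
  set p : (Fin (2 * n) → ℤ) → E n := fun z =>
    T • WithLp.toLp 2 ((a.1 * h.1).mulVec (intVec z)) with hp
  have hpΛ : ∀ z, p z ∈ Λ := fun z => by
    rw [hmem, hlat]
    exact ⟨z, (inv_smul_smul₀ hTpos.ne' _).symm⟩
  have hpn : ∀ z, ‖p z‖ = T * matNorm h.1 (intVec z) := fun z => by
    rw [hp, norm_smul, Real.norm_of_nonneg hTpos.le]
    exact congrArg (T * ·) (matNorm_orthogonal_mul ha' _)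
  have hdet : h.1.det = 1 := h.2
  have hbij : Function.Bijective fun z => (⟨p z, hpΛ z⟩ : Λ) := by
    constructor
    · intro z w hzw
      have h1 : p z = p w := congrArg Subtype.val hzw
      have h2 := smul_right_injective (E n) hTpos.ne' h1
      have h3 : (a.1 * h.1).mulVec (intVec z) = (a.1 * h.1).mulVec (intVec w) :=
        congrArg WithLp.ofLp h2
      refine intVec_injective (Matrix.mulVec_injective_of_isUnit
        ((Matrix.isUnit_iff_isUnit_det _).mpr ?_) h3)
      rw [Matrix.det_mul, hdet, show a.1.det = 1 from a.2, one_mul]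
      exact isUnit_one
    · rintro ⟨y, hy⟩
      rw [hmem, hlat] at hy
      obtain ⟨z, hz⟩ := hy
      refine ⟨z, Subtype.ext ?_⟩
      change T • WithLp.toLp 2 ((a.1 * h.1).mulVec (intVec z)) = y
      have hz' : WithLp.toLp 2 ((a.1 * h.1).mulVec (intVec z)) = T⁻¹ • y := hz
      rw [hz', smul_inv_smul₀ hTpos.ne']
  exact norm_epsteinConst_mul_le hn hv hc hdet hlow hlow' (Equiv.ofBijective _ hbij) hpn

end Compact

/-! ### The limits -/

namespace LorentzModel

variable {n : ℕ} {S : IwasawaGroup n}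

theorem tendsto_one_add_log_div {D : ℕ → ℕ} (hD : Tendsto D atTop atTop) {v : ℝ} (hv : 0 < v)
    (B : ℝ) : Tendsto (fun i => B * (1 + |Real.log (D i * v)|) / D i) atTop (𝓝 0) := by
  have hDr : Tendsto (fun i => (D i : ℝ)) atTop atTop := tendsto_natCast_atTop_atTop.comp hD
  have h1 : Tendsto (fun i => (D i : ℝ)⁻¹) atTop (𝓝 0) := tendsto_inv_atTop_zero.comp hDr
  have h2 : Tendsto (fun i => Real.log (D i) / D i) atTop (𝓝 0) :=
    (Real.isLittleO_log_id_atTop.tendsto_div_nhds_zero).comp hDr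
  have h3 : Tendsto (fun i => B * ((D i : ℝ)⁻¹ + |Real.log (D i) / D i + Real.log v * (D i : ℝ)⁻¹|))
      atTop (𝓝 0) := by
    have := (h1.add (h2.add (h1.const_mul (Real.log v))).abs).const_mul B
    simpa using this
  refine h3.congr' ?_
  filter_upwards [hD.eventually_ge_atTop 1] with i hi
  have hp : (0 : ℝ) < D i := by exact_mod_cast hi
  rw [Real.log_mul hp.ne' hv.ne', ← div_eq_mul_inv, ← add_div, abs_div, abs_of_pos hp,
    inv_eq_one_div, ← add_div, mul_div_assoc]

/-- A sum over the cusps of `Γ i` of terms that depend only on the cusp of `Γ₀` below is `o` of the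
index, if the terms are small compared to the index of the cusp lattices. -/
theorem tendsto_sum_div_relIndex (H : LorentzModel S) (hn : 1 ≤ n) {Γ₀ : Subgroup S.G}
    [DiscreteTopology Γ₀] {R₀ : Set (Subgroup S.G)} (hR₀ : S.IsCuspReps Γ₀ R₀)
    {Γ : ℕ → Subgroup S.G} (hle : ∀ i, Γ i ≤ Γ₀) (hnormal : ∀ i, ((Γ i).subgroupOf Γ₀).Normal)
    (hfin : ∀ i, (Γ i).relIndex Γ₀ ≠ 0) {R : ℕ → Set (Subgroup S.G)}
    (hR : ∀ i, S.IsCuspReps (Γ i) (R i)) (hR₀f : R₀.Finite) (hRf : ∀ i, (R i).Finite)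
    {a : ℕ → Subgroup S.G → ℝ} (ha : ∀ i P₀, 0 ≤ a i P₀)
    (hlim : ∀ P₀ ∈ R₀, Tendsto (fun i => a i P₀ / S.cuspIndex (Γ i) Γ₀ P₀) atTop (𝓝 0)) :
    Tendsto (fun i => (∑ P' ∈ (hRf i).toFinset, a i (conj (S.toRep Γ₀ R₀ P') P')) /
      (Γ i).relIndex Γ₀) atTop (𝓝 0) := by
  have hsum : Tendsto (fun i => ∑ P₀ ∈ hR₀f.toFinset, a i P₀ / S.cuspIndex (Γ i) Γ₀ P₀) atTop
      (𝓝 0) := by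
    have := tendsto_finsetSum hR₀f.toFinset fun P₀ hP₀ => hlim P₀ (hR₀f.mem_toFinset.mp hP₀)
    simpa using this
  refine squeeze_zero (fun i => ?_) (fun i => ?_) hsum
  · exact div_nonneg (Finset.sum_nonneg fun _ _ => ha _ _) (Nat.cast_nonneg _)
  · exact H.sum_div_relIndex_le hn hR₀ (hR i) (hle i) (hnormal i) (hfin i) hR₀f (hRf i) (a i) (ha i)

/-- At each cusp of `Γ₀` the summand of `α (Γ i)` is small compared to the index of the cusp
lattices, for a cusp-uniform sequence. -/
theorem tendsto_epsteinConst_div_cuspIndex (H : LorentzModel S) (hn : 1 ≤ n) {Γ₀ : Subgroup S.G}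
    [DiscreteTopology Γ₀] {R₀ : Set (Subgroup S.G)} (hR₀ : S.IsCuspReps Γ₀ R₀)
    {Γ : ℕ → Subgroup S.G} (hle : ∀ i, Γ i ≤ Γ₀) (hnormal : ∀ i, ((Γ i).subgroupOf Γ₀).Normal)
    (hfin : ∀ i, (Γ i).relIndex Γ₀ ≠ 0) (hfew : ∀ γ ∈ Γ₀, γ ≠ 1 → {i | γ ∈ Γ i}.Finite)
    (hunif : S.CuspUniform Γ₀ R₀ Γ) {P₀ : Subgroup S.G} (hP₀ : P₀ ∈ R₀) :
    Tendsto (fun i => ‖epsteinConst (S.cuspLattice (Γ i) P₀) *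
      (ZLattice.covolume (S.cuspLattice (Γ i) P₀) : ℂ) / (sphereVol n : ℂ)‖ /
        S.cuspIndex (Γ i) Γ₀ P₀) atTop (𝓝 0) := by
  have h₀ := hR₀.1 P₀ hP₀
  have h : ∀ i, S.IsCuspidal (Γ i) P₀ := fun i => (H.isCuspidal_iff (hle i) (hfin i) P₀).mpr h₀
  have hfix := S.conj_toRep_of_mem hR₀ hP₀
  obtain ⟨C, hC, hCu⟩ := hunif P₀ hP₀
  obtain ⟨B, hB⟩ := exists_norm_epsteinConst_mul_le hn hC
  have hv₀ : 0 < ZLattice.covolume (S.cuspLattice Γ₀ P₀) := by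
    have := h₀.2.1
    have := isZLattice_cuspLattice h₀
    exact ZLattice.covolume_pos _ _
  have hD := H.tendsto_cuspIndex hn hle hfew h h₀
  have hlim := (tendsto_one_add_log_div hD hv₀ B).div_const ‖(sphereVol n : ℂ)‖
  rw [zero_div] at hlim
  refine squeeze_zero (fun i => by positivity) (fun i => ?_) hlim
  have hv : 0 < ZLattice.covolume (S.cuspLattice (Γ i) P₀) := by
    have := (h i).2.1
    have := isZLattice_cuspLattice (h i)
    exact ZLattice.covolume_pos _ _
  obtain ⟨g, hg, hgC⟩ := hCu P₀ h₀ hfix i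
  rw [IwasawaGroup.hatLattice, S.tildeLattice_eq hR₀ (hle i) (hnormal i) h₀, hfix] at hg
  have hb := hB _ _ hv g hg hgC
  rw [norm_div, div_right_comm, ← covolume_cuspLattice (hle i) (h i) h₀]
  gcongr

/-- The two limits, for each of the two groups. -/
theorem tendsto_cusps (H : LorentzModel S) (hn : 1 ≤ n) {Γ₀ : Subgroup S.G} (hΓ₀ : IsLattice Γ₀)
    {R₀ : Set (Subgroup S.G)} (hR₀ : S.IsCuspReps Γ₀ R₀) {Γ : ℕ → Subgroup S.G}
    (hle : ∀ i, Γ i ≤ Γ₀) (hnormal : ∀ i, ((Γ i).subgroupOf Γ₀).Normal)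
    (hfin : ∀ i, (Γ i).relIndex Γ₀ ≠ 0) (hfew : ∀ γ ∈ Γ₀, γ ≠ 1 → {i | γ ∈ Γ i}.Finite)
    (hpar : ∀ i, S.ParabolicCondition (Γ i)) {R : ℕ → Set (Subgroup S.G)}
    (hR : ∀ i, S.IsCuspReps (Γ i) (R i)) :
    (∀ i, (R i).Finite) ∧
    Tendsto (fun i => ((R i).ncard : ℝ) / ((Γ i).relIndex Γ₀ : ℝ)) atTop (𝓝 0) ∧
    (S.CuspUniform Γ₀ R₀ Γ →
      Tendsto (fun i => ‖S.alpha Γ₀ R₀ (Γ i) (R i)‖ / ((Γ i).relIndex Γ₀ : ℝ)) atTop (𝓝 0)) := by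
  have hdisc : DiscreteTopology Γ₀ := hΓ₀.1
  have hRf : ∀ i, (R i).Finite := fun i =>
    H.finite_cusps hn hΓ₀ (hle i) (hfin i) (hpar i) (hR i)
  have hR₀f : R₀.Finite := H.finite_reps hR₀ (hR 0) (hle 0) (hfin 0) (hRf 0)
  refine ⟨hRf, ?_, fun hunif => ?_⟩
  · have h := H.tendsto_sum_div_relIndex hn hR₀ hle hnormal hfin hR hR₀f hRf (a := fun _ _ => 1)
      (fun _ _ => zero_le_one) fun P₀ hP₀ => by
        have hc : ∀ i, S.IsCuspidal (Γ i) P₀ := fun i =>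
          (H.isCuspidal_iff (hle i) (hfin i) P₀).mpr (hR₀.1 P₀ hP₀)
        have := tendsto_inv_atTop_zero.comp ((tendsto_natCast_atTop_atTop (R := ℝ)).comp
          (H.tendsto_cuspIndex hn hle hfew hc (hR₀.1 P₀ hP₀)))
        simpa [Function.comp_def] using this
    refine h.congr fun i => ?_
    rw [Finset.sum_const, nsmul_one, Set.ncard_eq_toFinset_card _ (hRf i)]
  · set a : ℕ → Subgroup S.G → ℝ := fun i P₀ => ‖epsteinConst (S.cuspLattice (Γ i) P₀) *
      (ZLattice.covolume (S.cuspLattice (Γ i) P₀) : ℂ) / (sphereVol n : ℂ)‖ with ha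
    have h := H.tendsto_sum_div_relIndex hn hR₀ hle hnormal hfin hR hR₀f hRf (a := a)
      (fun _ _ => norm_nonneg _) fun P₀ hP₀ =>
        H.tendsto_epsteinConst_div_cuspIndex hn hR₀ hle hnormal hfin hfew hunif hP₀
    refine squeeze_zero (fun i => by positivity) (fun i => ?_) h
    refine div_le_div_of_nonneg_right ?_ (Nat.cast_nonneg _)
    rw [IwasawaGroup.alpha, finsum_mem_eq_finite_toFinset_sum _ (hRf i)]
    refine norm_sum_le_of_le _ fun P' hP' => le_of_eq ?_
    have hcusp := (H.isCuspidal_iff (hle i) (hfin i) P').mp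
      ((hR i).1 P' ((hRf i).mem_toFinset.mp hP'))
    rw [S.tildeLattice_eq hR₀ (hle i) (hnormal i) hcusp]

end LorentzModel

end HypCusp

theorem mainTheorem8 (n : ℕ) (hn : 1 ≤ n) (S : HypCusp.IwasawaGroup n)
    (hS : S = HypCusp.lorentzGroup n ∨ S = HypCusp.spinLorentzGroup n)
    (Γ₀ : Subgroup S.G) (hΓ₀ : HypCusp.IsLattice Γ₀)
    (R₀ : Set (Subgroup S.G)) (hR₀ : S.IsCuspReps Γ₀ R₀)
    (Γ : ℕ → Subgroup S.G) (hle : ∀ i, Γ i ≤ Γ₀)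
    (hnormal : ∀ i, ((Γ i).subgroupOf Γ₀).Normal)
    (hfinite : ∀ i, (Γ i).relIndex Γ₀ ≠ 0)
    (hindex : Tendsto (fun i => (Γ i).relIndex Γ₀) atTop atTop)
    (hfew : ∀ γ ∈ Γ₀, γ ≠ 1 → {i | γ ∈ Γ i}.Finite)
    (hpar : ∀ i, S.ParabolicCondition (Γ i))
    (R : ℕ → Set (Subgroup S.G)) (hR : ∀ i, S.IsCuspReps (Γ i) (R i)) :
    (∀ i, (R i).Finite) ∧
    Tendsto (fun i => ((R i).ncard : ℝ) / ((Γ i).relIndex Γ₀ : ℝ)) atTop (𝓝 0) ∧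
    (S.CuspUniform Γ₀ R₀ Γ →
      Tendsto (fun i => ‖S.alpha Γ₀ R₀ (Γ i) (R i)‖ / ((Γ i).relIndex Γ₀ : ℝ)) atTop (𝓝 0)) := by
  obtain ⟨H⟩ : Nonempty (HypCusp.LorentzModel S) := by
    rcases hS with rfl | rfl
    · exact ⟨HypCusp.lorentzModel n⟩
    · exact ⟨HypCusp.spinLorentzModel n⟩
  exact H.tendsto_cusps hn hΓ₀ hR₀ hle hnormal hfinite hfew hpar hR
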